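/- Let $G=(V,E)$ be a finite simple graph with $n\ge 1$ nodes and $m$ edges, given by adjacency lists, and let $\lambda\in[0,1]$. A wedge of $G$ is a triple of distinct vertices $(x,y,z)$ with $xy\in E$, $yz\in E$, $xz\notin E$. The wedge graph $Z(G)$ has as nodes the edges of $G$ that contribute to at least one wedge; two nodes are adjacent if the corresponding edges $xy$, $yz$ form a wedge. Let $n'$ and $m'$ be the numbers of nodes and edges of $Z(G)$. The procedure Apr-MinSTC, applied to a graph $F$, builds $Z(F)$, finds a maximal matching of $Z(F)$, labels as weak the edges of $F$ that are endpoints (in $Z(F)$) of matching edges, and labels all other edges of $F$ strong. The algorithm STC-Peel on $(G,\lambda)$ does the following, with arbitrary choices and ties resolved arbitrarily: (1) label $G$ by Apr-MinSTC; (2) let $H$ be $G$ with weight $1$ on strong and $\lambda$ on weak edges; (3) starting from $V$, repeatedly remove a vertex of minimum weighted degree in the current induced subgraph of $H$, and let $U$ be a set of maximum density (total weight of the edges inside the set divided by its size) among the non-empty sets produced, $V$ included; (4) label the induced subgraph $G(U)$ by Apr-MinSTC, and return $U$ with this labeling. Then STC-Peel can be implemented, on a random access machine with words of $O(\log n)$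 bits and unit-cost exact real arithmetic and comparisons (for the weights), by one program that runs in time $$O\Big(\sum_{v\in V}\deg(v)^2+(m+n\log n)+(m'+n')\Big),$$ where the constants are absolute (independent of $G$, $\lambda$ and the order of the adjacency lists) and a constant number of steps is allowed for $n=1$. The time includes the construction of the wedge graphs $Z(G)$ and $Z(G(U))$, both labelings by maximal matchings, the construction of $H$, and the peeling. Moreover, on every class of graphs with $\log n=O(m)$ (for instance, graphs without isolated vertices), this bound is in $O(nm)$: for every real $K$ there is a $C$ such that every graph with $\log n\le K m$ satisfies $$\sum_{v\in V}\deg(v)^2+(m+n\log n)+(m'+n')\le C\,nm .$$ -/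

import Mathlib

namespace STCPeel

/-! ## Wedge graphs -/

section Graph

variable {V : Type*}

/-- `(x, y, z)` is a wedge: `xy` and `yz` are edges, `x ≠ z`, and `xz` is not an edge. -/
def IsWedge (G : SimpleGraph V) (x y z : V) : Prop :=
  G.Adj x y ∧ G.Adj y z ∧ x ≠ z ∧ ¬ G.Adj x z

theorem IsWedge.symm {G : SimpleGraph V} {x y z : V} (h : IsWedge G x y z) : IsWedge G z y x :=
  ⟨h.2.1.symm, h.1.symm, h.2.2.1.symm, fun k => h.2.2.2 k.symm⟩

/-- The nodes of `Z(G)`: the edges of `G` that contribute to at least one wedge. -/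
def wedgeVerts (G : SimpleGraph V) : Set (Sym2 V) :=
  {e | ∃ x y z, IsWedge G x y z ∧ (e = s(x, y) ∨ e = s(y, z))}

/-- The wedge graph `Z(G)`: two nodes are joined when the two edges of `G` form a wedge. -/
def wedgeGraph (G : SimpleGraph V) : SimpleGraph (wedgeVerts G) where
  Adj e f := ∃ x y z, IsWedge G x y z ∧ e.1 = s(x, y) ∧ f.1 = s(y, z)
  symm := ⟨by
    rintro e f ⟨x, y, z, h, he, hf⟩
    exact ⟨z, y, x, h.symm, by rw [hf, Sym2.eq_swap], by rw [he, Sym2.eq_swap]⟩⟩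
  loopless := ⟨by
    rintro e ⟨x, y, z, h, he, hf⟩
    rw [he, Sym2.eq_swap] at hf
    exact h.2.2.1 (Sym2.congr_right.mp hf)⟩

/-- `G(U)`, kept on the vertex set of `G`: the edges of `G` with both endpoints in `U`. -/
def sub (G : SimpleGraph V) (U : Finset V) : SimpleGraph V :=
  (G.induce (U : Set V)).spanningCoe

/-! ## The algorithm STC-Peel as a relation between its input and its results

Ties and arbitrary choices are resolved in any way. A labeling is given by its set of weak edges;
the other edges are strong. -/

/-- `weak` is a possible result of Apr-MinSTC on `G`: the weak edges are the endpoints, in the wedge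
graph, of the edges of a maximal matching of the wedge graph. -/
def IsAprMinSTC (G : SimpleGraph V) (weak : Set (Sym2 V)) : Prop :=
  ∃ M : (wedgeGraph G).Subgraph,
    Maximal (fun M' : (wedgeGraph G).Subgraph => M'.IsMatching) M ∧ weak = Subtype.val '' M.verts

open Classical in
/-- Edge weights: `lam` for weak edges and `1` for strong edges. -/
noncomputable def weight (weak : Set (Sym2 V)) (lam : ℝ) (e : Sym2 V) : ℝ :=
  if e ∈ weak then lam else 1

open Classical in
/-- Weighted degree of `v` inside `U`. -/
noncomputable def wdeg (G : SimpleGraph V) (w : Sym2 V → ℝ) (U : Finset V) (v : V) : ℝ :=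
  ∑ u ∈ U with G.Adj v u, w s(v, u)

open Classical in
/-- Density of `U`: total weight of the edges inside `U`, divided by the size of `U`. -/
noncomputable def density [Fintype V] (G : SimpleGraph V) (w : Sym2 V → ℝ) (U : Finset V) : ℝ :=
  (∑ e ∈ (sub G U).edgeFinset, w e) / (U.card : ℝ)

end Graph

/-- What is left after the first `i` vertices of the removal order have been removed. -/
def remaining {n : ℕ} (order : Equiv.Perm (Fin n)) (i : ℕ) : Finset (Fin n) :=
  Finset.univ.filter fun v => i ≤ (order.symm v : ℕ)

/-- In every round a vertex of minimum weighted degree among the remaining ones is removed. -/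
def IsPeelOrder {n : ℕ} (G : SimpleGraph (Fin n)) (w : Sym2 (Fin n) → ℝ)
    (order : Equiv.Perm (Fin n)) : Prop :=
  ∀ i : Fin n, ∀ v ∈ remaining order i,
    wdeg G w (remaining order i) (order i) ≤ wdeg G w (remaining order i) v

/-- `U` is a densest one among the (non-empty) vertex sets produced by the removal order. -/
def IsBestRemaining {n : ℕ} (G : SimpleGraph (Fin n)) (w : Sym2 (Fin n) → ℝ)
    (order : Equiv.Perm (Fin n)) (U : Finset (Fin n)) : Prop :=
  ∃ i : Fin n, U = remaining order i ∧
    ∀ j : Fin n, density G w (remaining order j) ≤ density G w U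

/-- A run of STC-Peel on `(G, lam)`: a labeling `weak` of `G`, a removal order of the graph `H`
weighted by that labeling, a densest set `U`, and a labeling `weak'` of `G(U)`. -/
structure IsRun {n : ℕ} (G : SimpleGraph (Fin n)) (lam : ℝ) (weak : Set (Sym2 (Fin n)))
    (order : Equiv.Perm (Fin n)) (U : Finset (Fin n)) (weak' : Set (Sym2 (Fin n))) : Prop where
  label : IsAprMinSTC G weak
  peel : IsPeelOrder G (weight weak lam) order
  best : IsBestRemaining G (weight weak lam) order U
  relabel : IsAprMinSTC (sub G U) weak'

/-! ## The machine model

A random access machine in structured form. It has word variables and word arrays, whose entries are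
natural numbers below a word bound `W` (a machine word), and real variables and real arrays with
exact arithmetic and comparison (the weights are reals). Reals cannot be turned into words. A program
is a fixed finite text, so it uses finitely many variables and arrays. -/

structure State where
  /-- word variables -/
  w : ℕ → ℕ
  /-- word arrays -/
  a : ℕ → ℕ → ℕ
  /-- real variables -/
  r : ℕ → ℝ
  /-- real arrays -/
  ra : ℕ → ℕ → ℝ

/-- Word expressions. -/
inductive WExp where
  | const (c : ℕ)
  | var (x : ℕ)
  | arr (A : ℕ) (i : WExp)
  | add (e f : WExp)
  | sub (e f : WExp)
  | mul (e f : WExp)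
  | div (e f : WExp)

/-- Real expressions. -/
inductive RExp where
  | ofWord (e : WExp)
  | var (x : ℕ)
  | arr (A : ℕ) (i : WExp)
  | add (e f : RExp)
  | sub (e f : RExp)
  | mul (e f : RExp)
  | div (e f : RExp)

/-- Tests. -/
inductive Test where
  | lt (e f : WExp)
  | eq (e f : WExp)
  | rlt (e f : RExp)
  | not (b : Test)
  | and (b c : Test)

/-- Programs. -/
inductive Cmd where
  | skip
  | set (x : ℕ) (e : WExp)
  | store (A : ℕ) (i e : WExp)
  | rset (x : ℕ) (e : RExp)
  | rstore (A : ℕ) (i : WExp) (e : RExp)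
  | seq (p q : Cmd)
  | cond (b : Test) (p q : Cmd)
  | loop (b : Test) (p : Cmd)

def WExp.eval (s : State) : WExp → ℕ
  | const c => c
  | var x => s.w x
  | arr A i => s.a A (i.eval s)
  | add e f => e.eval s + f.eval s
  | sub e f => e.eval s - f.eval s
  | mul e f => e.eval s * f.eval s
  | div e f => e.eval s / f.eval s

/-- Number of elementary operations in the evaluation. -/
def WExp.cost : WExp → ℕ
  | const _ => 1
  | var _ => 1
  | arr _ i => i.cost + 1
  | add e f => e.cost + f.cost + 1
  | sub e f => e.cost + f.cost + 1
  | mul e f => e.cost + f.cost + 1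
  | div e f => e.cost + f.cost + 1

noncomputable def RExp.eval (s : State) : RExp → ℝ
  | ofWord e => (e.eval s : ℝ)
  | var x => s.r x
  | arr A i => s.ra A (i.eval s)
  | add e f => e.eval s + f.eval s
  | sub e f => e.eval s - f.eval s
  | mul e f => e.eval s * f.eval s
  | div e f => e.eval s / f.eval s

def RExp.cost : RExp → ℕ
  | ofWord e => e.cost + 1
  | var _ => 1
  | arr _ i => i.cost + 1
  | add e f => e.cost + f.cost + 1
  | sub e f => e.cost + f.cost + 1
  | mul e f => e.cost + f.cost + 1
  | div e f => e.cost + f.cost + 1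

def Test.holds (s : State) : Test → Prop
  | lt e f => e.eval s < f.eval s
  | eq e f => e.eval s = f.eval s
  | rlt e f => e.eval s < f.eval s
  | not b => ¬ b.holds s
  | and b c => b.holds s ∧ c.holds s

def Test.cost : Test → ℕ
  | lt e f => e.cost + f.cost + 1
  | eq e f => e.cost + f.cost + 1
  | rlt e f => e.cost + f.cost + 1
  | not b => b.cost + 1
  | and b c => b.cost + c.cost + 1

/-- `Exec W p s t s'`: on a machine with word bound `W`, program `p` started in state `s` halts in
state `s'` after exactly `t` elementary steps. An assignment of a word that is not below `W` cannot
be executed. (The intermediate values of an expression are bounded by a power of `W` that depends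
only on the program text, so they occupy a constant number of words.) -/
inductive Exec (W : ℕ) : Cmd → State → ℕ → State → Prop where
  | skip (s : State) : Exec W .skip s 1 s
  | set (s : State) (x : ℕ) (e : WExp) (h : e.eval s < W) :
      Exec W (.set x e) s (e.cost + 1) { s with w := Function.update s.w x (e.eval s) }
  | store (s : State) (A : ℕ) (i e : WExp) (h : e.eval s < W) :
      Exec W (.store A i e) s (i.cost + e.cost + 1)
        { s with a := Function.update s.a A (Function.update (s.a A) (i.eval s) (e.eval s)) }
  | rset (s : State) (x : ℕ) (e : RExp) :
      Exec W (.rset x e) s (e.cost + 1) { s with r := Function.update s.r x (e.eval s) }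
  | rstore (s : State) (A : ℕ) (i : WExp) (e : RExp) :
      Exec W (.rstore A i e) s (i.cost + e.cost + 1)
        { s with ra := Function.update s.ra A (Function.update (s.ra A) (i.eval s) (e.eval s)) }
  | seq {p q : Cmd} {s s₁ s₂ : State} {t₁ t₂ : ℕ} (h₁ : Exec W p s t₁ s₁)
      (h₂ : Exec W q s₁ t₂ s₂) : Exec W (.seq p q) s (t₁ + t₂) s₂
  | condTrue {b : Test} {p q : Cmd} {s s' : State} {t : ℕ} (hb : b.holds s)
      (h : Exec W p s t s') : Exec W (.cond b p q) s (b.cost + t) s'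
  | condFalse {b : Test} {p q : Cmd} {s s' : State} {t : ℕ} (hb : ¬ b.holds s)
      (h : Exec W q s t s') : Exec W (.cond b p q) s (b.cost + t) s'
  | loopTrue {b : Test} {p : Cmd} {s s₁ s₂ : State} {t₁ t₂ : ℕ} (hb : b.holds s)
      (h₁ : Exec W p s t₁ s₁) (h₂ : Exec W (.loop b p) s₁ t₂ s₂) :
      Exec W (.loop b p) s (b.cost + t₁ + t₂) s₂
  | loopFalse {b : Test} {p : Cmd} {s : State} (hb : ¬ b.holds s) :
      Exec W (.loop b p) s b.cost s

/-! ## Input and output conventions -/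

/-- Adjacency list representation of a graph `H` whose nodes are numbered by `name`: the numbers of
the neighbours of node `i` stand, once each and in any order, in
`nb (off i), …, nb (off (i + 1) - 1)`. -/
structure IsAdjList {X : Type*} {N : ℕ} (H : SimpleGraph X) (name : Fin N ≃ X)
    (off nb : ℕ → ℕ) : Prop where
  zero : off 0 = 0
  mono : ∀ i : Fin N, off i ≤ off (i + 1)
  sound : ∀ i : Fin N, ∀ p, off i ≤ p → p < off (i + 1) →
    ∃ j : Fin N, nb p = j ∧ H.Adj (name i) (name j)
  complete : ∀ i j : Fin N, H.Adj (name i) (name j) →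
    ∃! p, off i ≤ p ∧ p < off (i + 1) ∧ nb p = j

/-- `off`, `nb` are adjacency lists of the input graph; unused cells hold `0`. -/
structure IsInput {n : ℕ} (G : SimpleGraph (Fin n)) (off nb : ℕ → ℕ) : Prop where
  adj : IsAdjList G (Equiv.refl (Fin n)) off nb
  off_unused : ∀ i, n < i → off i = 0
  nb_unused : ∀ p, off n ≤ p → nb p = 0

/-- Start: `n` in word variable 0, the adjacency lists in word arrays 0 and 1, `lam` in real
variable 0, and `0` everywhere else. -/
def initState (n : ℕ) (lam : ℝ) (off nb : ℕ → ℕ) : State where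
  w x := if x = 0 then n else 0
  a A := if A = 0 then off else if A = 1 then nb else fun _ => 0
  r x := if x = 0 then lam else 0
  ra _ _ := 0

/-- The wedge graph of `G` in memory: its nodes are numbered `0, …, N - 1`, node `i` is the edge of
`G` with endpoints `x i` and `y i`, and `off`, `nb` are adjacency lists. -/
def IsWedgeGraphArrays {n : ℕ} (G : SimpleGraph (Fin n)) (N : ℕ) (x y off nb : ℕ → ℕ) : Prop :=
  ∃ name : Fin N ≃ wedgeVerts G,
    (∀ i : Fin N, (name i).1.map (fun v : Fin n => (v : ℕ)) = s(x i, y i)) ∧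
    IsAdjList (wedgeGraph G) name off nb

/-- A function `f` on edges in memory: `arr p` is the value at the edge that entry `p` of the input
adjacency lists stands for. -/
def IsEdgeArray {n : ℕ} {α : Type*} (G : SimpleGraph (Fin n)) (off nb : ℕ → ℕ)
    (f : Sym2 (Fin n) → α) (arr : ℕ → α) : Prop :=
  ∀ u v : Fin n, G.Adj u v → ∀ p, off u ≤ p → p < off (u + 1) → nb p = v → arr p = f s(u, v)

/-- The final memory holds all the results of a run of STC-Peel: the wedge graph of `G`, the labeling
of `G` (`1` for weak, `0` for strong), the weighted graph `H`, the removal order, the set `U`, the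
wedge graph of `G(U)` and the labeling of `G(U)`. -/
def IsOutput {n : ℕ} (G : SimpleGraph (Fin n)) (lam : ℝ) (off nb : ℕ → ℕ) (s : State) : Prop :=
  ∃ (weak : Set (Sym2 (Fin n))) (order : Equiv.Perm (Fin n)) (U : Finset (Fin n))
    (weak' : Set (Sym2 (Fin n))),
    IsRun G lam weak order U weak' ∧
    IsWedgeGraphArrays G (s.w 1) (s.a 2) (s.a 3) (s.a 4) (s.a 5) ∧
    IsEdgeArray G off nb (weak.indicator fun _ => 1) (s.a 6) ∧
    IsEdgeArray G off nb (weight weak lam) (s.ra 0) ∧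
    (∀ i : Fin n, s.a 7 i = order i) ∧
    (∀ v : Fin n, s.a 8 v = if v ∈ U then 1 else 0) ∧
    IsWedgeGraphArrays (sub G U) (s.w 2) (s.a 9) (s.a 10) (s.a 11) (s.a 12) ∧
    IsEdgeArray (sub G U) off nb (weak'.indicator fun _ => 1) (s.a 13)

open Classical in
/-- `Σ_v deg(v)² + (m + n log n) + (m' + n')`. -/
noncomputable def timeBound {n : ℕ} (G : SimpleGraph (Fin n)) : ℝ :=
  ∑ v, (G.degree v : ℝ) ^ 2 + ((G.edgeSet.ncard : ℝ) + n * Real.log n) +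
    (((wedgeGraph G).edgeSet.ncard : ℝ) + ((wedgeVerts G).ncard : ℝ))

end STCPeel

namespace STCPeel

/-! ## Weakest preconditions with step counts -/

-- The program runs in time proportional to `size G`, the sum of `(deg v + 1)²`, and needs no heap
-- with logarithmic operations. The term `n log n` of the bound only has to pay for the summand `n`
-- hidden in `size G` (`size_le_timeBound`).
--
-- Wedges. A wedge is a centre together with an ordered pair of its neighbours, so all candidates
-- are visited in `Σ deg²` rounds, each decided in constant time by an adjacency matrix. Memory
-- starts as zero and the matrices are touched only at adjacent pairs, so no quadratic
-- initialisation is needed, and the matrices can be reused for `G(U)`. During the same scan a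
-- matching of the wedge graph grows greedily: a wedge with both edges free joins it. In the end
-- every edge of the wedge graph has a matched endpoint, which makes the matching maximal
-- (`ScanInv.step`, `maximal_isMatching_of_forall`). The neighbours of `xy` in the wedge graph are
-- the edges completing a wedge at `x` or at `y`, so its list costs `deg x + deg y`, again `O(Σ
-- deg²)` in total (`Numbering.nbrIds_eq`, `sum_nbrs_degree_add`).
--
-- Peeling. Weights are only `1` and `lam`, so a weighted degree is `a + lam * b`, where `a` and `b`
-- count strong and weak edges and `a + b ≤ deg` (`wdeg_eq`, `count_strong_add_count_weak_le`).
-- Vertices are filed in the cells `(a, b)` of a grid, organised as a tree in which `(a, b)` has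
-- depth `a + b` and every cell stores the minimum of its subtree. A key change repairs one path to
-- the root, and the minimum is read off at the root (`wp_repair`, `Queue.min`). Removing `v`
-- changes the key of each remaining neighbour `x` at cost `O(deg x + 1)`, and `Σ_v Σ_{x ~ v} deg x
-- = Σ deg²` (`wp_peel`, `sum_removalTime_le`). The densities are then recovered backwards from the
-- recorded degrees of the removed vertices (`inside_erase`, `wp_findBest`).
--
-- For the second claim, `Σ deg² ≤ 2nm`, `m' ≤ Σ deg²` and `n' ≤ m` (`timeBound_le`).

infixr:60 " ;; " => Cmd.seq

namespace State

/-- Assignment to a word variable. -/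
def setW (s : State) (x v : ℕ) : State := { s with w := Function.update s.w x v }

/-- Assignment to a cell of a word array. -/
def setA (s : State) (A i v : ℕ) : State :=
  { s with a := Function.update s.a A (Function.update (s.a A) i v) }

/-- Assignment to a real variable. -/
noncomputable def setR (s : State) (x : ℕ) (v : ℝ) : State :=
  { s with r := Function.update s.r x v }

/-- Assignment to a cell of a real array. -/
noncomputable def setRA (s : State) (A i : ℕ) (v : ℝ) : State :=
  { s with ra := Function.update s.ra A (Function.update (s.ra A) i v) }

variable (s : State) (x y v A B i : ℕ) (c : ℝ)

@[simp] theorem setW_w : (s.setW x v).w y = if y = x then v else s.w y := by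
  simp [setW, Function.update_apply]
@[simp] theorem setW_a : (s.setW x v).a = s.a := rfl
@[simp] theorem setW_r : (s.setW x v).r = s.r := rfl
@[simp] theorem setW_ra : (s.setW x v).ra = s.ra := rfl
@[simp] theorem setA_w : (s.setA A i v).w = s.w := rfl
@[simp] theorem setA_a_self : (s.setA A i v).a A = Function.update (s.a A) i v := by
  simp [setA]
@[simp] theorem setA_a_of_ne (h : B ≠ A) : (s.setA A i v).a B = s.a B := by
  simp [setA, h]
@[simp] theorem setA_r : (s.setA A i v).r = s.r := rfl
@[simp] theorem setA_ra : (s.setA A i v).ra = s.ra := rfl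
@[simp] theorem setR_w : (s.setR x c).w = s.w := rfl
@[simp] theorem setR_a : (s.setR x c).a = s.a := rfl
@[simp] theorem setR_r : (s.setR x c).r y = if y = x then c else s.r y := by
  simp [setR, Function.update_apply]
@[simp] theorem setR_ra : (s.setR x c).ra = s.ra := rfl
@[simp] theorem setRA_w : (s.setRA A i c).w = s.w := rfl
@[simp] theorem setRA_a : (s.setRA A i c).a = s.a := rfl
@[simp] theorem setRA_r : (s.setRA A i c).r = s.r := rfl
@[simp] theorem setRA_ra_self : (s.setRA A i c).ra A = Function.update (s.ra A) i c := by
  simp [setRA]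
@[simp] theorem setRA_ra_of_ne (h : B ≠ A) : (s.setRA A i c).ra B = s.ra B := by
  simp [setRA, h]

/-- All words of the state fit into a machine word. -/
structure Bdd (W : ℕ) (s : State) : Prop where
  w : ∀ x, s.w x < W
  a : ∀ A i, s.a A i < W

end State

/-- `p`, started in `s`, halts after some number of steps `t` in some state `s'` with `Q t s'`. -/
def WP (W : ℕ) (p : Cmd) (s : State) (Q : ℕ → State → Prop) : Prop :=
  ∃ t s', Exec W p s t s' ∧ Q t s'

section Rules

variable {W : ℕ} {p q : Cmd} {s : State} {Q Q' : ℕ → State → Prop}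

theorem WP.mono (h : WP W p s Q) (hQ : ∀ t s', Q t s' → Q' t s') : WP W p s Q' := by
  obtain ⟨t, s', he, hq⟩ := h
  exact ⟨t, s', he, hQ _ _ hq⟩

theorem wp_skip : WP W .skip s Q ↔ Q 1 s := by
  constructor
  · rintro ⟨t, s', he, hq⟩
    cases he
    exact hq
  · exact fun h => ⟨_, _, .skip s, h⟩

theorem wp_set {x : ℕ} {e : WExp} :
    WP W (.set x e) s Q ↔ e.eval s < W ∧ Q (e.cost + 1) (s.setW x (e.eval s)) := by
  constructor
  · rintro ⟨t, s', he, hq⟩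
    cases he with
    | set _ _ _ h => exact ⟨h, hq⟩
  · exact fun h => ⟨_, _, .set s x e h.1, h.2⟩

theorem wp_store {A : ℕ} {i e : WExp} :
    WP W (.store A i e) s Q ↔
      e.eval s < W ∧ Q (i.cost + e.cost + 1) (s.setA A (i.eval s) (e.eval s)) := by
  constructor
  · rintro ⟨t, s', he, hq⟩
    cases he with
    | store _ _ _ _ h => exact ⟨h, hq⟩
  · exact fun h => ⟨_, _, .store s A i e h.1, h.2⟩

theorem wp_rset {x : ℕ} {e : RExp} :
    WP W (.rset x e) s Q ↔ Q (e.cost + 1) (s.setR x (e.eval s)) := by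
  constructor
  · rintro ⟨t, s', he, hq⟩
    cases he with
    | rset _ _ _ => exact hq
  · exact fun h => ⟨_, _, .rset s x e, h⟩

theorem wp_rstore {A : ℕ} {i : WExp} {e : RExp} :
    WP W (.rstore A i e) s Q ↔ Q (i.cost + e.cost + 1) (s.setRA A (i.eval s) (e.eval s)) := by
  constructor
  · rintro ⟨t, s', he, hq⟩
    cases he with
    | rstore _ _ _ _ => exact hq
  · exact fun h => ⟨_, _, .rstore s A i e, h⟩

theorem wp_seq :
    WP W (p ;; q) s Q ↔ WP W p s fun t s' => WP W q s' fun t' s'' => Q (t + t') s'' := by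
  constructor
  · rintro ⟨t, s', he, hq⟩
    cases he with
    | seq h₁ h₂ => exact ⟨_, _, h₁, _, _, h₂, hq⟩
  · rintro ⟨t, s', h₁, t', s'', h₂, hq⟩
    exact ⟨_, _, .seq h₁ h₂, hq⟩

theorem wp_cond {b : Test} :
    WP W (.cond b p q) s Q ↔
      (b.holds s → WP W p s fun t s' => Q (b.cost + t) s') ∧
      (¬ b.holds s → WP W q s fun t s' => Q (b.cost + t) s') := by
  constructor
  · rintro ⟨t, s', he, hq⟩
    cases he with
    | condTrue hb h => exact ⟨fun _ => ⟨_, _, h, hq⟩, fun k => absurd hb k⟩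
    | condFalse hb h => exact ⟨fun k => absurd k hb, fun _ => ⟨_, _, h, hq⟩⟩
  · rintro ⟨h₁, h₂⟩
    by_cases hb : b.holds s
    · obtain ⟨t, s', h, hq⟩ := h₁ hb
      exact ⟨_, _, .condTrue hb h, hq⟩
    · obtain ⟨t, s', h, hq⟩ := h₂ hb
      exact ⟨_, _, .condFalse hb h, hq⟩

end Rules

/-! ## What a program leaves unchanged -/

/-- Word variables that occur as targets of assignments. -/
def Cmd.modW : Cmd → ℕ → Bool
  | set y _, x => y == x
  | seq p q, x => p.modW x || q.modW x
  | cond _ p q, x => p.modW x || q.modW x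
  | loop _ p, x => p.modW x
  | _, _ => false

/-- Word arrays that occur as targets of assignments. -/
def Cmd.modA : Cmd → ℕ → Bool
  | store y _ _, x => y == x
  | seq p q, x => p.modA x || q.modA x
  | cond _ p q, x => p.modA x || q.modA x
  | loop _ p, x => p.modA x
  | _, _ => false

/-- Real variables that occur as targets of assignments. -/
def Cmd.modR : Cmd → ℕ → Bool
  | rset y _, x => y == x
  | seq p q, x => p.modR x || q.modR x
  | cond _ p q, x => p.modR x || q.modR x
  | loop _ p, x => p.modR x
  | _, _ => false

/-- Real arrays that occur as targets of assignments. -/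
def Cmd.modRA : Cmd → ℕ → Bool
  | rstore y _ _, x => y == x
  | seq p q, x => p.modRA x || q.modRA x
  | cond _ p q, x => p.modRA x || q.modRA x
  | loop _ p, x => p.modRA x
  | _, _ => false

/-- `s'` agrees with `s` on everything that `p` does not assign. -/
structure Frame (p : Cmd) (s s' : State) : Prop where
  w : ∀ x, p.modW x = false → s'.w x = s.w x
  a : ∀ x, p.modA x = false → s'.a x = s.a x
  r : ∀ x, p.modR x = false → s'.r x = s.r x
  ra : ∀ x, p.modRA x = false → s'.ra x = s.ra x

theorem Frame.refl (p : Cmd) (s : State) : Frame p s s :=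
  ⟨fun _ _ => rfl, fun _ _ => rfl, fun _ _ => rfl, fun _ _ => rfl⟩

theorem Frame.trans {p : Cmd} {s s' s'' : State} (h : Frame p s s') (h' : Frame p s' s'') :
    Frame p s s'' :=
  ⟨fun x hx => (h'.w x hx).trans (h.w x hx), fun x hx => (h'.a x hx).trans (h.a x hx),
    fun x hx => (h'.r x hx).trans (h.r x hx), fun x hx => (h'.ra x hx).trans (h.ra x hx)⟩

theorem Frame.mono {p q : Cmd} {s s' : State} (h : Frame p s s')
    (hw : ∀ x, q.modW x = false → p.modW x = false)
    (ha : ∀ x, q.modA x = false → p.modA x = false)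
    (hr : ∀ x, q.modR x = false → p.modR x = false)
    (hra : ∀ x, q.modRA x = false → p.modRA x = false) : Frame q s s' :=
  ⟨fun x hx => h.w x (hw x hx), fun x hx => h.a x (ha x hx),
    fun x hx => h.r x (hr x hx), fun x hx => h.ra x (hra x hx)⟩

theorem Frame.seq_left {p q : Cmd} {s s' : State} (h : Frame p s s') : Frame (p ;; q) s s' := by
  apply h.mono <;> intro x hx <;> simp_all [Cmd.modW, Cmd.modA, Cmd.modR, Cmd.modRA]

theorem Frame.seq_right {p q : Cmd} {s s' : State} (h : Frame q s s') : Frame (p ;; q) s s' := by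
  apply h.mono <;> intro x hx <;> simp_all [Cmd.modW, Cmd.modA, Cmd.modR, Cmd.modRA]

theorem Frame.of_setW {x v : ℕ} {e : WExp} {s : State} :
    Frame (.set x e) s (s.setW x v) := by
  refine ⟨fun y hy => ?_, fun _ _ => rfl, fun _ _ => rfl, fun _ _ => rfl⟩
  have : y ≠ x := by
    rintro rfl
    simp [Cmd.modW] at hy
  simp [this]

/-- The sets of assigned variables are Boolean functions of the program text, so for a concrete
program the side conditions of `Frame` are closed by `rfl`. This is how facts are carried past the
pieces of the program that do not touch them. -/
theorem Exec.frame {W : ℕ} {p : Cmd} {s s' : State} {t : ℕ} (h : Exec W p s t s') :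
    Frame p s s' := by
  induction h with
  | skip s => exact .refl _ _
  | set s x e h => exact Frame.of_setW
  | store s A i e h =>
    refine ⟨fun _ _ => rfl, fun y hy => ?_, fun _ _ => rfl, fun _ _ => rfl⟩
    have : y ≠ A := by
      rintro rfl
      simp [Cmd.modA] at hy
    simp [this]
  | rset s x e =>
    refine ⟨fun _ _ => rfl, fun _ _ => rfl, fun y hy => ?_, fun _ _ => rfl⟩
    have : y ≠ x := by
      rintro rfl
      simp [Cmd.modR] at hy
    simp [this]
  | rstore s A i e =>
    refine ⟨fun _ _ => rfl, fun _ _ => rfl, fun _ _ => rfl, fun y hy => ?_⟩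
    have : y ≠ A := by
      rintro rfl
      simp [Cmd.modRA] at hy
    simp [this]
  | seq _ _ ih₁ ih₂ => exact ih₁.seq_left.trans ih₂.seq_right
  | condTrue _ _ ih =>
    apply ih.mono <;> intro x hx <;> simp_all [Cmd.modW, Cmd.modA, Cmd.modR, Cmd.modRA]
  | condFalse _ _ ih =>
    apply ih.mono <;> intro x hx <;> simp_all [Cmd.modW, Cmd.modA, Cmd.modR, Cmd.modRA]
  | loopTrue _ _ _ ih₁ ih₂ => exact Frame.trans (ih₁.mono (fun _ h => h) (fun _ h => h)
      (fun _ h => h) (fun _ h => h)) ih₂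
  | loopFalse _ => exact .refl _ _

theorem State.Bdd.setW {W : ℕ} {s : State} (h : s.Bdd W) {x v : ℕ} (hv : v < W) :
    (s.setW x v).Bdd W := by
  refine ⟨fun y => ?_, h.a⟩
  rw [State.setW_w]
  split_ifs
  exacts [hv, h.w y]

theorem State.Bdd.setA {W : ℕ} {s : State} (h : s.Bdd W) {A i v : ℕ} (hv : v < W) :
    (s.setA A i v).Bdd W := by
  refine ⟨h.w, fun B j => ?_⟩
  by_cases hB : B = A
  · subst hB
    rw [State.setA_a_self, Function.update_apply]
    split_ifs
    exacts [hv, h.a _ _]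
  · rw [State.setA_a_of_ne _ _ _ _ _ hB]
    exact h.a _ _

/-- `Exec` only performs word assignments whose value is below `W`, so boundedness is an invariant.
A value read from memory can therefore be stored again without a new bound. -/
theorem Exec.bdd {W : ℕ} {p : Cmd} {s s' : State} {t : ℕ} (h : Exec W p s t s') :
    s.Bdd W → s'.Bdd W := by
  induction h with
  | skip s => exact id
  | set s x e h => exact fun k => k.setW h
  | store s A i e h => exact fun k => k.setA h
  | rset s x e => exact fun k => ⟨k.w, k.a⟩
  | rstore s A i e => exact fun k => ⟨k.w, k.a⟩
  | seq _ _ ih₁ ih₂ => exact fun k => ih₂ (ih₁ k)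
  | condTrue _ _ ih => exact ih
  | condFalse _ _ ih => exact ih
  | loopTrue _ _ _ ih₁ ih₂ => exact fun k => ih₂ (ih₁ k)
  | loopFalse _ => exact id

theorem WP.strengthen {W : ℕ} {p : Cmd} {s : State} {Q Q' : ℕ → State → Prop}
    (h : WP W p s Q) (hb : s.Bdd W)
    (hQ : ∀ t s', Q t s' → Frame p s s' → s'.Bdd W → Q' t s') : WP W p s Q' := by
  obtain ⟨t, s', he, hq⟩ := h
  exact ⟨t, s', he, hQ _ _ hq he.frame (he.bdd hb)⟩

/-! ## Counting loops -/

/-- `while x < h do (body; x := x + 1)` -/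
def countTo (x h : ℕ) (body : Cmd) : Cmd :=
  .loop (.lt (.var x) (.var h)) (body ;; .set x (.add (.var x) (.const 1)))

/-- Induction on the number of rounds left. The 7 steps of overhead are 3 for the test and 4 for the
increment; the final failing test costs the last 3. -/
theorem wp_countTo {W x h : ℕ} {body : Cmd} {s : State} (I : ℕ → ℕ → State → Prop)
    (hx : body.modW x = false) (hh : body.modW h = false) (hxh : x ≠ h) (hb : s.Bdd W)
    (hle : s.w x ≤ s.w h) (h0 : I (s.w x) 0 s)
    (step : ∀ i t s₁, s.w x ≤ i → i < s.w h → Frame (countTo x h body) s s₁ → s₁.Bdd W →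
      s₁.w x = i → I i t s₁ →
      WP W body s₁ fun t' s₂ => I (i + 1) (t + (t' + 7)) (s₂.setW x (i + 1))) :
    WP W (countTo x h body) s fun t s' => ∃ t', t = t' + 3 ∧ I (s.w h) t' s' := by
  have hmod : (countTo x h body).modW h = false := by
    have : (x == h) = false := by simpa using hxh
    simp [countTo, Cmd.modW, hh, this]
  suffices H : ∀ d i t₀ s₁, d = s.w h - i → s.w x ≤ i → i ≤ s.w h → Frame (countTo x h body) s s₁ →
      s₁.Bdd W → s₁.w x = i → I i t₀ s₁ → WP W (countTo x h body) s₁ fun t s' =>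
        ∃ t', t₀ + t = t' + 3 ∧ I (s.w h) t' s' by
    simpa using H _ _ 0 s rfl le_rfl hle (.refl _ _) hb rfl h0
  intro d
  induction d with
  | zero =>
    intro i t₀ s₁ hd hi hi' hf hb₁ hx₁ hI
    obtain rfl : i = s.w h := by omega
    refine ⟨_, _, .loopFalse ?_, t₀, ?_, hI⟩
    · simp [Test.holds, WExp.eval, hx₁, hf.w h hmod]
    · simp [Test.cost, WExp.cost]
  | succ d ih =>
    intro i t₀ s₁ hd hi hi' hf hb₁ hx₁ hI
    have hlt : i < s.w h := by omega
    obtain ⟨t, s₂, he, hI₂⟩ := step i t₀ s₁ hi hlt hf hb₁ hx₁ hI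
    have hx₂ : s₂.w x = i := by rw [he.frame.w x hx, hx₁]
    have hset : Exec W (.set x (.add (.var x) (.const 1))) s₂ 4 (s₂.setW x (i + 1)) := by
      have := Exec.set (W := W) s₂ x (.add (.var x) (.const 1))
        (by simp only [WExp.eval, hx₂]; exact lt_of_le_of_lt hlt (hb.w h))
      simp only [WExp.eval, WExp.cost, hx₂] at this
      exact this
    have hseq := Exec.seq he hset
    obtain ⟨t', s', he', t'', ht'', hI'⟩ := ih (i + 1) (t₀ + (t + 7)) (s₂.setW x (i + 1))
      (by omega) (by omega) hlt
      (hf.trans (hseq.frame.mono (fun _ h => h) (fun _ h => h) (fun _ h => h) (fun _ h => h)))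
      (hseq.bdd hb₁) (by simp) hI₂
    refine ⟨_, _, .loopTrue ?_ hseq he', t'', ?_, hI'⟩
    · simp [Test.holds, WExp.eval, hx₁, hf.w h hmod, hlt]
    · simp only [Test.cost, WExp.cost]
      omega

/-- `for x = 0, …, h - 1 do body` -/
def upTo (x h : ℕ) (body : Cmd) : Cmd :=
  .set x (.const 0) ;; countTo x h body

/-- The rule for counting loops whose invariant `I i t s` speaks about the time `t` used so far. -/
theorem wp_upTo_time {W x h N : ℕ} {body : Cmd} {s : State} {Q : ℕ → State → Prop}
    (I : ℕ → ℕ → State → Prop)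
    (hx : body.modW x = false) (hh : body.modW h = false) (hxh : x ≠ h) (hb : s.Bdd W)
    (hN : s.w h = N) (h0 : I 0 0 (s.setW x 0))
    (step : ∀ i t s₁, i < N → Frame (upTo x h body) s s₁ → s₁.Bdd W →
      s₁.w x = i → I i t s₁ →
      WP W body s₁ fun t' s₂ => I (i + 1) (t + (t' + 7)) (s₂.setW x (i + 1)))
    (post : ∀ t s', Frame (upTo x h body) s s' → s'.Bdd W → I N t s' → Q (t + 5) s') :
    WP W (upTo x h body) s Q := by
  have hW : 0 < W := lt_of_le_of_lt (Nat.zero_le _) (hb.w 0)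
  have hb' : (s.setW x 0).Bdd W := hb.setW hW
  have hN' : (s.setW x 0).w h = N := by simp [hxh.symm, hN]
  have hfr : Frame (upTo x h body) s (s.setW x 0) :=
    Frame.seq_left (Frame.of_setW (e := .const 0))
  have key := wp_countTo (s := s.setW x 0) I hx hh hxh hb' (by simp) (by simpa using h0)
    (fun i t s₁ _ hi hf hb₁ hx₁ hI =>
      step i t s₁ (hN' ▸ hi) (hfr.trans hf.seq_right) hb₁ hx₁ hI)
  rw [upTo, wp_seq, wp_set]
  refine ⟨hW, key.strengthen hb' ?_⟩
  rintro t s' ⟨t', rfl, hI⟩ hf hb''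
  have := post t' s' (hfr.trans hf.seq_right) hb'' (by rwa [hN'] at hI)
  simpa [WExp.cost, add_comm, add_left_comm] using this

/-- The case where the time of a round is bounded in terms of its number alone. Peeling needs the
general rule, since there the cost depends on the vertex found at run time. -/
theorem wp_upTo {W x h N : ℕ} {body : Cmd} {s : State} {Q : ℕ → State → Prop}
    (I : ℕ → State → Prop) (T : ℕ → ℕ)
    (hx : body.modW x = false) (hh : body.modW h = false) (hxh : x ≠ h) (hb : s.Bdd W)
    (hN : s.w h = N) (h0 : I 0 (s.setW x 0))
    (step : ∀ i s₁, i < N → Frame (upTo x h body) s s₁ → s₁.Bdd W →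
      s₁.w x = i → I i s₁ →
      WP W body s₁ fun t s₂ => t ≤ T i ∧ I (i + 1) (s₂.setW x (i + 1)))
    (post : ∀ t s', t ≤ ∑ i ∈ Finset.range N, (T i + 7) + 5 → Frame (upTo x h body) s s' →
      s'.Bdd W → I N s' → Q t s') :
    WP W (upTo x h body) s Q := by
  refine wp_upTo_time (fun i t s => t ≤ ∑ j ∈ Finset.range i, (T j + 7) ∧ I i s) hx hh hxh hb hN
    ⟨by simp, h0⟩ ?_ fun t s' hf hb' hI => post _ _ (by omega) hf hb' hI.2
  rintro i t s₁ hi hf hb₁ hx₁ ⟨ht, hI⟩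
  refine (step i s₁ hi hf hb₁ hx₁ hI).mono ?_
  rintro t' s₂ ⟨ht', hI₂⟩
  refine ⟨?_, hI₂⟩
  rw [Finset.sum_range_succ]
  omega

/-! ## Loops over the neighbours of a vertex -/

section Neighbours

variable {n : ℕ}

open Classical in
/-- The neighbours of a vertex. -/
noncomputable def nbrs (G : SimpleGraph (Fin n)) (u : Fin n) : Finset (Fin n) :=
  Finset.univ.filter (G.Adj u)

@[simp] theorem mem_nbrs {G : SimpleGraph (Fin n)} {u v : Fin n} : v ∈ nbrs G u ↔ G.Adj u v := by
  simp [nbrs]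

/-- `for all neighbours v of b do body`; `p` is the position of `v` in the adjacency lists. -/
def eachNb (b p h v : ℕ) (body : Cmd) : Cmd :=
  .set p (.arr 0 (.var b)) ;; .set h (.arr 0 (.add (.var b) (.const 1))) ;;
    countTo p h (.set v (.arr 1 (.var p)) ;; body)

/-- Positions in the block of `u` and neighbours of `u` are in bijection: `complete` gives a unique
position for each neighbour and `sound` makes the map onto. Costs per position thereby become costs
per neighbour. -/
theorem sum_entries {G : SimpleGraph (Fin n)} {off nb : ℕ → ℕ} (hG : IsInput G off nb) (u : Fin n)
    (f : Fin n → ℕ) (g : ℕ → ℕ)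
    (hg : ∀ p, off u ≤ p → p < off (u + 1) → ∀ v : Fin n, nb p = v → g p = f v) :
    ∑ p ∈ Finset.Ico (off u) (off (u + 1)), g p = ∑ v ∈ nbrs G u, f v := by
  symm
  have hex : ∀ v : Fin n, v ∈ nbrs G u → ∃ p, off u ≤ p ∧ p < off (u + 1) ∧ nb p = v :=
    fun v hv => (hG.adj.complete u v (mem_nbrs.1 hv)).exists
  choose! i hi using hex
  refine Finset.sum_bij (fun v _ => i v) ?_ ?_ ?_ ?_
  · intro v hv
    simpa using ⟨(hi v hv).1, (hi v hv).2.1⟩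
  · intro v hv v' hv' h
    have h1 := (hi v hv).2.2
    have h2 := (hi v' hv').2.2
    rw [h] at h1
    exact Fin.ext (h1.symm.trans h2)
  · intro p hp
    rw [Finset.mem_Ico] at hp
    obtain ⟨j, hj, ha⟩ := hG.adj.sound u p hp.1 hp.2
    have hj' : j ∈ nbrs G u := by simpa using ha
    exact ⟨j, hj', (hG.adj.complete u j ha).unique (hi j hj') ⟨hp.1, hp.2, hj⟩⟩
  · intro v hv
    exact (hg _ (hi v hv).1 (hi v hv).2.1 v (hi v hv).2.2).symm

/-- The order of a list is arbitrary, so the invariant is indexed by the set of neighbours already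
treated; `stable` says that it ignores the control variables of the loop. Of the 10 steps per
neighbour 7 belong to the counting loop and 3 to the load of `v`; the 11 are the two initial loads
and the last test. -/
theorem wp_eachNb {W b p h v : ℕ} {body : Cmd} {s : State} {Q : ℕ → State → Prop}
    {G : SimpleGraph (Fin n)} {off nb : ℕ → ℕ} (hG : IsInput G off nb) (u : Fin n)
    (I : Finset (Fin n) → State → Prop) (T : Fin n → ℕ)
    (hp : (Cmd.set v (.arr 1 (.var p)) ;; body).modW p = false)
    (hh : (Cmd.set v (.arr 1 (.var p)) ;; body).modW h = false)
    (ha0 : body.modA 0 = false) (ha1 : body.modA 1 = false) (hph : p ≠ h) (hpb : p ≠ b)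
    (hb : s.Bdd W) (h0 : s.a 0 = off) (h1 : s.a 1 = nb) (hu : s.w b = u)
    (stable : ∀ P s₁ s₂, (∀ x, x ≠ p → x ≠ h → x ≠ v → s₂.w x = s₁.w x) → s₂.a = s₁.a →
      s₂.r = s₁.r → s₂.ra = s₁.ra → I P s₁ → I P s₂)
    (start : I ∅ s)
    (step : ∀ (P : Finset (Fin n)) (x : Fin n) (s₁ : State), P ⊆ nbrs G u → G.Adj u x → x ∉ P →
      Frame (eachNb b p h v body) s s₁ → s₁.Bdd W → s₁.w v = x → off u ≤ s₁.w p →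
      s₁.w p < off (u + 1) → nb (s₁.w p) = x → I P s₁ →
      WP W body s₁ fun t s₂ => t ≤ T x ∧ I (insert x P) s₂)
    (post : ∀ t s', t ≤ ∑ x ∈ nbrs G u, (T x + 10) + 11 → Frame (eachNb b p h v body) s s' →
      s'.Bdd W → I (nbrs G u) s' → Q t s') :
    WP W (eachNb b p h v body) s Q := by
  classical
  set inner : Cmd := Cmd.set v (.arr 1 (.var p)) ;; body with hinner
  have hpv : v ≠ p := by
    rintro rfl
    simp [hinner, Cmd.modW] at hp
  have hhv : v ≠ h := by
    rintro rfl
    simp [hinner, Cmd.modW] at hh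
  set s1 : State := s.setW p (off u) with hs1
  set s2 : State := s1.setW h (off (u + 1)) with hs2
  have hoff : ∀ i, off i < W := fun i => h0 ▸ hb.a 0 i
  have hnb : ∀ i, nb i < W := fun i => h1 ▸ hb.a 1 i
  have hb1 : s1.Bdd W := hb.setW (hoff _)
  have hb2 : s2.Bdd W := hb1.setW (hoff _)
  have hf2 : Frame (eachNb b p h v body) s s2 :=
    (Frame.seq_left (Frame.of_setW (e := .arr 0 (.var b)))).trans
      (Frame.seq_right (Frame.seq_left
        (Frame.of_setW (e := .arr 0 (.add (.var b) (.const 1))))))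
  have h2p : s2.w p = off u := by simp [hs2, hs1, hph]
  have h2h : s2.w h = off (u + 1) := by simp [hs2]
  have hm0 : (eachNb b p h v body).modA 0 = false := by simp [eachNb, countTo, Cmd.modA, ha0]
  have hm1 : (eachNb b p h v body).modA 1 = false := by simp [eachNb, countTo, Cmd.modA, ha1]
  let done : ℕ → Finset (Fin n) := fun i =>
    (nbrs G u).filter fun x => ∃ r, off u ≤ r ∧ r < i ∧ nb r = x
  have done0 : done (off u) = ∅ := by
    simp only [done, Finset.filter_eq_empty_iff]
    rintro x _ ⟨r, hr, hr', _⟩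
    omega
  have done1 : done (off (u + 1)) = nbrs G u := by
    simp only [done, Finset.filter_eq_self]
    intro x hx
    exact (hG.adj.complete u x (mem_nbrs.1 hx)).exists
  -- The bound as a function of the position. The default `0` never matters, because entries in the
  -- block of `u` are vertices.
  let T' : ℕ → ℕ := fun i => if hi : nb i < n then T ⟨nb i, hi⟩ else 0
  have key := wp_countTo (W := W) (x := p) (h := h) (body := inner) (s := s2)
    (fun i t s => t ≤ ∑ j ∈ Finset.Ico (off u) i, (T' j + 10) ∧ I (done i) s) hp hh hph hb2
    (by rw [h2p, h2h]; exact hG.adj.mono u)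
    (by
      rw [h2p, done0]
      refine ⟨by simp, stable _ s _ ?_ ?_ ?_ ?_ start⟩
      · intro x hx hx' _
        simp [hs2, hs1, hx, hx']
      all_goals simp [hs2, hs1])
    (by
      rintro i t₀ s₁ hi hi' hf hb₁ hx₁ ⟨ht₀, hI⟩
      rw [h2p] at hi
      rw [h2h] at hi'
      have hfr : Frame (eachNb b p h v body) s s₁ := hf2.trans hf.seq_right.seq_right
      have ha1' : s₁.a 1 = nb := by rw [hfr.a 1 hm1, h1]
      obtain ⟨x, hx, hadj⟩ := hG.adj.sound u i hi hi'
      have hadj : G.Adj u x := hadj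
      have hxn : nb i < n := by rw [hx]; exact x.2
      have hnotin : x ∉ done i := by
        simp only [done, Finset.mem_filter, not_and]
        rintro _ ⟨r, hr, hr', hr''⟩
        have := (hG.adj.complete u x hadj).unique ⟨hr, by omega, hr''⟩ ⟨hi, hi', hx⟩
        omega
      have hdone : done (i + 1) = insert x (done i) := by
        ext y
        simp only [done, Finset.mem_filter, Finset.mem_insert, mem_nbrs]
        constructor
        · rintro ⟨hy, r, hr, hr', hr''⟩
          by_cases hri : r = i
          · left
            rw [hri, hx] at hr''
            exact Fin.ext hr''.symm
          · exact Or.inr ⟨hy, r, hr, by omega, hr''⟩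
        · rintro (rfl | ⟨hy, r, hr, hr', hr''⟩)
          · exact ⟨hadj, i, hi, by omega, hx⟩
          · exact ⟨hy, r, hr, by omega, hr''⟩
      have hev : (WExp.arr 1 (.var p)).eval s₁ = x := by
        simp only [WExp.eval, hx₁, ha1', hx]
      rw [hinner, wp_seq, wp_set, hev]
      refine ⟨by rw [← hx]; exact hnb i, ?_⟩
      have hb₁' : (s₁.setW v x).Bdd W := hb₁.setW (by rw [← hx]; exact hnb i)
      have hfr' : Frame (eachNb b p h v body) s (s₁.setW v x) :=
        hfr.trans (Frame.seq_right (Frame.seq_right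
          ((Frame.seq_left (Frame.of_setW (e := .arr 1 (.var p))) :
            Frame inner s₁ (s₁.setW v x)).mono
              (by intro y hy; simp_all [countTo, Cmd.modW])
              (by intro y hy; simp_all [countTo, Cmd.modA])
              (by intro y hy; simp_all [countTo, Cmd.modR])
              (by intro y hy; simp_all [countTo, Cmd.modRA]))))
      refine (step (done i) x (s₁.setW v x) (Finset.filter_subset _ _) hadj hnotin hfr' hb₁'
        (by simp) ?_ ?_ ?_ ?_).mono ?_
      · simp [hpv.symm, hx₁, hi]
      · simp [hpv.symm, hx₁, hi']
      · simp [hpv.symm, hx₁, hx]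
      · refine stable _ s₁ _ ?_ rfl rfl rfl hI
        intro y _ _ hy
        simp [hy]
      · rintro t s₂ ⟨ht, hI₂⟩
        refine ⟨?_, ?_⟩
        · have hT : T' i = T x := by simp [T', hx]
          rw [Finset.sum_Ico_succ_top hi, hT]
          simp only [WExp.cost]
          omega
        · rw [hdone]
          refine stable _ s₂ _ ?_ rfl rfl rfl hI₂
          intro y hy _ _
          simp [hy])
  rw [eachNb, wp_seq, wp_set]
  have hev1 : (WExp.arr 0 (.var b)).eval s = off u := by simp only [WExp.eval, hu, h0]
  have hev2 : (WExp.arr 0 (.add (.var b) (.const 1))).eval s1 = off (u + 1) := by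
    simp [WExp.eval, hs1, hpb.symm, hu, h0]
  rw [hev1]
  refine ⟨hoff _, ?_⟩
  rw [wp_seq, wp_set, ← hs1, hev2]
  refine ⟨hoff _, ?_⟩
  rw [← hs2]
  refine key.strengthen hb2 ?_
  rintro t s' ⟨t', rfl, ht, hI⟩ hf hb'
  rw [h2h, done1] at hI
  refine post _ _ ?_ (hf2.trans hf.seq_right.seq_right) hb' hI
  rw [h2h, sum_entries hG u (fun x => T x + 10)] at ht
  · simp only [WExp.cost]
    omega
  · intro i _ _ x hx
    simp [T', hx]

/-- `for all u, for all neighbours v of u do body`, with `u` in variable 3, `v` in variable 6 and the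
position of `v` in variable 4. -/
def eachArc (body : Cmd) : Cmd := upTo 3 0 (eachNb 3 4 5 6 body)

open Classical in
/-- The ordered pairs of adjacent vertices. -/
noncomputable def arcs (G : SimpleGraph (Fin n)) : Finset (Fin n × Fin n) :=
  Finset.univ.filter fun a => G.Adj a.1 a.2

@[simp] theorem mem_arcs {G : SimpleGraph (Fin n)} {a : Fin n × Fin n} :
    a ∈ arcs G ↔ G.Adj a.1 a.2 := by
  simp [arcs]

/-- The machine holds the input. -/
structure Ctx (off nb : ℕ → ℕ) (n : ℕ) (lam : ℝ) (W : ℕ) (s : State) : Prop where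
  n_eq : s.w 0 = n
  off_eq : s.a 0 = off
  nb_eq : s.a 1 = nb
  lam_eq : s.r 0 = lam
  bdd : s.Bdd W

theorem Ctx.frame {off nb : ℕ → ℕ} {lam : ℝ} {W : ℕ} {s s' : State} {p : Cmd}
    (h : Ctx off nb n lam W s) (hf : Frame p s s') (hb : s'.Bdd W) (h0 : p.modW 0 = false)
    (h1 : p.modA 0 = false) (h2 : p.modA 1 = false) (h3 : p.modR 0 = false) :
    Ctx off nb n lam W s' :=
  ⟨(hf.w 0 h0).trans h.n_eq, (hf.a 0 h1).trans h.off_eq, (hf.a 1 h2).trans h.nb_eq,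
    (hf.r 0 h3).trans h.lam_eq, hb⟩

/-- Fuses the two nested loops, with an invariant indexed by the set of ordered adjacent pairs
already treated. The 18 steps per vertex are the 11 of `wp_eachNb` and the 7 of one outer round. -/
theorem wp_eachArc {W : ℕ} {body : Cmd} {s : State} {Q : ℕ → State → Prop} {lam : ℝ}
    {G : SimpleGraph (Fin n)} {off nb : ℕ → ℕ} (hG : IsInput G off nb)
    (I : Finset (Fin n × Fin n) → State → Prop) (T : Fin n → Fin n → ℕ)
    (hm : ∀ x ∈ [0, 3, 4, 5], body.modW x = false)
    (ha0 : body.modA 0 = false) (ha1 : body.modA 1 = false) (hr0 : body.modR 0 = false)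
    (hc : Ctx off nb n lam W s)
    (stable : ∀ D s₁ s₂, (∀ x, x ∉ [3, 4, 5, 6] → s₂.w x = s₁.w x) → s₂.a = s₁.a →
      s₂.r = s₁.r → s₂.ra = s₁.ra → I D s₁ → I D s₂)
    (start : I ∅ s)
    (step : ∀ (D : Finset (Fin n × Fin n)) (u x : Fin n) (s₁ : State), D ⊆ arcs G → G.Adj u x →
      (u, x) ∉ D → Frame (eachArc body) s s₁ → Ctx off nb n lam W s₁ → s₁.w 3 = u → s₁.w 6 = x →
      off u ≤ s₁.w 4 → s₁.w 4 < off (u + 1) → nb (s₁.w 4) = x → I D s₁ →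
      WP W body s₁ fun t s₂ => t ≤ T u x ∧ I (insert (u, x) D) s₂)
    (post : ∀ t s', t ≤ ∑ u, (∑ x ∈ nbrs G u, (T u x + 10) + 18) + 5 →
      Frame (eachArc body) s s' → Ctx off nb n lam W s' → I (arcs G) s' → Q t s') :
    WP W (eachArc body) s Q := by
  classical
  have m0 := hm 0 (by simp)
  have m3 := hm 3 (by simp)
  have m4 := hm 4 (by simp)
  have m5 := hm 5 (by simp)
  have q0 : (eachArc body).modW 0 = false := by
    simp [eachArc, upTo, eachNb, countTo, Cmd.modW, m0]
  have q1 : (eachArc body).modA 0 = false := by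
    simp [eachArc, upTo, eachNb, countTo, Cmd.modA, ha0]
  have q2 : (eachArc body).modA 1 = false := by
    simp [eachArc, upTo, eachNb, countTo, Cmd.modA, ha1]
  have q3 : (eachArc body).modR 0 = false := by
    simp [eachArc, upTo, eachNb, countTo, Cmd.modR, hr0]
  let done : ℕ → Finset (Fin n × Fin n) := fun i => (arcs G).filter fun a => (a.1 : ℕ) < i
  refine wp_upTo (N := n) (fun i s => I (done i) s)
    (fun i => if hi : i < n then ∑ x ∈ nbrs G ⟨i, hi⟩, (T ⟨i, hi⟩ x + 10) + 11 else 0)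
    (by simp [eachNb, countTo, Cmd.modW, m3]) (by simp [eachNb, countTo, Cmd.modW, m0])
    (by decide) hc.bdd hc.n_eq ?_ ?_ ?_
  · have : done 0 = ∅ := by simp [done]
    rw [this]
    refine stable _ s _ ?_ rfl rfl rfl start
    intro x hx
    simp at hx
    simp [hx]
  · intro i s₁ hi hf hb hx hI
    obtain ⟨u, rfl⟩ : ∃ u : Fin n, (u : ℕ) = i := ⟨⟨i, hi⟩, rfl⟩
    have hc₁ := hc.frame hf hb q0 q1 q2 q3
    refine wp_eachNb hG u (fun P s => I (done u ∪ P.image fun x => (u, x)) s) (fun x => T u x)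
      (by simp [Cmd.modW, m4]) (by simp [Cmd.modW, m5]) ha0 ha1 (by decide) (by decide)
      hb hc₁.off_eq hc₁.nb_eq hx ?_ ?_ ?_ ?_
    · intro P s₁ s₂ hw
      refine stable _ _ _ ?_
      intro x hx
      simp at hx
      exact hw x (by tauto) (by tauto) (by tauto)
    · simpa using hI
    · intro P x s₂ hP hadj hxP hf₂ hb₂ hw6 hp hp' hnb hI₂
      have hfu : Frame (upTo 3 0 (eachNb 3 4 5 6 body)) s₁ s₂ :=
        Frame.seq_right (hf₂.mono
          (by intro y hy; simp_all [countTo, Cmd.modW])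
          (by intro y hy; simp_all [countTo, Cmd.modA])
          (by intro y hy; simp_all [countTo, Cmd.modR])
          (by intro y hy; simp_all [countTo, Cmd.modRA]))
      have hfs : Frame (eachArc body) s s₂ := hf.trans hfu
      have h3 : s₂.w 3 = u := by
        rw [hf₂.w 3 (by simp [eachNb, countTo, Cmd.modW, m3]), hx]
      have hins : (done u ∪ (insert x P).image fun x => (u, x)) =
          insert (u, x) (done u ∪ P.image fun x => (u, x)) := by
        ext ⟨a, b⟩
        simp only [Finset.mem_union, Finset.mem_image, Finset.mem_insert, Prod.mk.injEq]
        aesop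
      rw [hins]
      refine step _ u x s₂ ?_ hadj ?_ hfs (hc.frame hfs hb₂ q0 q1 q2 q3) h3 hw6 hp hp' hnb hI₂
      · intro a ha
        simp only [Finset.mem_union, Finset.mem_image, done, Finset.mem_filter] at ha
        rcases ha with ha | ⟨y, hy, rfl⟩
        · exact ha.1
        · simpa using hP hy
      · simpa [done] using hxP
    · intro t s₂ ht hf₂ hb₂ hI₂
      refine ⟨by simpa using ht, ?_⟩
      have : done (u + 1) = done u ∪ (nbrs G u).image fun x => (u, x) := by
        ext ⟨a, b⟩
        simp only [done, Finset.mem_filter, mem_arcs, Finset.mem_union, Finset.mem_image, mem_nbrs,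
          Prod.mk.injEq]
        constructor
        · rintro ⟨hab, hlt⟩
          rcases Nat.lt_succ_iff_lt_or_eq.1 hlt with h | h
          · exact Or.inl ⟨hab, h⟩
          · obtain rfl := Fin.ext h
            exact Or.inr ⟨b, hab, rfl, rfl⟩
        · rintro (⟨hab, hlt⟩ | ⟨y, hy, rfl, rfl⟩)
          · exact ⟨hab, by omega⟩
          · exact ⟨hy, by omega⟩
      rw [this]
      refine stable _ s₂ _ ?_ rfl rfl rfl hI₂
      intro x hx
      simp at hx
      simp [hx]
  · intro t s' ht hf hb hI
    refine post t s' ?_ hf (hc.frame hf hb q0 q1 q2 q3) ?_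
    · rw [← Fin.sum_univ_eq_sum_range
        (fun i => (if hi : i < n then ∑ x ∈ nbrs G ⟨i, hi⟩, (T ⟨i, hi⟩ x + 10) + 11 else 0) + 7)]
        at ht
      simpa [add_assoc] using ht
    · have : done n = arcs G := by
        ext a
        simp [done]
      rwa [this] at hI

end Neighbours

attribute [simp] WExp.eval WExp.cost RExp.eval RExp.cost Test.holds Test.cost
attribute [simp] wp_skip wp_set wp_store wp_rset wp_rstore wp_seq wp_cond

end STCPeel


namespace STCPeel

/-! ## Loading a subgraph into an adjacency matrix -/

section Matrix

variable {n : ℕ}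

theorem index_inj {u v u' v' : Fin n} :
    (u : ℕ) * n + v = u' * n + v' ↔ u = u' ∧ v = v' := by
  constructor
  · intro h
    have h1 : (u : ℕ) = u' := by
      have := congrArg (· / n) h
      simpa [Nat.add_div_of_dvd_right, Nat.div_eq_of_lt, u.pos, mul_comm _ n,
        Nat.mul_add_div u.pos] using this
    refine ⟨Fin.ext h1, Fin.ext ?_⟩
    rw [h1] at h
    omega
  · rintro ⟨rfl, rfl⟩
    rfl

/-- The position `x * n + y` of a pair of vertices in a matrix. -/
def entry (x y : ℕ) : WExp := .add (.mul (.var x) (.var 0)) (.var y)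

@[simp] theorem entry_eval (x y : ℕ) (s : State) : (entry x y).eval s = s.w x * s.w 0 + s.w y := rfl

@[simp] theorem entry_cost (x y : ℕ) : (entry x y).cost = 5 := rfl

@[simp] theorem sub_adj {G : SimpleGraph (Fin n)} {U : Finset (Fin n)} {u v : Fin n} :
    (sub G U).Adj u v ↔ G.Adj u v ∧ u ∈ U ∧ v ∈ U := by
  simp [sub]

theorem sub_univ (G : SimpleGraph (Fin n)) : sub G Finset.univ = G := by
  ext
  simp

/-- Writes the matrix of the subgraph induced by the flags in array 8 and clears the other marks. -/
def loadGraph : Cmd := eachArc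
  (.store 14 (entry 3 6) (.mul (.arr 8 (.var 3)) (.arr 8 (.var 6))) ;;
    .store 16 (entry 3 6) (.const 0) ;; .store 17 (entry 3 6) (.const 0))

/-- The matrices hold no mark at pairs of vertices that are not adjacent. -/
def CleanOutside (G : SimpleGraph (Fin n)) (s : State) : Prop :=
  ∀ u v : Fin n, ¬ G.Adj u v →
    s.a 14 (u * n + v) = 0 ∧ s.a 16 (u * n + v) = 0 ∧ s.a 17 (u * n + v) = 0

/-- Characteristic function of a set of vertices. -/
def IsFlags (U : Finset (Fin n)) (f : ℕ → ℕ) : Prop := ∀ v : Fin n, f v = if v ∈ U then 1 else 0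

open Classical in
/-- Adjacency matrix. -/
def IsMatrix (F : SimpleGraph (Fin n)) (f : ℕ → ℕ) : Prop :=
  ∀ u v : Fin n, f (u * n + v) = if F.Adj u v then 1 else 0

/-- Clearing a whole matrix would cost `n²`. Only pairs adjacent in `G` are rewritten; all other
cells are zero by `CleanOutside`, as they should be for a subgraph of `G`. -/
theorem wp_loadGraph {G : SimpleGraph (Fin n)} {off nb : ℕ → ℕ} (hG : IsInput G off nb) {W : ℕ}
    {lam : ℝ} {s : State} (hW : 1 < W) (hc : Ctx off nb n lam W s) {U : Finset (Fin n)}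
    (hU : IsFlags U (s.a 8)) (h : CleanOutside G s) :
    WP W loadGraph s fun t s' => t ≤ ∑ u, (∑ _x ∈ nbrs G u, 40 + 18) + 5 ∧
      IsMatrix (sub G U) (s'.a 14) ∧
      ∀ u v : Fin n, s'.a 16 (u * n + v) = 0 ∧ s'.a 17 (u * n + v) = 0 := by
  classical
  refine wp_eachArc hG (fun D s => CleanOutside G s ∧ ∀ u v : Fin n, (u, v) ∈ D →
      s.a 14 (u * n + v) = (if (sub G U).Adj u v then 1 else 0) ∧
      s.a 16 (u * n + v) = 0 ∧ s.a 17 (u * n + v) = 0) (fun _ _ => 30)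
    (by decide) rfl rfl rfl hc ?_ ⟨h, by simp⟩ ?_ ?_
  · intro D s₁ s₂ _ ha _ _ h
    simpa only [CleanOutside, ha] using h
  · intro D u x s₁ _ hux hD hf hc₁ h3 h6 _ _ _ ⟨hI, hI'⟩
    have h8 : IsFlags U (s₁.a 8) := by rw [hf.a 8 rfl]; exact hU
    have hle : s₁.a 8 u * s₁.a 8 x ≤ 1 := by
      rw [h8, h8]
      split_ifs <;> simp
    simp [h3, h6, hc₁.n_eq, lt_of_le_of_lt hle hW, (by omega : 0 < W)]
    refine ⟨fun v w hvw => ?_, fun v w hvw => ?_⟩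
    · have : ¬ (v = u ∧ w = x) := by
        rintro ⟨rfl, rfl⟩
        exact hvw hux
      simp [index_inj, this, hI v w hvw]
    · simp only [Function.update_apply, index_inj]
      by_cases hvw' : v = u ∧ w = x
      · obtain ⟨rfl, rfl⟩ := hvw'
        simp only [and_self, if_true, h8 v, h8 w, hux, true_and]
        split_ifs <;> simp_all
      · have := hI' v w (by tauto)
        simpa [hvw'] using this
  · intro t s' ht _ _ ⟨hI, hI'⟩
    refine ⟨by simpa using ht, fun u v => ?_, fun u v => ?_⟩
    · by_cases huv : G.Adj u v
      · exact (hI' u v (by simpa using huv)).1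
      · simp [(hI u v huv).1, huv]
    · by_cases huv : G.Adj u v
      · exact (hI' u v (by simpa using huv)).2
      · exact (hI u v huv).2

end Matrix

/-! ## Wedges and a maximal matching -/

section Scan

variable {V : Type*}

/-- An edge of a larger matching has an endpoint covered by `M`. The `M`-edge there also lies in the
larger matching, and uniqueness of the partner identifies the two. -/
theorem maximal_isMatching_of_forall {Z : SimpleGraph V} {M : Z.Subgraph} (hM : M.IsMatching)
    (h : ∀ e f, Z.Adj e f → e ∈ M.verts ∨ f ∈ M.verts) :
    Maximal (fun M' : Z.Subgraph => M'.IsMatching) M := by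
  refine ⟨hM, fun M' hM' hle => ?_⟩
  have key : ∀ e f, M'.Adj e f → e ∈ M.verts → M.Adj e f := by
    intro e f hef he
    obtain ⟨g, hg, _⟩ := hM he
    rwa [(hM' (M'.edge_vert hef)).unique hef (hle.2 hg)]
  have adj : ∀ e f, M'.Adj e f → M.Adj e f := by
    intro e f hef
    rcases h e f (M'.adj_sub hef) with he | hf
    · exact key e f hef he
    · exact (key f e hef.symm hf).symm
  refine ⟨fun e he => ?_, fun e f => adj e f⟩
  obtain ⟨f, hf, _⟩ := hM' he
  exact M.edge_vert (adj e f hf)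

theorem exists_isMatching_insert {Z : SimpleGraph V} {M : Z.Subgraph} (hM : M.IsMatching)
    {e f : V} (h : Z.Adj e f) (he : e ∉ M.verts) (hf : f ∉ M.verts) :
    ∃ M' : Z.Subgraph, M'.IsMatching ∧ M'.verts = M.verts ∪ {e, f} := by
  refine ⟨M ⊔ Z.subgraphOfAdj h, hM.sup (SimpleGraph.Subgraph.IsMatching.subgraphOfAdj h) ?_, ?_⟩
  · rw [hM.support_eq_verts, (SimpleGraph.Subgraph.IsMatching.subgraphOfAdj h).support_eq_verts]
    rw [Set.disjoint_left]
    rintro x hx hx'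
    simp at hx'
    rcases hx' with rfl | rfl
    exacts [he hx, hf hx]
  · simp

theorem IsWedge.left_mem {F : SimpleGraph V} {x y z : V} (h : IsWedge F x y z) :
    s(x, y) ∈ wedgeVerts F := ⟨x, y, z, h, Or.inl rfl⟩

theorem IsWedge.right_mem {F : SimpleGraph V} {x y z : V} (h : IsWedge F x y z) :
    s(y, z) ∈ wedgeVerts F := ⟨x, y, z, h, Or.inr rfl⟩

/-- Reversing the wedge if necessary, the edge is its first leg; only the choice of the centre among
the two ends remains. -/
theorem mem_wedgeVerts_iff {F : SimpleGraph V} {a b : V} :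
    s(a, b) ∈ wedgeVerts F ↔ ∃ c, IsWedge F a b c ∨ IsWedge F b a c := by
  constructor
  · rintro ⟨x, y, z, h, he | he⟩
    · rcases Sym2.eq_iff.1 he with ⟨rfl, rfl⟩ | ⟨rfl, rfl⟩
      exacts [⟨z, Or.inl h⟩, ⟨z, Or.inr h⟩]
    · rcases Sym2.eq_iff.1 he with ⟨rfl, rfl⟩ | ⟨rfl, rfl⟩
      exacts [⟨x, Or.inr h.symm⟩, ⟨x, Or.inl h.symm⟩]
  · rintro ⟨c, h | h⟩
    · exact h.left_mem
    · rw [Sym2.eq_swap]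
      exact h.left_mem

theorem adj_of_mem_wedgeVerts {F : SimpleGraph V} {a b : V} (h : s(a, b) ∈ wedgeVerts F) :
    F.Adj a b := by
  obtain ⟨c, h | h⟩ := mem_wedgeVerts_iff.1 h
  exacts [h.1, h.1.symm]

variable {n : ℕ}

/-- Marks the edges that lie in wedges in array 16, and those of a maximal matching of the wedge
graph in array 17. -/
def scanWedges : Cmd := eachArc (eachNb 3 7 8 9
  (.cond (.and (.not (.eq (.var 6) (.var 9))) (.and (.eq (.arr 14 (entry 6 3)) (.const 1))
      (.and (.eq (.arr 14 (entry 3 9)) (.const 1)) (.eq (.arr 14 (entry 6 9)) (.const 0)))))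
    (.store 16 (entry 6 3) (.const 1) ;; .store 16 (entry 3 6) (.const 1) ;;
      .cond (.and (.eq (.arr 17 (entry 6 3)) (.const 0)) (.eq (.arr 17 (entry 3 9)) (.const 0)))
        (.store 17 (entry 6 3) (.const 1) ;; .store 17 (entry 3 6) (.const 1) ;;
          .store 17 (entry 3 9) (.const 1) ;; .store 17 (entry 9 3) (.const 1))
        .skip)
    .skip))

/-- `f` is the symmetric matrix of the set `S` of edges. -/
def IsEdgeMatrix (S : Set (Sym2 (Fin n))) (f : ℕ → ℕ) : Prop :=
  ∀ u v : Fin n, f (u * n + v) = S.indicator (fun _ => 1) s(u, v)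

/-- The marks after the triples `(y, x, z)` in `D` have been looked at. -/
structure ScanInv (F : SimpleGraph (Fin n)) (D : Fin n → Fin n → Fin n → Prop) (nd wk : ℕ → ℕ) :
    Prop where
  nd_iff : ∀ a b : Fin n, nd (a * n + b) = 1 ↔
    ∃ c, (D b a c ∧ IsWedge F a b c) ∨ (D a b c ∧ IsWedge F b a c)
  nd_le : ∀ a b : Fin n, nd (a * n + b) ≤ 1
  matching : ∃ M : (wedgeGraph F).Subgraph, M.IsMatching ∧
    IsEdgeMatrix (Subtype.val '' M.verts) wk ∧
    ∀ y x z, D y x z → IsWedge F x y z →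
      s(x, y) ∈ Subtype.val '' M.verts ∨ s(y, z) ∈ Subtype.val '' M.verts

/-- The invariant sees `D` only through genuine wedges, so triples that are not wedges may be added
or dropped freely when the scan passes them. -/
theorem ScanInv.congr {F : SimpleGraph (Fin n)} {D D' : Fin n → Fin n → Fin n → Prop}
    {nd wk : ℕ → ℕ} (h : ScanInv F D nd wk)
    (hD : ∀ y x z, IsWedge F x y z → (D y x z ↔ D' y x z)) : ScanInv F D' nd wk := by
  obtain ⟨h1, h2, M, hM, hM', hM''⟩ := h
  refine ⟨fun a b => ?_, h2, M, hM, hM', fun y x z hd hw => hM'' y x z ((hD y x z hw).2 hd) hw⟩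
  rw [h1]
  refine exists_congr fun c => ?_
  have h3 := hD b a c
  have h4 := hD a b c
  tauto

open Classical in
theorem IsEdgeMatrix.update {S : Set (Sym2 (Fin n))} {f : ℕ → ℕ} (h : IsEdgeMatrix S f)
    (x y : Fin n) : IsEdgeMatrix (insert s(x, y) S)
      (Function.update (Function.update f (x * n + y) 1) (y * n + x) 1) := by
  intro u v
  simp only [Function.update_apply, index_inj, h u v, Set.indicator_apply, Set.mem_insert_iff,
    Sym2.eq_iff]
  by_cases h1 : u = y ∧ v = x
  · simp [h1]
  · by_cases h2 : u = x ∧ v = y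
    · simp [h2]
    · simp [h1, h2]

/-- The greedy step. If both edges are unmatched, the edge of the wedge graph joining them extends
the matching; otherwise one of them is covered already and nothing has to change. -/
theorem ScanInv.step {F : SimpleGraph (Fin n)} {D : Fin n → Fin n → Fin n → Prop}
    {nd wk : ℕ → ℕ} (h : ScanInv F D nd wk) {x y z : Fin n} (hw : IsWedge F x y z) :
    ScanInv F (fun y' x' z' => D y' x' z' ∨ (y' = y ∧ x' = x ∧ z' = z))
      (Function.update (Function.update nd (x * n + y) 1) (y * n + x) 1)
      (if wk (x * n + y) = 0 ∧ wk (y * n + z) = 0 then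
        Function.update (Function.update (Function.update (Function.update wk (x * n + y) 1)
          (y * n + x) 1) (y * n + z) 1) (z * n + y) 1 else wk) := by
  classical
  obtain ⟨h1, h2, M, hM, hM', hM''⟩ := h
  refine ⟨fun a b => ?_, fun a b => ?_, ?_⟩
  · simp only [Function.update_apply, index_inj]
    by_cases c1 : a = y ∧ b = x
    · simp only [c1, and_self, if_true, true_iff]
      exact ⟨z, Or.inr ⟨Or.inr (by simp), hw⟩⟩
    · by_cases c2 : a = x ∧ b = y
      · simp only [c2, and_self, if_true, ite_self, true_iff]
        exact ⟨z, Or.inl ⟨Or.inr (by simp), hw⟩⟩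
      · rw [if_neg c1, if_neg c2, h1]
        refine exists_congr fun c => ?_
        tauto
  · simp only [Function.update_apply]
    split_ifs
    exacts [le_rfl, le_rfl, h2 a b]
  · split_ifs with hc
    · have e1 : (⟨s(x, y), hw.left_mem⟩ : wedgeVerts F) ∉ M.verts := by
        intro hm
        have := hM' x y
        rw [hc.1, Set.indicator_of_mem (Set.mem_image_of_mem _ hm)] at this
        omega
      have e2 : (⟨s(y, z), hw.right_mem⟩ : wedgeVerts F) ∉ M.verts := by
        intro hm
        have := hM' y z
        rw [hc.2, Set.indicator_of_mem (Set.mem_image_of_mem _ hm)] at this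
        omega
      obtain ⟨M', hm, hv⟩ := exists_isMatching_insert hM
        (⟨x, y, z, hw, rfl, rfl⟩ : (wedgeGraph F).Adj ⟨s(x, y), hw.left_mem⟩
          ⟨s(y, z), hw.right_mem⟩) e1 e2
      have hv' : (Subtype.val '' M'.verts : Set (Sym2 (Fin n))) =
          insert s(y, z) (insert s(x, y) (Subtype.val '' M.verts)) := by
        rw [hv, Set.image_union, Set.image_pair]
        ext e
        simp only [Set.mem_union, Set.mem_insert_iff, Set.mem_singleton_iff]
        tauto
      refine ⟨M', hm, ?_, ?_⟩
      · rw [hv']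
        exact (hM'.update x y).update y z
      · rintro y' x' z' (hd | ⟨rfl, rfl, rfl⟩) hw'
        · rw [hv']
          rcases hM'' y' x' z' hd hw' with h | h
          · exact Or.inl (Or.inr (Or.inr h))
          · exact Or.inr (Or.inr (Or.inr h))
        · left
          rw [hv']
          exact Or.inr (Or.inl rfl)
    · refine ⟨M, hM, hM', ?_⟩
      rintro y' x' z' (hd | ⟨rfl, rfl, rfl⟩) hw'
      · exact hM'' y' x' z' hd hw'
      · by_contra hcon
        push Not at hcon
        exact hc ⟨by rw [hM', Set.indicator_of_notMem hcon.1],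
          by rw [hM', Set.indicator_of_notMem hcon.2]⟩

/-- The loops run over neighbours in `G`, while the matrix tests membership in `F`. No wedge of `F`
is missed, because both its legs are edges of `G`. The time is a constant per pair of neighbours of
the centre. -/
theorem wp_scanWedges {G F : SimpleGraph (Fin n)} (hF : F ≤ G) {off nb : ℕ → ℕ}
    (hG : IsInput G off nb) {W : ℕ} {lam : ℝ} {s : State} (hW : 1 < W)
    (hc : Ctx off nb n lam W s) (h14 : IsMatrix F (s.a 14))
    (h : ∀ u v : Fin n, s.a 16 (u * n + v) = 0 ∧ s.a 17 (u * n + v) = 0) :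
    WP W scanWedges s fun t s' =>
      t ≤ ∑ u, (∑ _x ∈ nbrs G u, (∑ _z ∈ nbrs G u, 130 + 21) + 18) + 5 ∧
      (∀ u v : Fin n, s'.a 16 (u * n + v) = 1 ↔ s(u, v) ∈ wedgeVerts F) ∧
      (∀ u v : Fin n, s'.a 16 (u * n + v) ≤ 1) ∧
      ∃ weak, IsAprMinSTC F weak ∧ IsEdgeMatrix weak (s'.a 17) := by
  classical
  refine wp_eachArc hG (fun A s => ScanInv F (fun y x _ => (y, x) ∈ A) (s.a 16) (s.a 17))
    (fun u _ => ∑ _z ∈ nbrs G u, 130 + 11)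
    (by decide) rfl rfl rfl hc ?_ ?_ ?_ ?_
  · intro D s₁ s₂ _ ha _ _ h
    simpa only [ha] using h
  · refine ⟨fun a b => ?_, fun a b => ?_, ⊥, ?_, ?_, ?_⟩
    · simp [(h a b).1]
    · simp [(h a b).1]
    · intro v hv
      simp at hv
    · intro u v
      simp [(h u v).2]
    · simp
  · intro A y x s₁ hA hyx hyA hf hc₁ h3 h6 _ _ _ hI
    refine wp_eachNb hG y (fun P s => ScanInv F (fun y' x' z' => (y', x') ∈ A ∨
      (y' = y ∧ x' = x ∧ z' ∈ P)) (s.a 16) (s.a 17)) (fun _ => 120)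
      rfl rfl rfl rfl (by decide) (by decide) hc₁.bdd hc₁.off_eq hc₁.nb_eq h3 ?_ ?_ ?_ ?_
    · intro P s₁ s₂ _ ha _ _ h
      simpa only [ha] using h
    · simpa using hI
    · intro P z s₂ _ hyz _ hf₂ hb₂ h9 _ _ _ hI₂
      have h3' : s₂.w 3 = y := by rw [hf₂.w 3 rfl, h3]
      have h6' : s₂.w 6 = x := by rw [hf₂.w 6 rfl, h6]
      have h0' : s₂.w 0 = n := by rw [hf₂.w 0 rfl, hc₁.n_eq]
      have h14' : IsMatrix F (s₂.a 14) := by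
        rw [hf₂.a 14 rfl, hf.a 14 rfl]
        exact h14
      have hD : (fun y' x' z' => (y', x') ∈ A ∨ (y' = y ∧ x' = x ∧ z' ∈ insert z P)) =
          fun y' x' z' => ((y', x') ∈ A ∨ (y' = y ∧ x' = x ∧ z' ∈ P)) ∨
            (y' = y ∧ x' = x ∧ z' = z) := by
        funext y' x' z'
        simp only [Finset.mem_insert, eq_iff_iff]
        tauto
      rw [hD]
      rw [wp_cond]
      have htest : Test.holds s₂ (.and (.not (.eq (.var 6) (.var 9)))
          (.and (.eq (.arr 14 (entry 6 3)) (.const 1))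
          (.and (.eq (.arr 14 (entry 3 9)) (.const 1)) (.eq (.arr 14 (entry 6 9)) (.const 0))))) ↔
          IsWedge F x y z := by
        simp only [Test.holds, WExp.eval, entry_eval, h3', h6', h9, h0', h14' x y, h14' y z,
          h14' x z, IsWedge, Fin.val_inj, ite_eq_left_iff, ite_eq_right_iff]
        simp
        tauto
      rw [htest]
      constructor
      · intro hw
        have := hI₂.step hw
        simp [h3', h6', h9, h0', hW]
        refine ⟨fun hz hz' => ?_, fun hz => ?_⟩
        · rwa [if_pos ⟨hz, hz'⟩] at this
        · rwa [if_neg (by tauto)] at this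
      · intro hw
        simp
        refine hI₂.congr fun y' x' z' hw' => ?_
        constructor
        · exact Or.inl
        · rintro (h | ⟨rfl, rfl, rfl⟩)
          exacts [h, absurd hw' hw]
    · intro t s₂ ht _ _ hI₂
      refine ⟨ht, hI₂.congr fun y' x' z' hw => ?_⟩
      -- For a wedge the third vertex is automatically a neighbour of the centre, so after the inner
      -- loop the condition on it disappears.
      have : y' = y → G.Adj y z' := by
        rintro rfl
        exact hF hw.2.1
      simp only [mem_nbrs, Finset.mem_insert, Prod.mk.injEq]
      tauto
  · intro t s' ht _ _ hI
    have hI' : ScanInv F (fun _ _ _ => True) (s'.a 16) (s'.a 17) := by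
      refine hI.congr fun y x z hw => ?_
      simpa using hF hw.1.symm
    obtain ⟨h1, h2, M, hM, hM', hM''⟩ := hI'
    refine ⟨by simpa [add_assoc] using ht, fun u v => ?_, h2, _, ⟨M, ?_, rfl⟩, hM'⟩
    · rw [h1, mem_wedgeVerts_iff]
      simp
    · refine maximal_isMatching_of_forall hM ?_
      rintro e f ⟨x, y, z, hw, he, hf⟩
      have := hM'' y x z trivial hw
      rw [← he, ← hf] at this
      simpa using this

end Scan

end STCPeel


namespace STCPeel

/-! ## The wedge graph in memory -/

section Number

variable {n : ℕ}

/-- Numbers the nodes of the wedge graph. -/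
def numberNodes : Cmd := .set 2 (.const 0) ;; eachArc
  (.cond (.and (.lt (.var 3) (.var 6)) (.eq (.arr 16 (entry 3 6)) (.const 1)))
    (.store 9 (.var 2) (.var 3) ;; .store 10 (.var 2) (.var 6) ;;
      .store 15 (entry 3 6) (.var 2) ;; .store 15 (entry 6 3) (.var 2) ;;
      .set 2 (.add (.var 2) (.const 1)))
    .skip)

/-- The numbering after the arcs in `D` have been looked at. -/
structure NumInv (F : SimpleGraph (Fin n)) (D : Finset (Fin n × Fin n)) (N : ℕ)
    (X Y id : ℕ → ℕ) : Prop where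
  node : ∀ i < N, ∃ u v : Fin n, X i = u ∧ Y i = v ∧ u < v ∧ (u, v) ∈ D ∧
    s(u, v) ∈ wedgeVerts F ∧ id (u * n + v) = i ∧ id (v * n + u) = i
  ident : ∀ u v : Fin n, (u, v) ∈ D → u < v → s(u, v) ∈ wedgeVerts F →
    id (u * n + v) < N ∧ X (id (u * n + v)) = u ∧ Y (id (u * n + v)) = v

/-- The number of a node is recovered from its pair of ends through `id`, so nodes inject into
pairs. This keeps the node counter inside a machine word. -/
theorem NumInv.le {F : SimpleGraph (Fin n)} {D : Finset (Fin n × Fin n)} {N : ℕ} {X Y id : ℕ → ℕ}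
    (h : NumInv F D N X Y id) : N ≤ n * n := by
  choose u v h using fun i : Fin N => h.node i i.2
  have hinj : Function.Injective fun i : Fin N => (u i, v i) := by
    intro i j hij
    simp only [Prod.mk.injEq] at hij
    have h1 := (h i).2.2.2.2.2.1
    have h2 := (h j).2.2.2.2.2.1
    rw [hij.1, hij.2, h2] at h1
    exact Fin.ext h1.symm
  simpa using Fintype.card_le_of_injective _ hinj

theorem NumInv.skip {F : SimpleGraph (Fin n)} {D : Finset (Fin n × Fin n)} {N : ℕ} {X Y id : ℕ → ℕ}
    (h : NumInv F D N X Y id) {u v : Fin n} (huv : ¬ (u < v ∧ s(u, v) ∈ wedgeVerts F)) :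
    NumInv F (insert (u, v) D) N X Y id := by
  refine ⟨fun i hi => ?_, fun u' v' hD hlt hw => ?_⟩
  · obtain ⟨u', v', h1, h2, h3, h4, h5⟩ := h.node i hi
    exact ⟨u', v', h1, h2, h3, Finset.mem_insert_of_mem h4, h5⟩
  · rcases Finset.mem_insert.1 hD with hD | hD
    · obtain ⟨rfl, rfl⟩ := Prod.mk.inj hD
      exact absurd ⟨hlt, hw⟩ huv
    · exact h.ident u' v' hD hlt hw

/-- Earlier nodes come from other pairs and all pairs are ascending, so neither of the two cells of
`id` that are written belongs to an earlier node. -/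
theorem NumInv.push {F : SimpleGraph (Fin n)} {D : Finset (Fin n × Fin n)} {N : ℕ} {X Y id : ℕ → ℕ}
    (h : NumInv F D N X Y id) {u v : Fin n} (hD : (u, v) ∉ D) (huv : u < v)
    (hw : s(u, v) ∈ wedgeVerts F) :
    NumInv F (insert (u, v) D) (N + 1) (Function.update X N u) (Function.update Y N v)
      (Function.update (Function.update id (u * n + v) N) (v * n + u) N) := by
  refine ⟨fun i hi => ?_, fun u' v' hD' hlt hw' => ?_⟩
  · by_cases hiN : i = N
    · subst hiN
      refine ⟨u, v, by simp, by simp, huv, by simp, hw, ?_, by simp⟩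
      simp [Function.update_apply]
    · obtain ⟨u', v', h1, h2, h3, h4, h5, h6, h7⟩ := h.node i (by omega)
      have c1 : ¬ (u' = u ∧ v' = v) := by
        rintro ⟨rfl, rfl⟩
        exact hD h4
      have c2 : ¬ (u' = v ∧ v' = u) := by
        rintro ⟨rfl, rfl⟩
        exact absurd huv (not_lt.2 h3.le)
      have c3 : ¬ (v' = u ∧ u' = v) := by tauto
      have c4 : ¬ (v' = v ∧ u' = u) := by tauto
      refine ⟨u', v', by simp [hiN, h1], by simp [hiN, h2], h3, Finset.mem_insert_of_mem h4,
        h5, ?_, ?_⟩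
      · simp only [Function.update_apply, index_inj, c1, c2, if_false, h6]
      · simp only [Function.update_apply, index_inj, c3, c4, if_false, h7]
  · by_cases c1 : u' = u ∧ v' = v
    · obtain ⟨rfl, rfl⟩ := c1
      simp [Function.update_apply]
    · have c2 : ¬ (u' = v ∧ v' = u) := by
        rintro ⟨rfl, rfl⟩
        exact absurd huv (not_lt.2 hlt.le)
      obtain ⟨h1, h2, h3⟩ := h.ident u' v' (by simpa [c1] using hD') hlt hw'
      simp only [Function.update_apply, index_inj, c1, c2, if_false]
      rw [if_neg h1.ne, if_neg h1.ne]
      exact ⟨by omega, h2, h3⟩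

/-- The numbering of the nodes of the wedge graph as held in memory. -/
structure Numbering (F : SimpleGraph (Fin n)) (N : ℕ) (name : Fin N ≃ wedgeVerts F)
    (X Y id : ℕ → ℕ) : Prop where
  ends : ∀ i : Fin N, ∃ u v : Fin n, X i = u ∧ Y i = v ∧ (name i).1 = s(u, v)
  ident : ∀ (u v : Fin n) (h : s(u, v) ∈ wedgeVerts F), id (u * n + v) = name.symm ⟨s(u, v), h⟩

/-- Two numbers of one edge would either have the same ordered ends, and then `id` identifies them,
or reversed ends, which contradicts `u < v`. Every node occurs, since its ends can be put in
ascending order and that pair has been scanned. -/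
theorem NumInv.exists_numbering {F : SimpleGraph (Fin n)} {D : Finset (Fin n × Fin n)} {N : ℕ}
    {X Y id : ℕ → ℕ} (h : NumInv F D N X Y id) (hD : ∀ u v, F.Adj u v → (u, v) ∈ D) :
    ∃ name, Numbering F N name X Y id := by
  choose u v hx hy hlt hd hw hid hid' using fun i : Fin N => h.node i i.2
  have hbij : Function.Bijective
      fun i : Fin N => (⟨s(u i, v i), hw i⟩ : wedgeVerts F) := by
    constructor
    · intro i j hij
      rcases Sym2.eq_iff.1 (congrArg Subtype.val hij) with ⟨h1, h2⟩ | ⟨h1, h2⟩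
      · have := hid i
        rw [h1, h2, hid j] at this
        exact Fin.ext this.symm
      · have := hlt i
        rw [h1, h2] at this
        exact absurd this (not_lt.2 (hlt j).le)
    · rintro ⟨e, he⟩
      have key : ∀ a b : Fin n, a < b → ∀ hab : s(a, b) ∈ wedgeVerts F, ∃ i : Fin N,
          (⟨s(u i, v i), hw i⟩ : wedgeVerts F) = ⟨s(a, b), hab⟩ := by
        intro a b hab hw'
        obtain ⟨k1, k2, k3⟩ := h.ident a b (hD a b (adj_of_mem_wedgeVerts hw')) hab hw'
        refine ⟨⟨_, k1⟩, Subtype.ext ?_⟩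
        rw [hx ⟨_, k1⟩] at k2
        rw [hy ⟨_, k1⟩] at k3
        simp only [Fin.ext k2, Fin.ext k3]
      induction e with
      | _ a b =>
        have hne : a ≠ b := (adj_of_mem_wedgeVerts he).ne
        rcases lt_or_gt_of_ne hne with hab | hab
        · exact key a b hab he
        · have he' : s(b, a) ∈ wedgeVerts F := by rwa [Sym2.eq_swap]
          obtain ⟨i, hi⟩ := key b a hab he'
          refine ⟨i, hi.trans (Subtype.ext ?_)⟩
          exact Sym2.eq_swap
  refine ⟨Equiv.ofBijective _ hbij, ?_, ?_⟩
  · exact fun i => ⟨u i, v i, hx i, hy i, rfl⟩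
  · intro a b hab
    obtain ⟨i, hi⟩ := hbij.2 ⟨s(a, b), hab⟩
    have : (Equiv.ofBijective _ hbij).symm ⟨s(a, b), hab⟩ = i := by
      rw [Equiv.symm_apply_eq]
      exact hi.symm
    rw [this]
    rcases Sym2.eq_iff.1 (congrArg Subtype.val hi) with ⟨h1, h2⟩ | ⟨h1, h2⟩
    · rw [← h1, ← h2, hid i]
    · rw [← h1, ← h2, hid' i]

theorem wp_numberNodes {G F : SimpleGraph (Fin n)} (hF : F ≤ G) {off nb : ℕ → ℕ}
    (hG : IsInput G off nb) {W : ℕ} {lam : ℝ} {s : State} (hW : n * n + 1 < W)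
    (hc : Ctx off nb n lam W s)
    (h : ∀ u v : Fin n, s.a 16 (u * n + v) = 1 ↔ s(u, v) ∈ wedgeVerts F) :
    WP W numberNodes s fun t s' => t ≤ ∑ u, (∑ _x ∈ nbrs G u, 60 + 18) + 7 ∧
      s'.w 2 ≤ n * n ∧ ∃ name, Numbering F (s'.w 2) name (s'.a 9) (s'.a 10) (s'.a 15) := by
  classical
  rw [numberNodes, wp_seq, wp_set]
  refine ⟨by simp; omega, ?_⟩
  have hc₀ : Ctx off nb n lam W (s.setW 2 0) :=
    ⟨by simp [hc.n_eq], hc.off_eq, hc.nb_eq, hc.lam_eq, hc.bdd.setW (by omega)⟩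
  refine wp_eachArc hG (fun D s => NumInv F D (s.w 2) (s.a 9) (s.a 10) (s.a 15)) (fun _ _ => 50)
    (by decide) rfl rfl rfl hc₀ ?_ ?_ ?_ ?_
  · intro D s₁ s₂ hw ha _ _ h
    simpa only [ha, hw 2 (by decide)] using h
  · refine ⟨fun i hi => ?_, fun u v h => ?_⟩
    · simp at hi
    · simp at h
  · intro D u x s₁ _ hux hD hf hc₁ h3 h6 _ _ _ hI
    have h16 : s₁.a 16 (u * n + x) = 1 ↔ s(u, x) ∈ wedgeVerts F := by
      rw [hf.a 16 rfl]
      exact h u x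
    have hle := hI.le
    have hb := hc₁.bdd.w 2
    have hu := u.2
    have hx := x.2
    have hn : n ≤ n * n := Nat.le_mul_self n
    rw [wp_cond]
    constructor
    · intro ht
      simp [h3, h6, hc₁.n_eq, h16] at ht
      simp [h3, h6, hc₁.n_eq, hb, (by omega : (u : ℕ) < W), (by omega : (x : ℕ) < W),
        (by omega : s₁.w 2 + 1 < W)]
      exact hI.push hD ht.1 ht.2
    · intro ht
      simp [h3, h6, hc₁.n_eq, h16] at ht
      simp
      exact hI.skip (by tauto)
  · intro t s' ht _ _ hI
    refine ⟨?_, hI.le, hI.exists_numbering fun u v huv => ?_⟩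
    · simp at ht ⊢
      omega
    · simpa using hF huv

end Number

/-! ### Duplicate-free lists stored in intervals of an array -/

section Lists

/-- The entries of `f` at the positions from `a` to `b - 1` are the elements of `S`, once each. -/
structure Lists (f : ℕ → ℕ) (a b : ℕ) (S : Set ℕ) : Prop where
  sound : ∀ p, a ≤ p → p < b → f p ∈ S
  complete : ∀ j ∈ S, ∃! p, a ≤ p ∧ p < b ∧ f p = j

theorem Lists.nil (f : ℕ → ℕ) (a : ℕ) : Lists f a a ∅ :=
  ⟨fun p h h' => by omega, fun j hj => absurd hj (by simp)⟩

theorem Lists.congr {f g : ℕ → ℕ} {a b : ℕ} {S : Set ℕ} (h : Lists f a b S)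
    (hg : ∀ p, a ≤ p → p < b → g p = f p) : Lists g a b S := by
  refine ⟨fun p hp hp' => by rw [hg p hp hp']; exact h.sound p hp hp', fun j hj => ?_⟩
  obtain ⟨p, ⟨h1, h2, h3⟩, hu⟩ := h.complete j hj
  refine ⟨p, ⟨h1, h2, by rw [hg p h1 h2, h3]⟩, fun q ⟨q1, q2, q3⟩ => hu q ⟨q1, q2, ?_⟩⟩
  rw [← hg q q1 q2, q3]

theorem Lists.append {f : ℕ → ℕ} {a b c : ℕ} {S T : Set ℕ} (h : Lists f a b S)
    (h' : Lists f b c T) (hab : a ≤ b) (hbc : b ≤ c) (hd : Disjoint S T) :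
    Lists f a c (S ∪ T) := by
  rw [Set.disjoint_left] at hd
  refine ⟨fun p hp hp' => ?_, fun j hj => ?_⟩
  · rcases lt_or_ge p b with hpb | hpb
    · exact Or.inl (h.sound p hp hpb)
    · exact Or.inr (h'.sound p hpb hp')
  · rcases hj with hj | hj
    · obtain ⟨p, ⟨h1, h2, h3⟩, hu⟩ := h.complete j hj
      refine ⟨p, ⟨h1, by omega, h3⟩, fun q ⟨q1, q2, q3⟩ => ?_⟩
      rcases lt_or_ge q b with hqb | hqb
      · exact hu q ⟨q1, hqb, q3⟩
      · exact absurd (q3 ▸ h'.sound q hqb q2) (hd hj)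
    · obtain ⟨p, ⟨h1, h2, h3⟩, hu⟩ := h'.complete j hj
      refine ⟨p, ⟨by omega, h2, h3⟩, fun q ⟨q1, q2, q3⟩ => ?_⟩
      rcases lt_or_ge q b with hqb | hqb
      · exact absurd hj (hd (q3 ▸ h.sound q q1 hqb))
      · exact hu q ⟨hqb, q2, q3⟩

theorem Lists.snoc {f : ℕ → ℕ} {a b j : ℕ} {S : Set ℕ} (h : Lists f a b S) (hab : a ≤ b)
    (hj : j ∉ S) : Lists (Function.update f b j) a (b + 1) (insert j S) := by
  have h1 : Lists (Function.update f b j) a b S := h.congr fun p _ hp => by simp [hp.ne]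
  have h2 : Lists (Function.update f b j) b (b + 1) {j} := by
    refine ⟨fun p hp hp' => ?_, fun k hk => ⟨b, ?_, ?_⟩⟩
    · obtain rfl : p = b := by omega
      simp
    · simp only [Set.mem_singleton_iff] at hk
      simp [hk]
    · rintro q ⟨q1, q2, _⟩
      omega
  have := h1.append h2 hab (by omega) (by simpa using hj)
  rwa [Set.union_comm, Set.singleton_union] at this

end Lists

end STCPeel


namespace STCPeel

/-! ### The sum of squared degrees as the measure of cost -/

section Size

variable {n : ℕ}

/-- The measure of the running time. -/
noncomputable def size (G : SimpleGraph (Fin n)) : ℕ := ∑ u, ((nbrs G u).card + 1) ^ 2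

theorem sum_arcs (G : SimpleGraph (Fin n)) (f : Fin n → Fin n → ℕ) :
    ∑ a ∈ arcs G, f a.1 a.2 = ∑ u, ∑ v ∈ nbrs G u, f u v := by
  classical
  simp only [arcs, nbrs, Finset.sum_filter]
  rw [← Finset.univ_product_univ, Finset.sum_product]

/-- Double counting: exchanging the two sums, `deg v` is counted once for each of the `deg v`
neighbours of `v`. Both the list construction and the peeling are paid for in this way. -/
theorem sum_nbrs_degree_add (G : SimpleGraph (Fin n)) :
    ∑ u, ∑ v ∈ nbrs G u, ((nbrs G u).card + (nbrs G v).card) = 2 * ∑ u, (nbrs G u).card ^ 2 := by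
  simp only [Finset.sum_add_distrib]
  have : ∑ u, ∑ v ∈ nbrs G u, (nbrs G v).card = ∑ v, ∑ u ∈ nbrs G v, (nbrs G v).card := by
    refine Finset.sum_comm' fun u v => ?_
    simp [G.adj_comm]
  rw [this]
  simp [two_mul, pow_two]

theorem sum_le_size (G : SimpleGraph (Fin n)) {c : ℕ} {f : Fin n → ℕ}
    (h : ∀ u, f u ≤ c * ((nbrs G u).card + 1) ^ 2) : ∑ u, f u ≤ c * size G := by
  rw [size, Finset.mul_sum]
  exact Finset.sum_le_sum fun u _ => h u

theorem card_nbrs_lt (G : SimpleGraph (Fin n)) (u : Fin n) : (nbrs G u).card < n := by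
  classical
  have : nbrs G u ⊆ Finset.univ.erase u := by
    intro v hv
    simpa using (mem_nbrs.1 hv).ne'
  have h := Finset.card_le_card this
  rw [Finset.card_erase_of_mem (Finset.mem_univ _), Finset.card_univ, Fintype.card_fin] at h
  have := u.pos
  omega

theorem size_le (G : SimpleGraph (Fin n)) : size G ≤ n ^ 3 := by
  have : size G ≤ ∑ _u : Fin n, n ^ 2 :=
    Finset.sum_le_sum fun u _ => Nat.pow_le_pow_left (card_nbrs_lt G u) 2
  refine this.trans (le_of_eq ?_)
  simp
  ring

theorem le_size (G : SimpleGraph (Fin n)) : n ≤ size G := by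
  have : ∑ _u : Fin n, 1 ≤ size G := Finset.sum_le_sum fun u _ => Nat.one_le_pow _ _ (by omega)
  simpa using this

/-- The degree of the vertex with number `k`. -/
noncomputable def deg (G : SimpleGraph (Fin n)) (k : ℕ) : ℕ :=
  if h : k < n then (nbrs G ⟨k, h⟩).card else 0

@[simp] theorem deg_coe (G : SimpleGraph (Fin n)) (u : Fin n) : deg G u = (nbrs G u).card := by
  simp [deg]

/-- Sending a node to its stored pair of ends injects the nodes into the ordered adjacent pairs of
`G`. -/
theorem Numbering.sum_le {F G : SimpleGraph (Fin n)} (hF : F ≤ G) {N : ℕ}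
    {name : Fin N ≃ wedgeVerts F} {X Y id : ℕ → ℕ} (h : Numbering F N name X Y id)
    (g : ℕ → ℕ → ℕ) :
    ∑ i ∈ Finset.range N, g (X i) (Y i) ≤ ∑ u, ∑ v ∈ nbrs G u, g (u : Fin n) v := by
  classical
  choose u v hx hy hn using h.ends
  rw [← Fin.sum_univ_eq_sum_range (fun i => g (X i) (Y i)), ← sum_arcs]
  have hinj : Function.Injective fun i : Fin N => (u i, v i) := by
    intro i j hij
    simp only [Prod.mk.injEq] at hij
    apply name.injective
    apply Subtype.ext
    rw [hn i, hn j, hij.1, hij.2]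
  have : ∑ i : Fin N, g (X i) (Y i) =
      ∑ a ∈ Finset.univ.image fun i : Fin N => (u i, v i), g a.1 a.2 := by
    rw [Finset.sum_image hinj.injOn]
    simp [hx, hy]
  rw [this]
  refine Finset.sum_le_sum_of_subset ?_
  intro a ha
  simp only [Finset.mem_image, Finset.mem_univ, true_and] at ha
  obtain ⟨i, rfl⟩ := ha
  have := (name i).2
  rw [hn i] at this
  simpa using hF (adj_of_mem_wedgeVerts this)

/-- This sum controls both the time for building the adjacency lists of the wedge graph and their
total length. -/
theorem Numbering.sum_deg_le {F G : SimpleGraph (Fin n)} (hF : F ≤ G) {N : ℕ}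
    {name : Fin N ≃ wedgeVerts F} {X Y id : ℕ → ℕ} (h : Numbering F N name X Y id) :
    ∑ i ∈ Finset.range N, (deg G (X i) + deg G (Y i)) ≤ 2 * size G := by
  refine (h.sum_le hF fun x y => deg G x + deg G y).trans ?_
  simp only [deg_coe]
  rw [sum_nbrs_degree_add]
  refine Nat.mul_le_mul_left _ ?_
  exact Finset.sum_le_sum fun u _ => Nat.pow_le_pow_left (by omega) 2

theorem Numbering.le_size {F G : SimpleGraph (Fin n)} (hF : F ≤ G) {N : ℕ}
    {name : Fin N ≃ wedgeVerts F} {X Y id : ℕ → ℕ} (h : Numbering F N name X Y id) :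
    N ≤ size G := by
  have := h.sum_le hF fun _ _ => 1
  simp only [Finset.sum_const, Finset.card_range, smul_eq_mul, mul_one] at this
  refine this.trans ?_
  exact Finset.sum_le_sum fun u _ => by nlinarith

end Size

/-! ### Adjacency lists of the wedge graph -/

section Build

variable {n : ℕ}

/-- The numbers of the edges `cw` for which `(o, c, w)` is a wedge with `w ∈ P`. -/
def wedgeIds (F : SimpleGraph (Fin n)) (id : ℕ → ℕ) (o c : Fin n) (P : Set (Fin n)) : Set ℕ :=
  {j | ∃ w ∈ P, IsWedge F o c w ∧ id (c * n + w) = j}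

/-- The numbers of the neighbours of a node of the wedge graph. -/
def nbrIds {F : SimpleGraph (Fin n)} {N : ℕ} (name : Fin N ≃ wedgeVerts F) (i : Fin N) : Set ℕ :=
  {j | ∃ k : Fin N, (k : ℕ) = j ∧ (wedgeGraph F).Adj (name i) (name k)}

theorem Numbering.ident_inj {F : SimpleGraph (Fin n)} {N : ℕ} {name : Fin N ≃ wedgeVerts F}
    {X Y id : ℕ → ℕ} (h : Numbering F N name X Y id) {a b c d : Fin n}
    (hab : s(a, b) ∈ wedgeVerts F) (hcd : s(c, d) ∈ wedgeVerts F)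
    (he : id (a * n + b) = id (c * n + d)) : s(a, b) = s(c, d) := by
  rw [h.ident a b hab, h.ident c d hcd] at he
  exact congrArg Subtype.val (name.symm.injective (Fin.ext he))

/-- The centre of a wedge containing the edge `xy` is `x` or `y`; the two sets collect the other
legs for these two centres. -/
theorem Numbering.nbrIds_eq {F : SimpleGraph (Fin n)} {N : ℕ} {name : Fin N ≃ wedgeVerts F}
    {X Y id : ℕ → ℕ} (h : Numbering F N name X Y id) {i : Fin N} {x y : Fin n}
    (hi : (name i).1 = s(x, y)) :
    nbrIds name i = wedgeIds F id y x Set.univ ∪ wedgeIds F id x y Set.univ := by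
  ext j
  simp only [nbrIds, wedgeIds, Set.mem_ofPred_eq, Set.mem_union, Set.mem_univ, true_and]
  constructor
  · rintro ⟨k, rfl, a, b, c, hw, h1, h2⟩
    have hk : id (b * n + c) = k := by
      rw [h.ident b c hw.right_mem]
      congr 1
      rw [Equiv.symm_apply_eq]
      exact Subtype.ext h2.symm
    rw [hi] at h1
    rcases Sym2.eq_iff.1 h1 with ⟨rfl, rfl⟩ | ⟨rfl, rfl⟩
    · exact Or.inr ⟨c, hw, hk⟩
    · exact Or.inl ⟨c, hw, hk⟩
  · rintro (⟨w, hw, rfl⟩ | ⟨w, hw, rfl⟩)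
    · refine ⟨_, (h.ident x w hw.right_mem).symm, y, x, w, hw, ?_, ?_⟩
      · rw [hi, Sym2.eq_swap]
      · simp
    · refine ⟨_, (h.ident y w hw.right_mem).symm, x, y, w, hw, hi, ?_⟩
      simp

/-- An edge at both `x` and `y` would be `xy` itself, but the far end of a wedge differs from its
first vertex. Hence concatenating the two lists repeats nothing. -/
theorem Numbering.disjoint {F : SimpleGraph (Fin n)} {N : ℕ} {name : Fin N ≃ wedgeVerts F}
    {X Y id : ℕ → ℕ} (h : Numbering F N name X Y id) (x y : Fin n) :
    Disjoint (wedgeIds F id y x Set.univ) (wedgeIds F id x y Set.univ) := by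
  rw [Set.disjoint_left]
  rintro j ⟨w, _, hw, rfl⟩ ⟨w', _, hw', he⟩
  rcases Sym2.eq_iff.1 (h.ident_inj hw'.right_mem hw.right_mem he) with ⟨h1, _⟩ | ⟨h1, h2⟩
  · exact hw.1.ne h1
  · exact hw.2.2.1 h1

/-- Appends the numbers of the edges that form a wedge with the edge of variables 12, 13 at the
vertex of variable 12 to array 12. -/
def listWedges : Cmd := eachNb 12 7 8 9
  (.cond (.and (.not (.eq (.var 9) (.var 13))) (.and (.eq (.arr 14 (entry 12 9)) (.const 1))
      (.eq (.arr 14 (entry 13 9)) (.const 0))))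
    (.store 12 (.var 10) (.arr 15 (entry 12 9)) ;; .set 10 (.add (.var 10) (.const 1)))
    .skip)

/-- As `oc` is known to be an edge, a wedge only needs `w ≠ o`, `cw` in `F` and `ow` not in `F`.
Different `w` give different edges, hence different numbers, so every entry is new. -/
theorem wp_listWedges {G F : SimpleGraph (Fin n)} (hF : F ≤ G) {off nb : ℕ → ℕ}
    (hG : IsInput G off nb) {W : ℕ} {lam : ℝ} {s : State} (hc : Ctx off nb n lam W s)
    (h14 : IsMatrix F (s.a 14)) {N : ℕ} {name : Fin N ≃ wedgeVerts F} {X Y : ℕ → ℕ}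
    (hN : Numbering F N name X Y (s.a 15)) {c o : Fin n} (hco : F.Adj o c)
    (h12 : s.w 12 = c) (h13 : s.w 13 = o) (hW : s.w 10 + (nbrs G c).card < W) :
    WP W listWedges s fun t s' => t ≤ 60 * (nbrs G c).card + 11 ∧
      s.w 10 ≤ s'.w 10 ∧ s'.w 10 ≤ s.w 10 + (nbrs G c).card ∧
      (∀ p < s.w 10, s'.a 12 p = s.a 12 p) ∧
      Lists (s'.a 12) (s.w 10) (s'.w 10) (wedgeIds F (s.a 15) o c Set.univ) := by
  classical
  refine wp_eachNb hG c (fun P s' => s.w 10 ≤ s'.w 10 ∧ s'.w 10 ≤ s.w 10 + P.card ∧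
      (∀ p < s.w 10, s'.a 12 p = s.a 12 p) ∧
      Lists (s'.a 12) (s.w 10) (s'.w 10) (wedgeIds F (s.a 15) o c P)) (fun _ => 50)
    rfl rfl rfl rfl (by decide) (by decide) hc.bdd hc.off_eq hc.nb_eq h12 ?_ ?_ ?_ ?_
  · intro P s₁ s₂ hw ha _ _ h
    simpa only [ha, hw 10 (by decide) (by decide) (by decide)] using h
  · refine ⟨le_rfl, by simp, fun _ _ => rfl, ?_⟩
    have : wedgeIds F (s.a 15) o c (∅ : Finset (Fin n)) = ∅ := by simp [wedgeIds]
    rw [this]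
    exact Lists.nil _ _
  · intro P x s₁ hP hcx hxP hf hb h9 _ _ _ ⟨i1, i2, i3, i4⟩
    have h0' : s₁.w 0 = n := by rw [hf.w 0 rfl, hc.n_eq]
    have h12' : s₁.w 12 = c := by rw [hf.w 12 rfl, h12]
    have h13' : s₁.w 13 = o := by rw [hf.w 13 rfl, h13]
    have h14' : IsMatrix F (s₁.a 14) := by
      rw [hf.a 14 rfl]
      exact h14
    have h15' : s₁.a 15 = s.a 15 := hf.a 15 rfl
    have hcard : P.card + 1 ≤ (nbrs G c).card := by
      rw [← Finset.card_insert_of_notMem hxP]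
      exact Finset.card_le_card (Finset.insert_subset (mem_nbrs.2 hcx) hP)
    rw [wp_cond]
    have htest : Test.holds s₁ (.and (.not (.eq (.var 9) (.var 13)))
        (.and (.eq (.arr 14 (entry 12 9)) (.const 1))
          (.eq (.arr 14 (entry 13 9)) (.const 0)))) ↔ IsWedge F o c x := by
      simp only [Test.holds, WExp.eval, entry_eval, h12', h13', h9, h0', h14' c x, h14' o x,
        IsWedge, Fin.val_inj, hco, true_and]
      simp
      tauto
    rw [htest]
    constructor
    · intro hw
      have hid : s₁.a 15 (c * n + x) < W := hb.a _ _
      rw [h15'] at hid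
      simp [h12', h9, h0', h15', hid, (by omega : s₁.w 10 + 1 < W)]
      refine ⟨by omega, ?_, ?_, ?_⟩
      · rw [Finset.card_insert_of_notMem hxP]
        omega
      · intro p hp
        rw [Function.update_of_ne (by omega), i3 p hp]
      · have hset : wedgeIds F (s.a 15) o c (insert x (P : Set (Fin n))) =
            insert (s.a 15 (c * n + x)) (wedgeIds F (s.a 15) o c P) := by
          ext j
          simp only [wedgeIds, Set.mem_insert_iff, Set.mem_ofPred_eq]
          constructor
          · rintro ⟨w, rfl | hw', hw'', rfl⟩
            · exact Or.inl rfl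
            · exact Or.inr ⟨w, hw', hw'', rfl⟩
          · rintro (rfl | ⟨w, hw', hw'', rfl⟩)
            · exact ⟨x, Or.inl rfl, hw, rfl⟩
            · exact ⟨w, Or.inr hw', hw'', rfl⟩
        rw [hset]
        refine i4.snoc i1 ?_
        rintro ⟨w, hw', hw'', he⟩
        have := Sym2.congr_right.1 (hN.ident_inj hw''.right_mem hw.right_mem he)
        subst this
        exact hxP hw'
    · intro hw
      simp
      refine ⟨i1, ?_, i3, ?_⟩
      · rw [Finset.card_insert_of_notMem hxP]
        omega
      · have hset : wedgeIds F (s.a 15) o c (insert x (P : Set (Fin n))) =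
            wedgeIds F (s.a 15) o c P := by
          ext j
          simp only [wedgeIds, Set.mem_insert_iff, Set.mem_ofPred_eq]
          constructor
          · rintro ⟨w, rfl | hw', hw'', rfl⟩
            · exact absurd hw'' hw
            · exact ⟨w, hw', hw'', rfl⟩
          · rintro ⟨w, hw', hw'', rfl⟩
            exact ⟨w, Or.inr hw', hw'', rfl⟩
        rw [hset]
        exact i4
  · intro t s' ht _ _ ⟨i1, i2, i3, i4⟩
    refine ⟨by simp at ht; omega, i1, i2, i3, ?_⟩
    convert i4 using 1
    ext j
    simp only [wedgeIds, Set.mem_ofPred_eq, Set.mem_univ, true_and, Finset.mem_coe, mem_nbrs]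
    refine exists_congr fun w => ?_
    constructor
    · rintro ⟨h1, h2⟩
      exact ⟨hF h1.2.1, h1, h2⟩
    · rintro ⟨_, h1, h2⟩
      exact ⟨h1, h2⟩

/-- Writes the adjacency lists of the wedge graph to arrays 11 and 12. -/
def buildLists : Cmd := .set 10 (.const 0) ;; .store 11 (.const 0) (.const 0) ;;
  upTo 11 2 (.set 12 (.arr 9 (.var 11)) ;; .set 13 (.arr 10 (.var 11)) ;; listWedges ;;
    .set 12 (.arr 10 (.var 11)) ;; .set 13 (.arr 9 (.var 11)) ;; listWedges ;;
    .store 11 (.add (.var 11) (.const 1)) (.var 10))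

/-- The adjacency lists of the first `i` nodes of the wedge graph are complete, and `e` is the next
free position. -/
structure ListsInv {F : SimpleGraph (Fin n)} {N : ℕ} (name : Fin N ≃ wedgeVerts F)
    (i e : ℕ) (off nb : ℕ → ℕ) : Prop where
  zero : off 0 = 0
  last : off i = e
  mono : ∀ j < i, off j ≤ off (j + 1)
  le : ∀ j ≤ i, off j ≤ e
  lists : ∀ j : Fin N, (j : ℕ) < i → Lists nb (off j) (off (j + 1)) (nbrIds name j)

theorem ListsInv.push {F : SimpleGraph (Fin n)} {N : ℕ} {name : Fin N ≃ wedgeVerts F}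
    {e e' : ℕ} {off nb nb' : ℕ → ℕ} {i : Fin N} (h : ListsInv name i e off nb) (he : e ≤ e')
    (hnb : ∀ p < e, nb' p = nb p) (hl : Lists nb' e e' (nbrIds name i)) :
    ListsInv name (i + 1) e' (Function.update off (i + 1) e') nb' := by
  obtain ⟨h0, h1, h2, h3, h4⟩ := h
  refine ⟨by simp [h0], by simp, fun j hj => ?_, fun j hj => ?_, fun j hj => ?_⟩
  · rcases Nat.lt_succ_iff_lt_or_eq.1 hj with hj | rfl
    · rw [Function.update_of_ne (by omega), Function.update_of_ne (by omega)]
      exact h2 j hj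
    · simp [h1, he]
  · by_cases hji : j = i + 1
    · simp [hji]
    · simpa [hji] using (h3 j (by omega)).trans he
  · rcases Nat.lt_succ_iff_lt_or_eq.1 hj with hj | hj
    · have : Lists nb' (off j) (off (j + 1)) (nbrIds name j) := by
        refine (h4 j hj).congr fun p _ hp => hnb p (hp.trans_le (h3 _ hj))
      rwa [Function.update_of_ne (by omega), Function.update_of_ne (by omega)]
    · obtain rfl := Fin.ext hj
      simpa [h1] using hl

theorem ListsInv.isAdjList {F : SimpleGraph (Fin n)} {N : ℕ} {name : Fin N ≃ wedgeVerts F}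
    {e : ℕ} {off nb : ℕ → ℕ} (h : ListsInv name N e off nb) :
    IsAdjList (wedgeGraph F) name off nb := by
  refine ⟨h.zero, fun i => h.mono i i.2, fun i p hp hp' => ?_, fun i j hij => ?_⟩
  · obtain ⟨k, hk, hadj⟩ := (h.lists i i.2).sound p hp hp'
    exact ⟨k, hk.symm, hadj⟩
  · exact (h.lists i i.2).complete j ⟨j, rfl, hij⟩

theorem wp_buildLists {G F : SimpleGraph (Fin n)} (hF : F ≤ G) {off nb : ℕ → ℕ}
    (hG : IsInput G off nb) {W : ℕ} {lam : ℝ} {s : State} (hc : Ctx off nb n lam W s)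
    (h14 : IsMatrix F (s.a 14)) {N : ℕ} (hNdef : s.w 2 = N)
    {name : Fin N ≃ wedgeVerts F} (hN : Numbering F N name (s.a 9) (s.a 10) (s.a 15)) (hW : 2 * size G < W) :
    WP W buildLists s fun t s' => t ≤ 300 * size G + 20 ∧
      IsAdjList (wedgeGraph F) name (s'.a 11) (s'.a 12) ∧ s'.a 11 N ≤ 2 * size G := by
  set s₀ : State := (s.setW 10 0).setA 11 0 0 with hs₀
  have hW0 : 0 < W := by omega
  have hb₀ : s₀.Bdd W := (hc.bdd.setW hW0).setA hW0
  have hc₀ : Ctx off nb n lam W s₀ :=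
    ⟨by simp [hs₀, hc.n_eq], by simp [hs₀, hc.off_eq], by simp [hs₀, hc.nb_eq],
      by simp [hs₀, hc.lam_eq], hb₀⟩
  have hsum := hN.sum_deg_le hF
  have hNs := hN.le_size hF
  rw [buildLists, wp_seq, wp_set]
  refine ⟨hW0, ?_⟩
  rw [wp_seq, wp_store]
  refine ⟨hW0, ?_⟩
  simp only [WExp.eval, WExp.cost]
  rw [← hs₀]
  -- The budget of node `i`, the sum of the degrees of its two ends: it bounds both the time spent
  -- on its list and the length of that list.
  let D : ℕ → ℕ := fun i => deg G (s.a 9 i) + deg G (s.a 10 i)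
  have hsum' : ∀ i ≤ N, ∑ j ∈ Finset.range i, D j ≤ 2 * size G := fun i hi =>
    (Finset.sum_le_sum_of_subset (Finset.range_mono hi)).trans hsum
  refine wp_upTo (N := N) (fun i s' => ListsInv name i (s'.w 10) (s'.a 11) (s'.a 12) ∧
      s'.w 10 ≤ ∑ j ∈ Finset.range i, D j) (fun i => 60 * D i + 60)
    rfl rfl (by decide) hb₀ (by simp [hs₀, hNdef]) ?_ ?_ ?_
  · refine ⟨⟨by simp [hs₀], by simp [hs₀], by simp, ?_, by simp⟩, by simp [hs₀]⟩
    intro j hj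
    simp [hs₀, Nat.le_zero.1 hj]
  · intro i s₁ hi hf hb hx ⟨hI, hI'⟩
    have hc₁ := hc₀.frame hf hb rfl rfl rfl rfl
    have f9 : s₁.a 9 = s.a 9 := by rw [hf.a 9 rfl]; simp [hs₀]
    have f10 : s₁.a 10 = s.a 10 := by rw [hf.a 10 rfl]; simp [hs₀]
    have f14 : s₁.a 14 = s.a 14 := by rw [hf.a 14 rfl]; simp [hs₀]
    have f15 : s₁.a 15 = s.a 15 := by rw [hf.a 15 rfl]; simp [hs₀]
    obtain ⟨u, v, hu, hv, huv⟩ := hN.ends ⟨i, hi⟩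
    simp only at hu hv
    have hadj : F.Adj u v := adj_of_mem_wedgeVerts (huv ▸ (name ⟨i, hi⟩).2)
    have hDi : D i = (nbrs G u).card + (nbrs G v).card := by simp [D, hu, hv]
    have hs1 := hsum' (i + 1) hi
    rw [Finset.sum_range_succ, hDi] at hs1
    have huW : (u : ℕ) < W := by rw [← hu]; exact hc.bdd.a _ _
    have hvW : (v : ℕ) < W := by rw [← hv]; exact hc.bdd.a _ _
    simp only [wp_seq, wp_set, WExp.eval, WExp.cost, hx, State.setW_w, State.setW_a, f9, f10, hu,
      huW, true_and]
    norm_num only [if_true, if_false, hx, hv, true_and, hvW]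
    set s₂ : State := (s₁.setW 12 u).setW 13 v with hs₂
    have hc₂ : Ctx off nb n lam W s₂ :=
      ⟨by simp [hs₂, hc₁.n_eq], hc₁.off_eq, hc₁.nb_eq, hc₁.lam_eq, (hb.setW huW).setW hvW⟩
    refine (wp_listWedges (c := u) (o := v) hF hG hc₂ (by simpa [hs₂, f14] using h14)
      (by simpa [hs₂, f15] using hN) hadj.symm (by simp [hs₂]) (by simp [hs₂])
      (by simp [hs₂]; omega)).strengthen hc₂.bdd ?_
    rintro t₁ s₃ ⟨ht₁, j1, j2, j3, j4⟩ hf₃ hb₃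
    have e10 : s₂.w 10 = s₁.w 10 := by simp [hs₂]
    have e12 : s₂.a 12 = s₁.a 12 := by simp [hs₂]
    rw [e10] at j1 j2 j3 j4
    rw [e12] at j3
    have hc₃ := hc₂.frame hf₃ hb₃ rfl rfl rfl rfl
    have g9 : s₃.a 9 = s.a 9 := by rw [hf₃.a 9 rfl]; simp [hs₂, f9]
    have g10 : s₃.a 10 = s.a 10 := by rw [hf₃.a 10 rfl]; simp [hs₂, f10]
    have g14 : s₃.a 14 = s.a 14 := by rw [hf₃.a 14 rfl]; simp [hs₂, f14]
    have g15 : s₃.a 15 = s.a 15 := by rw [hf₃.a 15 rfl]; simp [hs₂, f15]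
    have gx : s₃.w 11 = i := by rw [hf₃.w 11 rfl]; simp [hs₂, hx]
    rw [show s₂.a 15 = s.a 15 by simp [hs₂, f15]] at j4
    simp only [gx, g9, g10, hu, hv, huW, hvW, true_and]
    set s₄ : State := (s₃.setW 12 v).setW 13 u with hs₄
    have hc₄ : Ctx off nb n lam W s₄ :=
      ⟨by simp [hs₄, hc₃.n_eq], hc₃.off_eq, hc₃.nb_eq, hc₃.lam_eq, (hb₃.setW hvW).setW huW⟩
    refine (wp_listWedges (c := v) (o := u) hF hG hc₄ (by simpa [hs₄, g14] using h14)
      (by simpa [hs₄, g15] using hN) hadj (by simp [hs₄]) (by simp [hs₄])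
      (by simp [hs₄]; omega)).strengthen hc₄.bdd ?_
    rintro t₂ s₅ ⟨ht₂, k1, k2, k3, k4⟩ hf₅ hb₅
    have e10' : s₄.w 10 = s₃.w 10 := by simp [hs₄]
    have e12' : s₄.a 12 = s₃.a 12 := by simp [hs₄]
    rw [e10'] at k1 k2 k3 k4
    rw [e12'] at k3
    rw [show s₄.a 15 = s.a 15 by simp [hs₄, g15]] at k4
    have l11 : s₅.w 11 = i := by rw [hf₅.w 11 rfl]; simp [hs₄, gx]
    have m11 : s₅.a 11 = s₁.a 11 := by
      rw [hf₅.a 11 rfl, hs₄, State.setW_a, State.setW_a, hf₃.a 11 rfl, hs₂]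
      simp
    rw [wp_store]
    refine ⟨hb₅.w 10, ?_, ?_, ?_⟩
    · simp only [WExp.cost, hDi]
      omega
    -- The block for centre `u` is followed by the block for centre `v`; together they form the
    -- neighbour list of the node.
    · have hl := (j4.congr (fun p _ hp => k3 p hp)).append k4 j1 k1 (hN.disjoint u v)
      rw [← hN.nbrIds_eq huv] at hl
      have := hI.push (i := ⟨i, hi⟩) (j1.trans k1)
        (fun p hp => (k3 p (hp.trans_le j1)).trans (j3 p hp)) hl
      simpa [l11, m11] using this
    · rw [Finset.sum_range_succ, hDi]
      simp
      omega
  · intro t s' ht _ _ ⟨hI, hI'⟩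
    refine ⟨?_, hI.isAdjList, ?_⟩
    · have : ∑ i ∈ Finset.range N, (60 * D i + 60 + 7) =
          60 * ∑ i ∈ Finset.range N, D i + 67 * N := by
        rw [Finset.mul_sum]
        simp only [add_assoc, Finset.sum_add_distrib]
        simp
        ring
      rw [this] at ht
      have := hsum' N le_rfl
      omega
    · rw [hI.last]
      exact hI'.trans (hsum' N le_rfl)

end Build

end STCPeel


namespace STCPeel

/-! ## Labels -/

section Labels

variable {n : ℕ}

theorem IsAdjList.off_le {X : Type*} {N : ℕ} {H : SimpleGraph X} {name : Fin N ≃ X}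
    {off nb : ℕ → ℕ} (h : IsAdjList H name off nb) {i j : ℕ} (hij : i ≤ j) (hj : j ≤ N) :
    off i ≤ off j := by
  induction j, hij using Nat.le_induction with
  | base => exact le_rfl
  | succ k _ ih => exact (ih (by omega)).trans (h.mono ⟨k, by omega⟩)

theorem IsAdjList.row_unique {X : Type*} {N : ℕ} {H : SimpleGraph X} {name : Fin N ≃ X}
    {off nb : ℕ → ℕ} (h : IsAdjList H name off nb) {u v : Fin N} {p : ℕ} (hu : off u ≤ p)
    (hu' : p < off (u + 1)) (hv : off v ≤ p) (hv' : p < off (v + 1)) : u = v := by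
  rcases lt_trichotomy u v with hlt | he | hlt
  · have := h.off_le (i := u + 1) (j := v) (by simpa using hlt) v.2.le
    omega
  · exact he
  · have := h.off_le (i := v + 1) (j := u) (by simpa using hlt) u.2.le
    omega

theorem off_succ {G : SimpleGraph (Fin n)} {off nb : ℕ → ℕ} (hG : IsInput G off nb) (u : Fin n) :
    off (u + 1) = off u + (nbrs G u).card := by
  have h := sum_entries hG u (fun _ => 1) (fun _ => 1) (by simp)
  simp at h
  have := hG.adj.mono u
  omega

theorem off_le_size {G : SimpleGraph (Fin n)} {off nb : ℕ → ℕ} (hG : IsInput G off nb) :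
    off n ≤ size G := by
  have h : ∀ i ≤ n, off i = ∑ j ∈ Finset.range i, deg G j := by
    intro i hi
    induction i with
    | zero => simp [hG.adj.zero]
    | succ i ih =>
      rw [Finset.sum_range_succ, ← ih (by omega)]
      have := off_succ hG ⟨i, by omega⟩
      rw [← deg_coe] at this
      exact this
  rw [h n le_rfl, ← Fin.sum_univ_eq_sum_range]
  exact Finset.sum_le_sum fun u _ => by rw [deg_coe]; nlinarith

/-- Writes the labels to array 13. -/
def writeLabels : Cmd := eachArc (.store 13 (.var 4) (.arr 17 (entry 3 6)))

/-- A position lies in one block only (`IsAdjList.row_unique`) and stands for one neighbour, so no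
label is overwritten by that of another arc. -/
theorem wp_writeLabels {G : SimpleGraph (Fin n)} {off nb : ℕ → ℕ}
    (hG : IsInput G off nb) {W : ℕ} {lam : ℝ} {s : State} (hc : Ctx off nb n lam W s)
    {weak : Set (Sym2 (Fin n))} (h17 : IsEdgeMatrix weak (s.a 17)) :
    WP W writeLabels s fun t s' => t ≤ ∑ u, (∑ _x ∈ nbrs G u, 20 + 18) + 5 ∧
      IsEdgeArray G off nb (weak.indicator fun _ => 1) (s'.a 13) := by
  classical
  refine wp_eachArc hG (fun D s => ∀ u v : Fin n, (u, v) ∈ D → ∀ p, off u ≤ p → p < off (u + 1) →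
      nb p = v → s.a 13 p = weak.indicator (fun _ => 1) s(u, v)) (fun _ _ => 10)
    (by decide) rfl rfl rfl hc ?_ (by simp) ?_ ?_
  · intro D s₁ s₂ _ ha _ _ h
    simpa only [ha] using h
  · intro D u x s₁ _ hux hD hf hc₁ h3 h6 hp hp' hnb hI
    have hb := hc₁.bdd.a 17 (u * n + x)
    have h17' : IsEdgeMatrix weak (s₁.a 17) := by
      rw [hf.a 17 rfl]
      exact h17
    simp [h3, h6, hc₁.n_eq, hb]
    intro v w hvw p hq hq' hnbq
    by_cases hpq : p = s₁.w 4
    · subst hpq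
      obtain rfl := hG.adj.row_unique hp hp' hq hq'
      obtain rfl : x = w := Fin.ext (hnb.symm.trans hnbq)
      simp [h17' u x]
    · rw [Function.update_of_ne hpq]
      refine hI v w (hvw.resolve_left ?_) p hq hq' hnbq
      rintro ⟨rfl, rfl⟩
      exact hpq ((hG.adj.complete v w hux).unique ⟨hq, hq', hnbq⟩ ⟨hp, hp', hnb⟩)
  · intro t s' ht _ _ hI
    exact ⟨by simpa using ht, fun u v huv p => hI u v (by simpa using huv) p⟩

end Labels

/-! ## Apr-MinSTC -/

section Apr

variable {n : ℕ}

/-- Apr-MinSTC on the subgraph induced by the flags in array 8. -/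
def apr : Cmd := loadGraph ;; scanWedges ;; numberNodes ;; buildLists ;; writeLabels

theorem IsAprMinSTC.subset_edgeSet {F : SimpleGraph (Fin n)} {weak : Set (Sym2 (Fin n))}
    (h : IsAprMinSTC F weak) {u v : Fin n} (huv : s(u, v) ∈ weak) : F.Adj u v := by
  obtain ⟨M, _, rfl⟩ := h
  obtain ⟨⟨e, he⟩, _, rfl⟩ := huv
  exact adj_of_mem_wedgeVerts he

theorem sub_le (G : SimpleGraph (Fin n)) (U : Finset (Fin n)) : sub G U ≤ G :=
  fun _ _ h => (sub_adj.1 h).1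

/-- The results of Apr-MinSTC on `F`. -/
structure AprPost (G F : SimpleGraph (Fin n)) (off nb : ℕ → ℕ) (weak : Set (Sym2 (Fin n)))
    (s : State) : Prop where
  label : IsAprMinSTC F weak
  graph : IsWedgeGraphArrays F (s.w 2) (s.a 9) (s.a 10) (s.a 11) (s.a 12)
  edges : IsEdgeArray G off nb (weak.indicator fun _ => 1) (s.a 13)
  matrix : IsEdgeMatrix weak (s.a 17)
  clean : CleanOutside G s
  nodes_le : s.w 2 ≤ size G
  entries_le : s.a 11 (s.w 2) ≤ 2 * size G

/-- The postcondition contains `CleanOutside` again, since marks are only left on edges of the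
induced subgraph. This allows the same code to be run a second time on `G(U)`. -/
theorem wp_apr {G : SimpleGraph (Fin n)} {off nb : ℕ → ℕ} (hG : IsInput G off nb) {W : ℕ}
    {lam : ℝ} {s : State} (hW : 2 * n ^ 3 + n * n + 2 ≤ W) (hc : Ctx off nb n lam W s)
    {U : Finset (Fin n)} (hU : IsFlags U (s.a 8)) (h : CleanOutside G s) :
    WP W apr s fun t s' => t ≤ 1000 * size G + 50 ∧
      ∃ weak, AprPost G (sub G U) off nb weak s' := by
  have hF := sub_le G U
  have hsz := size_le G
  rw [apr, wp_seq]
  refine (wp_loadGraph hG (by omega) hc hU h).strengthen hc.bdd ?_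
  rintro t₁ s₁ ⟨ht₁, h14, h1617⟩ hf₁ hb₁
  have hc₁ := hc.frame hf₁ hb₁ rfl rfl rfl rfl
  rw [wp_seq]
  refine (wp_scanWedges hF hG (by omega) hc₁ h14 h1617).strengthen hb₁ ?_
  rintro t₂ s₂ ⟨ht₂, h16, h16', weak, hweak, h17⟩ hf₂ hb₂
  have hc₂ := hc₁.frame hf₂ hb₂ rfl rfl rfl rfl
  rw [wp_seq]
  refine (wp_numberNodes hF hG (by omega) hc₂ h16).strengthen hb₂ ?_
  rintro t₃ s₃ ⟨ht₃, _, name, hname⟩ hf₃ hb₃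
  have hc₃ := hc₂.frame hf₃ hb₃ rfl rfl rfl rfl
  have h14₃ : IsMatrix (sub G U) (s₃.a 14) := by
    rw [hf₃.a 14 rfl, hf₂.a 14 rfl]
    exact h14
  rw [wp_seq]
  refine (wp_buildLists hF hG hc₃ h14₃ rfl hname (by omega)).strengthen hb₃ ?_
  rintro t₄ s₄ ⟨ht₄, hadj, hlen⟩ hf₄ hb₄
  have hc₄ := hc₃.frame hf₄ hb₄ rfl rfl rfl rfl
  have h17₄ : IsEdgeMatrix weak (s₄.a 17) := by
    rw [hf₄.a 17 rfl, hf₃.a 17 rfl]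
    exact h17
  refine (wp_writeLabels hG hc₄ h17₄).strengthen hb₄ ?_
  rintro t₅ s₅ ⟨ht₅, hlab⟩ hf₅ hb₅
  have e2 : s₅.w 2 = s₃.w 2 := by rw [hf₅.w 2 rfl, hf₄.w 2 rfl]
  have e9 : s₅.a 9 = s₃.a 9 := by rw [hf₅.a 9 rfl, hf₄.a 9 rfl]
  have e10 : s₅.a 10 = s₃.a 10 := by rw [hf₅.a 10 rfl, hf₄.a 10 rfl]
  have e11 : s₅.a 11 = s₄.a 11 := hf₅.a 11 rfl
  have e12 : s₅.a 12 = s₄.a 12 := hf₅.a 12 rfl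
  have e14 : s₅.a 14 = s₃.a 14 := by rw [hf₅.a 14 rfl, hf₄.a 14 rfl]
  have e16 : s₅.a 16 = s₂.a 16 := by rw [hf₅.a 16 rfl, hf₄.a 16 rfl, hf₃.a 16 rfl]
  have e17 : s₅.a 17 = s₄.a 17 := hf₅.a 17 rfl
  refine ⟨?_, weak, ⟨hweak, ?_, hlab, ?_, ?_, ?_, ?_⟩⟩
  · have b1 : ∑ u, (∑ _x ∈ nbrs G u, 40 + 18) ≤ 40 * size G :=
      sum_le_size G fun u => by simp; nlinarith
    have b2 : ∑ u, (∑ _x ∈ nbrs G u, (∑ _z ∈ nbrs G u, 130 + 21) + 18) ≤ 200 * size G :=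
      sum_le_size G fun u => by simp; nlinarith
    have b3 : ∑ u, (∑ _x ∈ nbrs G u, 60 + 18) ≤ 60 * size G :=
      sum_le_size G fun u => by simp; nlinarith
    have b5 : ∑ u, (∑ _x ∈ nbrs G u, 20 + 18) ≤ 20 * size G :=
      sum_le_size G fun u => by simp; nlinarith
    omega
  · rw [e2, e9, e10, e11, e12]
    refine ⟨name, fun i => ?_, hadj⟩
    obtain ⟨u, v, hu, hv, huv⟩ := hname.ends i
    rw [huv, hu, hv, Sym2.map_mk]
  · rw [e17]
    exact h17₄
  · intro u v huv
    rw [e14, e16, e17]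
    refine ⟨?_, ?_, ?_⟩
    · rw [h14₃ u v, if_neg]
      exact fun h => huv (hF h)
    · have h1 := h16' u v
      have h2 : s₂.a 16 (u * n + v) ≠ 1 := by
        rw [Ne, h16]
        exact fun h => huv (hF (adj_of_mem_wedgeVerts h))
      omega
    · rw [h17₄ u v, Set.indicator_of_notMem]
      exact fun h => huv (hF (hweak.subset_edgeSet h))
  · rw [e2]
    exact hname.le_size hF
  · rw [e2, e11]
    exact hlen

theorem IsAdjList.congr {X : Type*} {N : ℕ} {H : SimpleGraph X} {name : Fin N ≃ X}
    {off nb off' nb' : ℕ → ℕ} (h : IsAdjList H name off nb) (ho : ∀ i ≤ N, off' i = off i)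
    (hn : ∀ p < off N, nb' p = nb p) : IsAdjList H name off' nb' := by
  have h1 : ∀ i : Fin N, off' i = off i := fun i => ho i i.2.le
  have h2 : ∀ i : Fin N, off' (i + 1) = off (i + 1) := fun i => ho (i + 1) i.2
  have h3 : ∀ (i : Fin N) p, p < off (i + 1) → nb' p = nb p := fun i p hp =>
    hn p (hp.trans_le (h.off_le i.2 le_rfl))
  refine ⟨by rw [ho 0 (by omega), h.zero], fun i => ?_, fun i p hp hp' => ?_, fun i j hij => ?_⟩
  · rw [h1, h2]
    exact h.mono i
  · rw [h1] at hp
    rw [h2] at hp'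
    rw [h3 i p hp']
    exact h.sound i p hp hp'
  · rw [h1, h2]
    obtain ⟨p, ⟨p1, p2, p3⟩, hu⟩ := h.complete i j hij
    refine ⟨p, ⟨p1, p2, by rw [h3 i p p2, p3]⟩, fun q ⟨q1, q2, q3⟩ => hu q ⟨q1, q2, ?_⟩⟩
    rw [← h3 i q q2, q3]

/-- Copies the results of Apr-MinSTC to arrays 2 to 6. -/
def copyOut : Cmd :=
  .set 11 (.add (.add (.var 2) (.arr 11 (.var 2))) (.add (.arr 0 (.var 0)) (.const 1))) ;;
  upTo 10 11 (.store 2 (.var 10) (.arr 9 (.var 10)) ;; .store 3 (.var 10) (.arr 10 (.var 10)) ;;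
    .store 4 (.var 10) (.arr 11 (.var 10)) ;; .store 5 (.var 10) (.arr 12 (.var 10)) ;;
    .store 6 (.var 10) (.arr 13 (.var 10))) ;;
  .set 1 (.var 2)

theorem wp_copyOut {G F : SimpleGraph (Fin n)} {off nb : ℕ → ℕ} (hG : IsInput G off nb) {W : ℕ}
    {lam : ℝ} {s : State} (hW : 4 * n ^ 3 + 2 ≤ W) (hc : Ctx off nb n lam W s)
    {weak : Set (Sym2 (Fin n))} (h : AprPost G F off nb weak s) :
    WP W copyOut s fun t s' => t ≤ 150 * size G + 60 ∧
      IsWedgeGraphArrays F (s'.w 1) (s'.a 2) (s'.a 3) (s'.a 4) (s'.a 5) ∧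
      IsEdgeArray G off nb (weak.indicator fun _ => 1) (s'.a 6) := by
  have hsz := size_le G
  have hoff := off_le_size hG
  have hN := h.nodes_le
  have hE := h.entries_le
  -- One loop copies all five arrays. Its length exceeds every index in use: nodes and their offsets
  -- up to `s.w 2`, entries below `s.a 11 (s.w 2)`, and positions below `off n`. Copying unused
  -- cells is harmless.
  set L := s.w 2 + s.a 11 (s.w 2) + (off n + 1) with hL
  rw [copyOut, wp_seq, wp_set]
  have hev : (WExp.add (.add (.var 2) (.arr 11 (.var 2)))
      (.add (.arr 0 (.var 0)) (.const 1))).eval s = L := by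
    simp [hc.n_eq, hc.off_eq, hL]
  rw [hev]
  have hLW : L < W := by omega
  refine ⟨hLW, ?_⟩
  have hb₀ : (s.setW 11 L).Bdd W := hc.bdd.setW hLW
  rw [wp_seq]
  refine wp_upTo (N := L) (fun i s' => ∀ j < i, s'.a 2 j = s.a 9 j ∧ s'.a 3 j = s.a 10 j ∧
      s'.a 4 j = s.a 11 j ∧ s'.a 5 j = s.a 12 j ∧ s'.a 6 j = s.a 13 j) (fun _ => 25)
    rfl rfl (by decide) hb₀ (by simp) (by simp) ?_ ?_
  · intro i s₁ hi hf hb hx hI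
    have e9 : s₁.a 9 = s.a 9 := hf.a 9 rfl
    have e10 : s₁.a 10 = s.a 10 := hf.a 10 rfl
    have e11 : s₁.a 11 = s.a 11 := hf.a 11 rfl
    have e12 : s₁.a 12 = s.a 12 := hf.a 12 rfl
    have e13 : s₁.a 13 = s.a 13 := hf.a 13 rfl
    simp [hx, e9, e10, e11, e12, e13, hc.bdd.a]
    intro j hj
    by_cases hji : j = i
    · simp [hji]
    · simpa [hji] using hI j (by omega)
  · intro t s' ht hf hb hI
    rw [wp_set]
    refine ⟨hb.w 2, ?_, ?_, ?_⟩
    · simp at ht ⊢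
      omega
    · have e2 : s'.w 2 = s.w 2 := by rw [hf.w 2 rfl]; simp
      obtain ⟨name, h1, h2⟩ := h.graph
      simp [e2]
      refine ⟨name, fun i => ?_, h2.congr (fun i hi => ?_) fun p hp => ?_⟩
      · rw [h1 i, (hI i (by omega)).1, (hI i (by omega)).2.1]
      · exact (hI i (by omega)).2.2.1
      · exact (hI p (by omega)).2.2.2.1
    · intro u v huv p hp hp' hnb
      have : off (u + 1) ≤ off n := hG.adj.off_le u.2 le_rfl
      simp
      rw [(hI p (by omega)).2.2.2.2]
      exact h.edges u v huv p hp hp' hnb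

end Apr

end STCPeel


namespace STCPeel

/-! ## A priority queue for keys `a + lam * b`

A vertex with key `(a, b)` is a member of cell `(a, b)`. The cells form a tree: the parent of
`(a, b)` is `(a - 1, b)` if `0 < a`, and `(0, b - 1)` if `a = 0 < b`. Every cell stores the
smallest key of a non-empty cell of its subtree, so a change in cell `(a, b)` costs `a + b + 1`
repairs. Keys are stored with an offset that makes them negative, so that `0` stands for an empty
subtree and the memory needs no initialisation. -/

section Tree

/-- Number of the cell `(a, b)`. -/
def cell (n a b : ℕ) : ℕ := a * (n + 1) + b

/-- The row length is `n + 1` because second coordinates up to `n` occur: the child `(0, b + 1)` of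
a cell with `b < n` is inspected as well. -/
theorem cell_inj {n a b a' b' : ℕ} (hb : b ≤ n) (hb' : b' ≤ n) :
    cell n a b = cell n a' b' ↔ a = a' ∧ b = b' := by
  constructor
  · intro h
    have h1 : a = a' := by
      have := congrArg (· / (n + 1)) h
      simpa [cell, mul_comm _ (n + 1), Nat.mul_add_div, Nat.div_eq_of_lt, Nat.lt_succ_of_le hb,
        Nat.lt_succ_of_le hb'] using this
    subst h1
    simp only [cell] at h
    omega
  · rintro ⟨rfl, rfl⟩
    rfl

/-- `(a', b')` lies in the subtree of `(a, b)`. -/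
def Below (a b a' b' : ℕ) : Prop := (a = 0 ∧ b ≤ b') ∨ (b' = b ∧ a ≤ a')

/-- The key of a cell, with offset. -/
noncomputable def cellKey (n : ℕ) (lam : ℝ) (a b : ℕ) : ℝ := a + lam * b - (n + n : ℕ)

/-- With `lam ≤ 1` and both counts below `n`, a key is smaller than the offset `n + n`, so it cannot
be mistaken for the sentinel `0`. -/
theorem cellKey_neg {n : ℕ} {lam : ℝ} (h : lam ≤ 1) {a b : ℕ} (ha : a < n) (hb : b < n) :
    cellKey n lam a b < 0 := by
  have h1 : (a : ℝ) < n := by exact_mod_cast ha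
  have h2 : (b : ℝ) < n := by exact_mod_cast hb
  have h3 : lam * b ≤ b := by nlinarith [(Nat.cast_nonneg b : (0 : ℝ) ≤ b)]
  simp only [cellKey]
  push_cast
  linarith

/-- `v` is the smallest key of a non-empty cell in `S`, attained by the cell with number `c`; if
there is no such cell then `v = 0`. -/
structure MinOn (n : ℕ) (lam : ℝ) (cn : ℕ → ℕ) (S : ℕ → ℕ → Prop) (v : ℝ) (c : ℕ) : Prop where
  nonpos : v ≤ 0
  lower : ∀ a b, S a b → b ≤ n → 0 < cn (cell n a b) → v ≤ cellKey n lam a b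
  attained : v < 0 → ∃ a b, S a b ∧ b ≤ n ∧ c = cell n a b ∧ 0 < cn (cell n a b) ∧
    v = cellKey n lam a b

variable {n : ℕ} {lam : ℝ} {cn : ℕ → ℕ}

theorem MinOn.congr {S T : ℕ → ℕ → Prop} {v : ℝ} {c : ℕ} (h : MinOn n lam cn S v c)
    (hST : ∀ a b, S a b ↔ T a b) : MinOn n lam cn T v c := by
  have : S = T := by
    funext a b
    exact propext (hST a b)
  exact this ▸ h

theorem MinOn.single (h : lam ≤ 1) {a b : ℕ} (ha : a < n) (hb : b < n)
    (hc : 0 < cn (cell n a b)) :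
    MinOn n lam cn (fun a' b' => a' = a ∧ b' = b) (cellKey n lam a b) (cell n a b) := by
  refine ⟨(cellKey_neg h ha hb).le, ?_, fun _ => ⟨a, b, ⟨rfl, rfl⟩, hb.le, rfl, hc, rfl⟩⟩
  rintro a' b' ⟨rfl, rfl⟩ _ _
  exact le_rfl

theorem MinOn.single_empty {a b : ℕ} (hc : cn (cell n a b) = 0) (c : ℕ) :
    MinOn n lam cn (fun a' b' => a' = a ∧ b' = b) 0 c := by
  refine ⟨le_rfl, ?_, fun h => absurd h (lt_irrefl _)⟩
  rintro a' b' ⟨rfl, rfl⟩ _ h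
  omega

theorem MinOn.merge_left {S T : ℕ → ℕ → Prop} {v v' : ℝ} {c c' : ℕ} (h : MinOn n lam cn S v c)
    (h' : MinOn n lam cn T v' c') (hv : v ≤ v') :
    MinOn n lam cn (fun a b => S a b ∨ T a b) v c := by
  refine ⟨h.nonpos, ?_, fun hneg => ?_⟩
  · rintro a b (hS | hT) hb hc
    · exact h.lower a b hS hb hc
    · exact hv.trans (h'.lower a b hT hb hc)
  · obtain ⟨a, b, hS, h2⟩ := h.attained hneg
    exact ⟨a, b, Or.inl hS, h2⟩

theorem MinOn.merge_right {S T : ℕ → ℕ → Prop} {v v' : ℝ} {c c' : ℕ} (h : MinOn n lam cn S v c)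
    (h' : MinOn n lam cn T v' c') (hv : v' ≤ v) :
    MinOn n lam cn (fun a b => S a b ∨ T a b) v' c' :=
  (h'.merge_left h hv).congr fun _ _ => or_comm

/-- A change of one cell count cannot affect a minimum over a set avoiding that cell. So only
entries at ancestors of the cell, itself included, need repair. -/
theorem MinOn.update {S : ℕ → ℕ → Prop} {v : ℝ} {c : ℕ} (h : MinOn n lam cn S v c) {A B : ℕ}
    (hB : B ≤ n) (hS : ¬ S A B) (k : ℕ) :
    MinOn n lam (Function.update cn (cell n A B) k) S v c := by
  have key : ∀ a b, S a b → b ≤ n →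
      Function.update cn (cell n A B) k (cell n a b) = cn (cell n a b) := by
    intro a b hab hb
    rw [Function.update_of_ne]
    rw [Ne, cell_inj hb hB]
    rintro ⟨rfl, rfl⟩
    exact hS hab
  refine ⟨h.nonpos, fun a b hab hb hc => ?_, fun hneg => ?_⟩
  · rw [key a b hab hb] at hc
    exact h.lower a b hab hb hc
  · obtain ⟨a, b, h1, h2, h3, h4, h5⟩ := h.attained hneg
    exact ⟨a, b, h1, h2, h3, by rwa [key a b h1 h2], h5⟩

/-- The entry of the tree at the cell `(a, b)` is right. -/
def TreeAt (n : ℕ) (lam : ℝ) (cn : ℕ → ℕ) (bv : ℕ → ℝ) (bt : ℕ → ℕ) (a b : ℕ) : Prop :=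
  MinOn n lam cn (Below a b) (bv (cell n a b)) (bt (cell n a b))

/-- Replaces the minimum in real variable 3 and word variable 28 by the entry `e` of the tree if that
is smaller. -/
def takeMin (e : WExp) : Cmd :=
  .cond (.rlt (.arr 1 e) (.var 3)) (.rset 3 (.arr 1 e) ;; .set 28 (.arr 23 e)) .skip

/-- The smaller of two minima is the minimum over the union. The index is evaluated again after the
real variable has been overwritten, hence the condition `he'`. -/
theorem wp_takeMin {W : ℕ} {s : State} (hb : s.Bdd W) {e : WExp} {k : ℕ} (he : e.eval s = k)
    (he' : ∀ v, e.eval (s.setR 3 v) = k) {S T : ℕ → ℕ → Prop}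
    (hS : MinOn n lam cn S (s.r 3) (s.w 28)) (hT : MinOn n lam cn T (s.ra 1 k) (s.a 23 k)) :
    WP W (takeMin e) s fun t s' => t ≤ 3 * e.cost + 8 ∧
      MinOn n lam cn (fun a b => S a b ∨ T a b) (s'.r 3) (s'.w 28) := by
  rw [takeMin, wp_cond]
  constructor
  · intro h
    simp only [Test.holds, RExp.eval, he] at h
    simp only [wp_seq, wp_rset, wp_set, WExp.eval, RExp.eval, he, he', Test.cost, RExp.cost,
      WExp.cost]
    refine ⟨hb.a _ _, by omega, ?_⟩
    simpa using hS.merge_right hT h.le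
  · intro h
    simp only [Test.holds, RExp.eval, he] at h
    simp only [wp_skip, Test.cost, RExp.cost]
    exact ⟨by omega, hS.merge_left hT (not_lt.1 h)⟩

/-- Starts the minimum with the cell in variables 25, 26, 27. -/
def startMin : Cmd := .cond (.lt (.const 0) (.arr 20 (.var 27)))
  (.rset 3 (.sub (.add (.ofWord (.var 25)) (.mul (.var 0) (.ofWord (.var 26))))
    (.ofWord (.add (.var 0) (.var 0)))) ;; .set 28 (.var 27))
  (.rset 3 (.ofWord (.const 0)) ;; .set 28 (.const 0))

theorem wp_startMin {off nb : ℕ → ℕ} {W : ℕ} {s : State} (hlam : lam ≤ 1)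
    (hc : Ctx off nb n lam W s) {a b : ℕ} (ha : a < n) (hb : b < n) (h25 : s.w 25 = a)
    (h26 : s.w 26 = b) (h27 : s.w 27 = cell n a b) :
    WP W startMin s fun t s' => t ≤ 20 ∧
      MinOn n lam (s.a 20) (fun a' b' => a' = a ∧ b' = b) (s'.r 3) (s'.w 28) := by
  have h1 := hc.bdd.w 27
  rw [h27] at h1
  rw [startMin, wp_cond]
  constructor
  · intro h
    simp [h27] at h
    have := MinOn.single hlam ha hb h
    simp [h25, h26, h27, h1, hc.n_eq, hc.lam_eq]
    simpa [cellKey] using this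
  · intro h
    simp [h27] at h
    simp [(by omega : 0 < W)]
    exact MinOn.single_empty h 0

/-- Recomputes the entry of the tree at the cell that is `i` steps above the cell in variables 21, 22,
where `i` stands in variable 24. -/
def repairCell : Cmd :=
  .set 25 (.sub (.var 21) (.var 24)) ;;
  .set 26 (.sub (.var 22) (.sub (.var 24) (.var 21))) ;;
  .set 27 (.add (.mul (.var 25) (.add (.var 0) (.const 1))) (.var 26)) ;;
  startMin ;;
  takeMin (.add (.var 27) (.add (.var 0) (.const 1))) ;;
  .cond (.eq (.var 25) (.const 0)) (takeMin (.add (.var 27) (.const 1))) .skip ;;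
  .rstore 1 (.var 27) (.var 3) ;; .store 23 (.var 27) (.var 28)

/-- Truncated subtraction encodes the path: the first coordinate falls from `A` to `0` and stays
there, and `i - A` then counts the steps in the second. The subtree of a cell is the cell itself,
the subtree of `(a + 1, b)` and, if `a = 0`, that of `(0, b + 1)`, so correct children give a
correct entry. -/
theorem wp_repairCell {off nb : ℕ → ℕ} {W : ℕ} {s₁ : State} (hlam : lam ≤ 1)
    (hW : (n + 1) * (n + 1) + n < W) (hc₁ : Ctx off nb n lam W s₁) {ca cb : ℕ} (hcan : ca < n)
    (hcbn : cb < n) (hca : ca = s₁.w 21 - s₁.w 24) (hcb : cb = s₁.w 22 - (s₁.w 24 - s₁.w 21))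
    (t1 : TreeAt n lam (s₁.a 20) (s₁.ra 1) (s₁.a 23) (ca + 1) cb)
    (t2 : ca = 0 → TreeAt n lam (s₁.a 20) (s₁.ra 1) (s₁.a 23) ca (cb + 1)) :
    WP W repairCell s₁ fun t s' => t ≤ 110 ∧ ∃ v c, MinOn n lam (s₁.a 20) (Below ca cb) v c ∧
      s'.ra 1 = Function.update (s₁.ra 1) (cell n ca cb) v ∧
      s'.a 23 = Function.update (s₁.a 23) (cell n ca cb) c := by
  have hn : n + n ≤ (n + 1) * (n + 1) := by nlinarith
  have hcell : cell n ca cb < (n + 1) * (n + 1) + n := by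
    simp only [cell]
    nlinarith
  have hcW : cell n ca cb < W := hcell.trans hW
  have hb := hc₁.bdd
  have c1 : cell n ca cb + (n + 1) = cell n (ca + 1) cb := by
    simp only [cell]
    ring
  have c2 : cell n ca cb + 1 = cell n ca (cb + 1) := rfl
  rw [repairCell, wp_seq, wp_set]
  have v1 : (WExp.sub (.var 21) (.var 24)).eval s₁ = ca := by simp [hca]
  rw [v1]
  refine ⟨by omega, ?_⟩
  rw [wp_seq, wp_set]
  have v2 : (WExp.sub (.var 22) (.sub (.var 24) (.var 21))).eval (s₁.setW 25 ca) = cb := by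
    simp [hcb]
  rw [v2]
  refine ⟨by omega, ?_⟩
  rw [wp_seq, wp_set]
  have v3 : (WExp.add (.mul (.var 25) (.add (.var 0) (.const 1))) (.var 26)).eval
      ((s₁.setW 25 ca).setW 26 cb) = cell n ca cb := by
    simp [hc₁.n_eq, cell]
  rw [v3]
  refine ⟨hcW, ?_⟩
  set s₂ := ((s₁.setW 25 ca).setW 26 cb).setW 27 (cell n ca cb) with hs₂
  have hc₂ : Ctx off nb n lam W s₂ :=
    ⟨by simp [hs₂, hc₁.n_eq], hc₁.off_eq, hc₁.nb_eq, hc₁.lam_eq,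
      ((hb.setW (by omega)).setW (by omega)).setW hcW⟩
  rw [wp_seq]
  refine (wp_startMin hlam hc₂ hcan hcbn (by simp [hs₂]) (by simp [hs₂])
    (by simp [hs₂])).strengthen hc₂.bdd ?_
  rintro t₃ s₃ ⟨ht₃, hm₃⟩ hf₃ hb₃
  have hc₃ := hc₂.frame hf₃ hb₃ rfl rfl rfl rfl
  rw [show s₂.a 20 = s₁.a 20 by simp [hs₂]] at hm₃
  have a27 : s₃.w 27 = cell n ca cb := by rw [hf₃.w 27 rfl]; simp [hs₂]
  have a25 : s₃.w 25 = ca := by rw [hf₃.w 25 rfl]; simp [hs₂]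
  have a23 : s₃.a 23 = s₁.a 23 := by rw [hf₃.a 23 rfl]; simp [hs₂]
  have ara : s₃.ra 1 = s₁.ra 1 := by rw [hf₃.ra 1 rfl]; simp [hs₂]
  rw [wp_seq]
  refine (wp_takeMin (e := .add (.var 27) (.add (.var 0) (.const 1)))
    (k := cell n (ca + 1) cb) hb₃ (by simp [a27, hc₃.n_eq, c1]) (by simp [a27, hc₃.n_eq, c1])
    hm₃ (by rw [a23, ara]; exact t1)).strengthen hb₃ ?_
  rintro t₄ s₄ ⟨ht₄, hm₄⟩ hf₄ hb₄
  have a27' : s₄.w 27 = cell n ca cb := by rw [hf₄.w 27 rfl, a27]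
  have a25' : s₄.w 25 = ca := by rw [hf₄.w 25 rfl, a25]
  have a23' : s₄.a 23 = s₁.a 23 := by rw [hf₄.a 23 rfl, a23]
  have ara' : s₄.ra 1 = s₁.ra 1 := by rw [hf₄.ra 1 rfl, ara]
  rw [wp_seq]
  have hcond : WP W (.cond (.eq (.var 25) (.const 0)) (takeMin (.add (.var 27) (.const 1)))
      .skip) s₄ fun t s' => t ≤ 25 ∧
        MinOn n lam (s₁.a 20) (Below ca cb) (s'.r 3) (s'.w 28) := by
    rw [wp_cond]
    constructor
    · intro h0
      simp [a25'] at h0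
      refine (wp_takeMin (e := .add (.var 27) (.const 1)) (k := cell n ca (cb + 1)) hb₄
        (by simp [a27', c2]) (by simp [a27', c2]) hm₄
        (by rw [a23', ara']; exact t2 h0)).mono ?_
      rintro t s' ⟨ht, hm⟩
      refine ⟨by simp at ht ⊢; omega, hm.congr fun a b => ?_⟩
      simp only [Below]
      omega
    · intro h0
      simp [a25'] at h0
      simp
      refine hm₄.congr fun a b => ?_
      simp only [Below]
      omega
  refine hcond.strengthen hb₄ ?_
  rintro t₅ s₅ ⟨ht₅, hm₅⟩ hf₅ hb₅
  have a27'' : s₅.w 27 = cell n ca cb := by rw [hf₅.w 27 rfl, a27']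
  have a23'' : s₅.a 23 = s₁.a 23 := by rw [hf₅.a 23 rfl, a23']
  have ara'' : s₅.ra 1 = s₁.ra 1 := by rw [hf₅.ra 1 rfl, ara']
  rw [wp_seq, wp_rstore, wp_store]
  refine ⟨hb₅.w 28, ?_, ?_⟩
  · simp at ht₄ ⊢
    omega
  · exact ⟨_, _, hm₅, by simp [a27'', ara''], by simp [a27'', a23'']⟩

/-- Repairs the tree on the path from the cell in variables 21, 22 to the root. -/
def repair : Cmd := .set 23 (.add (.add (.var 21) (.var 22)) (.const 1)) ;;
  upTo 24 23 repairCell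

/-- Before step `i` the only entries that may be wrong are those on the path from the `i`-th cell to
the root. After `A + B + 1` steps the path is used up. -/
theorem wp_repair {off nb : ℕ → ℕ} {W : ℕ} {s : State} (hlam : lam ≤ 1)
    (hW : (n + 1) * (n + 1) + n < W) (hc : Ctx off nb n lam W s) {A B : ℕ} (hA : A < n) (hB : B < n)
    (h21 : s.w 21 = A) (h22 : s.w 22 = B)
    (h : ∀ a b, b ≤ n → ¬ Below a b A B → TreeAt n lam (s.a 20) (s.ra 1) (s.a 23) a b) :
    WP W repair s fun t s' => t ≤ 150 * (A + B + 1) ∧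
      ∀ a b, b ≤ n → TreeAt n lam (s.a 20) (s'.ra 1) (s'.a 23) a b := by
  have hn : n + n ≤ (n + 1) * (n + 1) := by nlinarith
  have hnW : (A + B + 1) < W := by omega
  rw [repair, wp_seq, wp_set]
  have hev : (WExp.add (.add (.var 21) (.var 22)) (.const 1)).eval s = A + B + 1 := by
    simp [h21, h22]
  rw [hev]
  refine ⟨hnW, ?_⟩
  have hc₀ : Ctx off nb n lam W (s.setW 23 (A + B + 1)) :=
    ⟨by simp [hc.n_eq], hc.off_eq, hc.nb_eq, hc.lam_eq, hc.bdd.setW hnW⟩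
  refine wp_upTo (N := A + B + 1) (fun i s' => ∀ a b, b ≤ n →
      ¬ (i ≤ A + B ∧ Below a b (A - i) (B - (i - A))) →
        TreeAt n lam (s.a 20) (s'.ra 1) (s'.a 23) a b) (fun _ => 110)
    rfl rfl (by decide) hc₀.bdd (by simp) ?_ ?_ ?_
  · intro a b hb hab
    exact h a b hb (by simpa using hab)
  · intro i s₁ hi hf hb hx hI
    have hc₁ := hc₀.frame hf hb rfl rfl rfl rfl
    have e21 : s₁.w 21 = A := by rw [hf.w 21 rfl]; simp [h21]
    have e22 : s₁.w 22 = B := by rw [hf.w 22 rfl]; simp [h22]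
    have e20 : s₁.a 20 = s.a 20 := hf.a 20 rfl
    obtain ⟨ca, hca⟩ : ∃ ca, ca = A - i := ⟨_, rfl⟩
    obtain ⟨cb, hcb⟩ : ∃ cb, cb = B - (i - A) := ⟨_, rfl⟩
    have hcan : ca < n := by omega
    have hcbn : cb < n := by omega
    -- A child is never an ancestor of its parent, so by the invariant the children of the current
    -- cell are correct.
    have t1 : TreeAt n lam (s.a 20) (s₁.ra 1) (s₁.a 23) (ca + 1) cb := by
      refine hI _ _ hcbn.le ?_
      rw [← hca, ← hcb]
      rintro ⟨_, h | h⟩ <;> omega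
    have t2 : ca = 0 → TreeAt n lam (s.a 20) (s₁.ra 1) (s₁.a 23) ca (cb + 1) := by
      intro h0
      refine hI _ _ hcbn ?_
      rw [← hca, ← hcb]
      rintro ⟨_, h | h⟩ <;> omega
    -- A proper ancestor of the current cell is an ancestor of the next cell on the path, and the
    -- root has no proper ancestor. Writing the current cell does not disturb the others, as cell
    -- numbers are distinct.
    have finish : ∀ v c, MinOn n lam (s.a 20) (Below ca cb) v c → ∀ a b, b ≤ n →
        ¬ (i + 1 ≤ A + B ∧ Below a b (A - (i + 1)) (B - (i + 1 - A))) →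
        TreeAt n lam (s.a 20) (Function.update (s₁.ra 1) (cell n ca cb) v)
          (Function.update (s₁.a 23) (cell n ca cb) c) a b := by
      intro v c hv a b hb' hab
      by_cases hcc : a = ca ∧ b = cb
      · obtain ⟨rfl, rfl⟩ := hcc
        simpa [TreeAt] using hv
      · have hne : cell n a b ≠ cell n ca cb := by
          rwa [Ne, cell_inj hb' hcbn.le]
        simp only [TreeAt, Function.update_of_ne hne]
        refine hI a b hb' ?_
        rintro ⟨hi', hB'⟩
        apply hab
        rcases hB' with ⟨h1, h2⟩ | ⟨h1, h2⟩
        · by_cases hcb0 : ca = 0 ∧ cb = 0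
          · exfalso
            omega
          · exact ⟨by omega, Or.inl ⟨h1, by omega⟩⟩
        · by_cases hca0 : ca = 0
          · exfalso
            omega
          · exact ⟨by omega, Or.inr ⟨by omega, by omega⟩⟩
    refine (wp_repairCell hlam hW hc₁ hcan hcbn (by rw [e21, hx, hca]) (by rw [e21, e22, hx, hcb])
      (by rw [e20]; exact t1) (by rw [e20]; exact t2)).mono ?_
    rintro t s₂ ⟨ht, v, c, hm, h1, h2⟩
    rw [e20] at hm
    refine ⟨ht, ?_⟩
    simp only [State.setW_a, State.setW_ra, h1, h2]
    exact finish v c hm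
  · intro t s' ht _ _ hI
    refine ⟨?_, fun a b hb => hI a b hb (by omega)⟩
    simp at ht ⊢
    omega

end Tree

end STCPeel


namespace STCPeel

/-! ### The priority queue: members of cells, minimum, insertion and removal -/

section Queue

variable {n : ℕ}

/-- The vertices of `R` are filed in the cells of their keys `(sa v, sb v)`: `cn` holds the sizes of
the cells, `mb` their members, and `ps` the positions of the vertices. -/
structure Members (R : Finset (Fin n)) (sa sb cn mb ps : ℕ → ℕ) : Prop where
  key_lt : ∀ v ∈ R, sa v < n ∧ sb v < n
  pos : ∀ v ∈ R, ps v < cn (cell n (sa v) (sb v)) ∧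
    mb (cell n (cell n (sa v) (sb v)) (ps v)) = v
  mem : ∀ a b, b ≤ n → ∀ i < cn (cell n a b), ∃ v ∈ R, sa v = a ∧ sb v = b ∧ ps v = i

variable {R : Finset (Fin n)} {sa sb cn mb ps : ℕ → ℕ}

/-- The slots of a cell are occupied by different vertices. Slot numbers are therefore at most `n`,
which keeps the pairs (cell, slot) apart under `cell_inj`. -/
theorem Members.count_le (h : Members R sa sb cn mb ps) {a b : ℕ} (hb : b ≤ n) :
    cn (cell n a b) ≤ R.card := by
  choose v hv hva hvb hvp using fun i : Fin (cn (cell n a b)) => h.mem a b hb i i.2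
  have hinj : Function.Injective v := by
    intro i j hij
    have h1 := hvp i
    rw [hij, hvp j] at h1
    exact Fin.ext h1.symm
  have := Finset.card_le_card_of_injOn (s := Finset.univ) (t := R) v (fun i _ => hv i) hinj.injOn
  simpa using this

theorem Members.congr_keys {sa' sb' : ℕ → ℕ} (h : Members R sa sb cn mb ps)
    (ha : ∀ v ∈ R, sa' v = sa v) (hb : ∀ v ∈ R, sb' v = sb v) : Members R sa' sb' cn mb ps := by
  refine ⟨fun v hv => ?_, fun v hv => ?_, fun a b hab i hi => ?_⟩
  · rw [ha v hv, hb v hv]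
    exact h.key_lt v hv
  · rw [ha v hv, hb v hv]
    exact h.pos v hv
  · obtain ⟨v, hv, h1, h2, h3⟩ := h.mem a b hab i hi
    exact ⟨v, hv, by rw [ha v hv, h1], by rw [hb v hv, h2], h3⟩

theorem Members.insert [DecidableEq (Fin n)] (h : Members R sa sb cn mb ps) {u : Fin n}
    (hu : u ∉ R) (ha : sa u < n) (hb : sb u < n) {c : ℕ} (hc : c = cell n (sa u) (sb u)) :
    Members (insert u R) sa sb (Function.update cn c (cn c + 1))
      (Function.update mb (cell n c (cn c)) u) (Function.update ps u (cn c)) := by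
  have hcn : cn c ≤ n := by
    rw [hc]
    exact (h.count_le hb.le).trans (by simpa using Finset.card_le_univ R)
  refine ⟨fun v hv => ?_, fun v hv => ?_, fun a b hab i hi => ?_⟩
  · rcases Finset.mem_insert.1 hv with rfl | hv
    exacts [⟨ha, hb⟩, h.key_lt v hv]
  · rcases Finset.mem_insert.1 hv with rfl | hv
    · simp [← hc]
    · have hne : (v : ℕ) ≠ u := fun he => hu (Fin.ext he ▸ hv)
      obtain ⟨h1, h2⟩ := h.pos v hv
      have hle := (h.count_le (a := sa v) (h.key_lt v hv).2.le).trans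
        (by simpa using Finset.card_le_univ R)
      rw [Function.update_of_ne hne]
      constructor
      · by_cases hcc : cell n (sa v) (sb v) = c
        · rw [hcc] at h1 ⊢
          simp
          omega
        · rwa [Function.update_of_ne hcc]
      · rw [Function.update_of_ne, h2]
        rw [Ne, cell_inj (by omega) hcn]
        rintro ⟨h3, h4⟩
        rw [h3] at h1
        omega
  · have key : ∀ v ∈ R, ps v = i → Function.update ps u (cn c) v = i := by
      intro v hv hvi
      rw [Function.update_of_ne, hvi]
      rw [Ne, Fin.val_inj]
      rintro rfl
      exact hu hv
    by_cases hcc : cell n a b = c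
    · rw [hcc, Function.update_self] at hi
      rcases Nat.lt_succ_iff_lt_or_eq.1 hi with hi | hi
      · obtain ⟨v, hv, h1, h2, h3⟩ := h.mem a b hab i (by rwa [hcc])
        exact ⟨v, Finset.mem_insert_of_mem hv, h1, h2, key v hv h3⟩
      · rw [hc, cell_inj hab hb.le] at hcc
        exact ⟨u, Finset.mem_insert_self _ _, hcc.1.symm, hcc.2.symm, by simp [hi]⟩
    · rw [Function.update_of_ne hcc] at hi
      obtain ⟨v, hv, h1, h2, h3⟩ := h.mem a b hab i hi
      exact ⟨v, Finset.mem_insert_of_mem hv, h1, h2, key v hv h3⟩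

/-- Constant-time deletion: the last member of the cell moves into the slot of `u` and the cell
shrinks by one. If `u` is the last member, the moves change nothing. -/
theorem Members.erase [DecidableEq (Fin n)] (h : Members R sa sb cn mb ps) {u : Fin n}
    (hu : u ∈ R) {c : ℕ} (hc : c = cell n (sa u) (sb u)) :
    0 < cn c ∧ Members (R.erase u) sa sb (Function.update cn c (cn c - 1))
      (Function.update mb (cell n c (ps u)) (mb (cell n c (cn c - 1))))
      (Function.update ps (mb (cell n c (cn c - 1))) (ps u)) := by
  have hbu := (h.key_lt u hu).2.le
  have hcn : cn c ≤ n := by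
    rw [hc]
    exact (h.count_le hbu).trans (by simpa using Finset.card_le_univ R)
  obtain ⟨u1, u2⟩ := h.pos u hu
  rw [← hc] at u1 u2
  obtain ⟨l, hl, l1, l2, l3⟩ := h.mem (sa u) (sb u) hbu (cn c - 1) (by rw [← hc]; omega)
  have hl' := (h.pos l hl).2
  rw [l1, l2, l3, ← hc] at hl'
  rw [hl']
  refine ⟨by omega, fun v hv => h.key_lt v (Finset.mem_of_mem_erase hv), fun v hv => ?_,
    fun a b hab i hi => ?_⟩
  · obtain ⟨hvu, hv⟩ := Finset.mem_erase.1 hv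
    by_cases hvl : v = l
    · subst hvl
      rw [l1, l2, ← hc]
      simp only [Function.update_self, and_true]
      have : ps u ≠ cn c - 1 := by
        intro h3
        rw [h3, hl'] at u2
        exact hvu (Fin.ext u2)
      omega
    · rw [Function.update_of_ne (by rwa [Ne, Fin.val_inj])]
      obtain ⟨h1, h2⟩ := h.pos v hv
      have hle := (h.count_le (a := sa v) (h.key_lt v hv).2.le).trans
        (by simpa using Finset.card_le_univ R)
      constructor
      · by_cases hcc : cell n (sa v) (sb v) = c
        · rw [hcc] at h1 h2 ⊢
          have : ps v ≠ cn c - 1 := by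
            intro h3
            rw [h3, hl'] at h2
            exact hvl (Fin.ext h2).symm
          simp
          omega
        · rwa [Function.update_of_ne hcc]
      · rw [Function.update_of_ne, h2]
        rw [Ne, cell_inj (by omega) (by omega)]
        rintro ⟨h3, h4⟩
        rw [h3, h4, u2] at h2
        exact hvu (Fin.ext h2).symm
  · have key : ∀ v ∈ R, v ≠ u → v ≠ l → sa v = a → sb v = b → ps v = i → ∃ v ∈ R.erase u,
        sa v = a ∧ sb v = b ∧ Function.update ps l (ps u) v = i := by
      intro v hv hvu hvl h1 h2 h3
      refine ⟨v, Finset.mem_erase.2 ⟨hvu, hv⟩, h1, h2, ?_⟩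
      rw [Function.update_of_ne (by rwa [Ne, Fin.val_inj]), h3]
    by_cases hcc : cell n a b = c
    · rw [hcc, Function.update_self] at hi
      obtain ⟨v, hv, h1, h2, h3⟩ := h.mem a b hab i (by rw [hcc]; omega)
      have hvl : v ≠ l := by
        rintro rfl
        omega
      by_cases hvu : v = u
      · subst hvu
        refine ⟨l, Finset.mem_erase.2 ⟨hvl.symm, hl⟩, l1.trans h1, l2.trans h2, ?_⟩
        simp [h3]
      · exact key v hv hvu hvl h1 h2 h3
    · rw [Function.update_of_ne hcc] at hi
      obtain ⟨v, hv, h1, h2, h3⟩ := h.mem a b hab i hi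
      refine key v hv ?_ ?_ h1 h2 h3
      · rintro rfl
        rw [h1, h2] at hc
        exact hcc hc.symm
      · rintro rfl
        rw [← l1, ← l2, h1, h2] at hc
        exact hcc hc.symm

/-- The memory holds a priority queue for `R` with the keys in arrays 18 and 19. -/
structure Queue (lam : ℝ) (R : Finset (Fin n)) (s : State) : Prop where
  members : Members R (s.a 18) (s.a 19) (s.a 20) (s.a 21) (s.a 22)
  tree : ∀ a b, b ≤ n → TreeAt n lam (s.a 20) (s.ra 1) (s.a 23) a b

variable {lam : ℝ}

theorem Queue.congr {s s' : State} (h : Queue lam R s) (ha : ∀ v ∈ R, s'.a 18 v = s.a 18 v)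
    (hb : ∀ v ∈ R, s'.a 19 v = s.a 19 v) (h20 : s'.a 20 = s.a 20) (h21 : s'.a 21 = s.a 21)
    (h22 : s'.a 22 = s.a 22) (h23 : s'.a 23 = s.a 23) (h1 : s'.ra 1 = s.ra 1) :
    Queue lam R s' := by
  refine ⟨?_, ?_⟩
  · rw [h20, h21, h22]
    exact h.members.congr_keys ha hb
  · rw [h20, h23, h1]
    exact h.tree

/-- The subtree of the root, cell `0`, is the whole grid. Its entry is negative because some vertex
has a negative key, so the minimum is attained by a non-empty cell, and slot `0` of that cell holds
a vertex. -/
theorem Queue.min {s : State} (h : Queue lam R s) (hlam : lam ≤ 1) (hR : R.Nonempty) :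
    ∃ v ∈ R, s.a 21 (s.a 23 0 * (n + 1)) = v ∧ ∀ x ∈ R,
      (s.a 18 v + lam * s.a 19 v : ℝ) ≤ s.a 18 x + lam * s.a 19 x := by
  have ht := h.tree 0 0 (Nat.zero_le _)
  have hroot : cell n 0 0 = 0 := by simp [cell]
  simp only [TreeAt, hroot] at ht
  have hlow : ∀ x ∈ R, s.ra 1 0 ≤ cellKey n lam (s.a 18 x) (s.a 19 x) := by
    intro x hx
    have hp := (h.members.pos x hx).1
    exact ht.lower _ _ (Or.inl ⟨rfl, Nat.zero_le _⟩) (h.members.key_lt x hx).2.le (by omega)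
  obtain ⟨x, hx⟩ := hR
  obtain ⟨h1, h2⟩ := h.members.key_lt x hx
  obtain ⟨a, b, _, hb, hc, hpos, hv⟩ := ht.attained ((hlow x hx).trans_lt (cellKey_neg hlam h1 h2))
  obtain ⟨v, hv', va, vb, vp⟩ := h.members.mem a b hb 0 hpos
  refine ⟨v, hv', ?_, fun y hy => ?_⟩
  · have := (h.members.pos v hv').2
    rw [va, vb, vp, ← hc] at this
    simpa [cell] using this
  · have := hlow y hy
    rw [hv] at this
    simp only [cellKey] at this
    rw [va, vb]
    linarith

/-- Finds the cell of the vertex in variable 20. -/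
def locate : Cmd := .set 21 (.arr 18 (.var 20)) ;; .set 22 (.arr 19 (.var 20)) ;;
  .set 27 (.add (.mul (.var 21) (.add (.var 0) (.const 1))) (.var 22))

theorem wp_locate {off nb : ℕ → ℕ} {W : ℕ} {s : State} (hW : (n + 1) * (n + 1) + n < W)
    (hc : Ctx off nb n lam W s) {u : Fin n} (h20 : s.w 20 = u) (ha : s.a 18 u < n)
    (hb : s.a 19 u < n) :
    WP W locate s fun t s' => t ≤ 20 ∧ s'.w 21 = s.a 18 u ∧ s'.w 22 = s.a 19 u ∧
      s'.w 27 = cell n (s.a 18 u) (s.a 19 u) := by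
  have h1 : s.a 18 u * (n + 1) + s.a 19 u < W := by nlinarith
  simp [locate, h20, hc.bdd.a, hc.n_eq, h1, cell]

/-- Puts the vertex in variable 20 into the queue. -/
def enqueue : Cmd := locate ;;
  .store 21 (.add (.mul (.var 27) (.add (.var 0) (.const 1))) (.arr 20 (.var 27))) (.var 20) ;;
  .store 22 (.var 20) (.arr 20 (.var 27)) ;;
  .store 20 (.var 27) (.add (.arr 20 (.var 27)) (.const 1)) ;; repair

/-- Takes the vertex in variable 20 out of the queue. -/
def dequeue : Cmd := locate ;;
  .store 20 (.var 27) (.sub (.arr 20 (.var 27)) (.const 1)) ;;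
  .set 29 (.arr 21 (.add (.mul (.var 27) (.add (.var 0) (.const 1))) (.arr 20 (.var 27)))) ;;
  .store 21 (.add (.mul (.var 27) (.add (.var 0) (.const 1))) (.arr 22 (.var 20))) (.var 29) ;;
  .store 22 (.var 29) (.arr 22 (.var 20)) ;; repair

/-- The vertex is appended to its cell and then the path above that cell is repaired. The cost is
the depth `a + b` of the cell up to constants. -/
theorem wp_enqueue {off nb : ℕ → ℕ} {W : ℕ} {s : State} (hlam : lam ≤ 1)
    (hW : (n + 1) * (n + 1) + n < W) (hc : Ctx off nb n lam W s) {u : Fin n} (h20 : s.w 20 = u)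
    (ha : s.a 18 u < n) (hb : s.a 19 u < n) (hu : u ∉ R) (hQ : Queue lam R s) :
    WP W enqueue s fun t s' => t ≤ 150 * (s.a 18 u + s.a 19 u + 1) + 50 ∧
      Queue lam (insert u R) s' := by
  rw [enqueue, wp_seq]
  refine (wp_locate hW hc h20 ha hb).strengthen hc.bdd ?_
  rintro t₁ s₁ ⟨ht₁, l1, l2, l3⟩ hf₁ hb₁
  have hc₁ := hc.frame hf₁ hb₁ rfl rfl rfl rfl
  have hle : s.a 20 (cell n (s.a 18 u) (s.a 19 u)) ≤ n :=
    (hQ.members.count_le hb.le).trans (by simpa using Finset.card_le_univ R)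
  have hnW : n + 1 < W := by nlinarith
  have e20 : s₁.a 20 = s.a 20 := hf₁.a 20 rfl
  have e21 : s₁.a 21 = s.a 21 := hf₁.a 21 rfl
  have e22 : s₁.a 22 = s.a 22 := hf₁.a 22 rfl
  have e23 : s₁.a 23 = s.a 23 := hf₁.a 23 rfl
  have e18 : s₁.a 18 = s.a 18 := hf₁.a 18 rfl
  have e19 : s₁.a 19 = s.a 19 := hf₁.a 19 rfl
  have era : s₁.ra 1 = s.ra 1 := hf₁.ra 1 rfl
  have w20 : s₁.w 20 = u := by rw [hf₁.w 20 rfl, h20]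
  set c := cell n (s.a 18 u) (s.a 19 u) with hcdef
  set k := s.a 20 c with hk
  have hidx : c * (n + 1) + k = cell n c k := rfl
  have hmem := hQ.members.insert hu ha hb hcdef
  have hw : ∀ (x : ℕ), s₁.w x < W := hb₁.w
  simp only [wp_seq, wp_store, WExp.eval, l3, hc₁.n_eq, State.setA_w, w20, hidx,
    State.setA_a_of_ne _ _ _ _ _ (by decide : (20 : ℕ) ≠ 21),
    State.setA_a_of_ne _ _ _ _ _ (by decide : (20 : ℕ) ≠ 22), e20, ← hk]
  refine ⟨w20 ▸ hw 20, by omega, by omega, ?_⟩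
  set s₂ := ((s₁.setA 21 (cell n c k) u).setA 22 u k).setA 20 c (k + 1) with hs₂
  have hb₂ : s₂.Bdd W := ((hb₁.setA (w20 ▸ hw 20)).setA (by omega)).setA (by omega)
  have hc₂ : Ctx off nb n lam W s₂ :=
    ⟨by simp [hs₂, hc₁.n_eq], by simp [hs₂, hc₁.off_eq], by simp [hs₂, hc₁.nb_eq],
      by simp [hs₂, hc₁.lam_eq], hb₂⟩
  have k20 : s₂.a 20 = Function.update (s.a 20) c (k + 1) := by simp [hs₂, e20]
  have k21 : s₂.a 21 = Function.update (s.a 21) (cell n c k) u := by simp [hs₂, e21]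
  have k22 : s₂.a 22 = Function.update (s.a 22) u k := by simp [hs₂, e22]
  have k23 : s₂.a 23 = s.a 23 := by simp [hs₂, e23]
  have kra : s₂.ra 1 = s.ra 1 := by simp [hs₂, era]
  refine (wp_repair hlam hW hc₂ ha hb (by simp [hs₂, l1]) (by simp [hs₂, l2]) ?_).strengthen hb₂ ?_
  · intro a b hab hnot
    rw [k20, k23, kra]
    exact (hQ.tree a b hab).update hb.le hnot _
  · rintro t₃ s₃ ⟨ht₃, htree⟩ hf₃ hb₃
    refine ⟨by simp only [WExp.cost]; omega, ?_, ?_⟩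
    · rw [hf₃.a 18 rfl, hf₃.a 19 rfl, hf₃.a 20 rfl, hf₃.a 21 rfl, hf₃.a 22 rfl, k20, k21, k22]
      rw [show s₂.a 18 = s.a 18 by simp [hs₂, e18], show s₂.a 19 = s.a 19 by simp [hs₂, e19]]
      exact hmem
    · rw [hf₃.a 20 rfl]
      exact htree

theorem wp_dequeue {off nb : ℕ → ℕ} {W : ℕ} {s : State} (hlam : lam ≤ 1)
    (hW : (n + 1) * (n + 1) + n < W) (hc : Ctx off nb n lam W s) {u : Fin n} (h20 : s.w 20 = u)
    (hu : u ∈ R) (hQ : Queue lam R s) :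
    WP W dequeue s fun t s' => t ≤ 150 * (s.a 18 u + s.a 19 u + 1) + 70 ∧
      Queue lam (R.erase u) s' := by
  obtain ⟨ha, hb⟩ := hQ.members.key_lt u hu
  rw [dequeue, wp_seq]
  refine (wp_locate hW hc h20 ha hb).strengthen hc.bdd ?_
  rintro t₁ s₁ ⟨ht₁, l1, l2, l3⟩ hf₁ hb₁
  have hc₁ := hc.frame hf₁ hb₁ rfl rfl rfl rfl
  have e20 : s₁.a 20 = s.a 20 := hf₁.a 20 rfl
  have e21 : s₁.a 21 = s.a 21 := hf₁.a 21 rfl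
  have e22 : s₁.a 22 = s.a 22 := hf₁.a 22 rfl
  have e23 : s₁.a 23 = s.a 23 := hf₁.a 23 rfl
  have e18 : s₁.a 18 = s.a 18 := hf₁.a 18 rfl
  have e19 : s₁.a 19 = s.a 19 := hf₁.a 19 rfl
  have era : s₁.ra 1 = s.ra 1 := hf₁.ra 1 rfl
  have w20 : s₁.w 20 = u := by rw [hf₁.w 20 rfl, h20]
  set c := cell n (s.a 18 u) (s.a 19 u) with hcdef
  obtain ⟨_, hmem⟩ := hQ.members.erase hu hcdef
  have h1 : s.a 20 c - 1 < W := (Nat.sub_le _ _).trans_lt (hc.bdd.a _ _)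
  set k := s.a 20 c - 1 with hk
  have hidx : ∀ i, c * (n + 1) + i = cell n c i := fun _ => rfl
  set l := s.a 21 (cell n c k) with hl
  have h2 : l < W := hc.bdd.a _ _
  have h3 : s.a 22 u < W := hc.bdd.a _ _
  simp [l3, hc₁.n_eq, w20, hidx, e20, ← hk, h1, e21, ← hl, h2, e22, h3]
  set s₂ := (((s₁.setA 20 c k).setW 29 l).setA 21 (cell n c (s.a 22 u)) l).setA 22 l (s.a 22 u)
    with hs₂
  have hb₂ : s₂.Bdd W := (((hb₁.setA h1).setW h2).setA h2).setA h3
  have hc₂ : Ctx off nb n lam W s₂ :=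
    ⟨by simp [hs₂, hc₁.n_eq], by simp [hs₂, hc₁.off_eq], by simp [hs₂, hc₁.nb_eq],
      by simp [hs₂, hc₁.lam_eq], hb₂⟩
  have k20 : s₂.a 20 = Function.update (s.a 20) c k := by simp [hs₂, e20]
  have k21 : s₂.a 21 = Function.update (s.a 21) (cell n c (s.a 22 u)) l := by simp [hs₂, e21]
  have k22 : s₂.a 22 = Function.update (s.a 22) l (s.a 22 u) := by simp [hs₂, e22]
  have k23 : s₂.a 23 = s.a 23 := by simp [hs₂, e23]
  have kra : s₂.ra 1 = s.ra 1 := by simp [hs₂, era]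
  refine (wp_repair hlam hW hc₂ ha hb (by simp [hs₂, l1]) (by simp [hs₂, l2]) ?_).strengthen hb₂ ?_
  · intro a b hab hnot
    rw [k20, k23, kra]
    exact (hQ.tree a b hab).update hb.le hnot _
  · rintro t₃ s₃ ⟨ht₃, htree⟩ hf₃ hb₃
    refine ⟨by omega, ?_, ?_⟩
    · rw [hf₃.a 18 rfl, hf₃.a 19 rfl, hf₃.a 20 rfl, hf₃.a 21 rfl, hf₃.a 22 rfl, k20, k21, k22]
      rw [show s₂.a 18 = s.a 18 by simp [hs₂, e18], show s₂.a 19 = s.a 19 by simp [hs₂, e19]]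
      exact hmem
    · rw [hf₃.a 20 rfl]
      exact htree

end Queue

end STCPeel


namespace STCPeel

/-! ## Weighted degrees -/

section Degrees

variable {n : ℕ}

open Classical in
/-- Number of elements of `R` that are related to `x`. -/
noncomputable def count (r : Fin n → Fin n → Prop) (R : Finset (Fin n)) (x : Fin n) : ℕ :=
  (R.filter (r x)).card

/-- Adjacency by a strong edge. -/
def StrongAdj (G : SimpleGraph (Fin n)) (weak : Set (Sym2 (Fin n))) (u v : Fin n) : Prop :=
  G.Adj u v ∧ s(u, v) ∉ weak

/-- Adjacency by a weak edge. -/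
def WeakAdj (G : SimpleGraph (Fin n)) (weak : Set (Sym2 (Fin n))) (u v : Fin n) : Prop :=
  G.Adj u v ∧ s(u, v) ∈ weak

variable {G : SimpleGraph (Fin n)} {weak : Set (Sym2 (Fin n))}

theorem strongAdj_comm {u v : Fin n} : StrongAdj G weak u v ↔ StrongAdj G weak v u := by
  simp only [StrongAdj, G.adj_comm u v, Sym2.eq_swap (a := u)]

theorem weakAdj_comm {u v : Fin n} : WeakAdj G weak u v ↔ WeakAdj G weak v u := by
  simp only [WeakAdj, G.adj_comm u v, Sym2.eq_swap (a := u)]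

/-- Strong and weak neighbours are disjoint sets of neighbours. This bounds the depth of the cell of
`x` by its degree, hence the cost of a queue operation. -/
theorem count_strong_add_count_weak_le (G : SimpleGraph (Fin n)) (weak : Set (Sym2 (Fin n)))
    (R : Finset (Fin n)) (x : Fin n) :
    count (StrongAdj G weak) R x + count (WeakAdj G weak) R x ≤ (nbrs G x).card := by
  classical
  rw [count, count, ← Finset.card_union_of_disjoint]
  · refine Finset.card_le_card fun v hv => ?_
    simp only [Finset.mem_union, Finset.mem_filter] at hv
    rcases hv with hv | hv
    exacts [mem_nbrs.2 hv.2.1, mem_nbrs.2 hv.2.1]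
  · rw [Finset.disjoint_left]
    intro v hv hv'
    exact (Finset.mem_filter.1 hv).2.2 (Finset.mem_filter.1 hv').2.2

open Classical in
theorem count_eq_erase {r : Fin n → Fin n → Prop} {R : Finset (Fin n)} {v : Fin n}
    (hv : v ∈ R) (x : Fin n) :
    count r R x = count r (R.erase v) x + if r x v then 1 else 0 := by
  rw [count, count, Finset.filter_erase]
  split_ifs with h
  · rw [Finset.card_erase_add_one]
    simp [hv, h]
  · rw [Finset.erase_eq_of_notMem]
    · rfl
    · simp [h]

/-- Only two weights occur, so a weighted degree is determined by two counts. These are the keys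
kept in the queue. -/
theorem wdeg_eq (lam : ℝ) (R : Finset (Fin n)) (v : Fin n) :
    wdeg G (weight weak lam) R v =
      count (StrongAdj G weak) R v + lam * count (WeakAdj G weak) R v := by
  classical
  simp only [wdeg, weight, Finset.sum_ite, Finset.filter_filter, Finset.sum_const, nsmul_eq_mul,
    mul_one]
  rw [add_comm, mul_comm lam]
  congr 2
  · congr 1
    ext
    simp [StrongAdj]
  · congr 2
    ext
    simp [WeakAdj]

theorem IsEdgeMatrix.eq_ite [DecidablePred (· ∈ weak)] {f : ℕ → ℕ} (h : IsEdgeMatrix weak f)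
    (u v : Fin n) : f (u * n + v) = if s(u, v) ∈ weak then 1 else 0 := by
  rw [h u v]
  simp [Set.indicator_apply]

/-- Writes the edge weights to real array 0 and the numbers of strong and weak edges at the vertices
to arrays 18 and 19. -/
def initDegrees : Cmd := eachArc
  (.rstore 0 (.var 4) (.sub (.ofWord (.const 1))
      (.mul (.ofWord (.arr 17 (entry 3 6))) (.sub (.ofWord (.const 1)) (.var 0)))) ;;
    .store 18 (.var 3) (.add (.arr 18 (.var 3)) (.sub (.const 1) (.arr 17 (entry 3 6)))) ;;
    .store 19 (.var 3) (.add (.arr 19 (.var 3)) (.arr 17 (entry 3 6))))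

theorem wp_initDegrees {off nb : ℕ → ℕ} (hG : IsInput G off nb) {W : ℕ} {lam : ℝ} {s : State}
    (hW : n + 1 < W) (hc : Ctx off nb n lam W s) (h17 : IsEdgeMatrix weak (s.a 17))
    (h18 : ∀ u : Fin n, s.a 18 u = 0) (h19 : ∀ u : Fin n, s.a 19 u = 0) :
    WP W initDegrees s fun t s' => t ≤ ∑ u, (∑ _x ∈ nbrs G u, 60 + 18) + 5 ∧
      IsEdgeArray G off nb (weight weak lam) (s'.ra 0) ∧
      (∀ u : Fin n, s'.a 18 u = count (StrongAdj G weak) Finset.univ u) ∧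
      ∀ u : Fin n, s'.a 19 u = count (WeakAdj G weak) Finset.univ u := by
  classical
  refine wp_eachArc hG (fun D s =>
      (∀ u v : Fin n, (u, v) ∈ D → ∀ p, off u ≤ p → p < off (u + 1) →
        nb p = v → s.ra 0 p = weight weak lam s(u, v)) ∧
      (∀ u : Fin n, s.a 18 u = count (fun u v => (u, v) ∈ D ∧ s(u, v) ∉ weak) Finset.univ u) ∧
      ∀ u : Fin n, s.a 19 u = count (fun u v => (u, v) ∈ D ∧ s(u, v) ∈ weak) Finset.univ u)
    (fun _ _ => 50) (by decide) rfl rfl rfl hc ?_ ?_ ?_ ?_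
  · intro D s₁ s₂ _ ha _ hra h
    simpa only [ha, hra] using h
  · simp [h18, h19, count]
  · rintro D u x s₁ _ hux hD hf hc₁ h3 h6 hp hp' hnb ⟨i1, i2, i3⟩
    have h17' : s₁.a 17 (u * n + x) = if s(u, x) ∈ weak then 1 else 0 := by
      rw [hf.a 17 rfl]
      exact h17.eq_ite u x
    have hle : ∀ r : Fin n → Fin n → Prop, count r Finset.univ u ≤ n := fun r =>
      (Finset.card_le_univ _).trans (by simp)
    have b18 := hle (fun u v => (u, v) ∈ D ∧ s(u, v) ∉ weak)
    have b19 := hle (fun u v => (u, v) ∈ D ∧ s(u, v) ∈ weak)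
    rw [← i2] at b18
    rw [← i3] at b19
    -- A new arc raises only the counter of its tail, and only if the arc is of kind `q`; this is
    -- used for strong and for weak edges.
    have hcount : ∀ (q : Sym2 (Fin n) → Prop) (v : Fin n),
        count (fun a b => (a, b) ∈ insert (u, x) D ∧ q s(a, b)) Finset.univ v =
          count (fun a b => (a, b) ∈ D ∧ q s(a, b)) Finset.univ v +
            if v = u ∧ q s(u, x) then 1 else 0 := by
      intro q v
      simp only [count]
      by_cases hvu : v = u ∧ q s(u, x)
      · obtain ⟨rfl, hq⟩ := hvu
        rw [if_pos ⟨rfl, hq⟩, ← Finset.card_insert_of_notMem (a := x)]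
        · congr 1
          ext y
          simp only [Finset.mem_filter, Finset.mem_univ, true_and, Finset.mem_insert,
            Prod.mk.injEq]
          constructor
          · rintro ⟨h | h, h'⟩
            exacts [Or.inl h, Or.inr ⟨h, h'⟩]
          · rintro (rfl | ⟨h, h'⟩)
            exacts [⟨Or.inl rfl, hq⟩, ⟨Or.inr h, h'⟩]
        · simp [hD]
      · rw [if_neg hvu, add_zero]
        congr 1
        ext y
        simp only [Finset.mem_filter, Finset.mem_univ, true_and, Finset.mem_insert,
          Prod.mk.injEq]
        constructor
        · rintro ⟨⟨rfl, rfl⟩ | h, h'⟩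
          · exact absurd ⟨rfl, h'⟩ hvu
          · exact ⟨h, h'⟩
        · rintro ⟨h, h'⟩
          exact ⟨Or.inr h, h'⟩
    simp only [wp_seq, wp_store, wp_rstore, WExp.eval, RExp.eval, entry_eval, h3, h6, hc₁.n_eq,
      hc₁.lam_eq, State.setRA_w, State.setRA_a, State.setA_w, h17',
      State.setA_a_of_ne _ _ _ _ _ (by decide : (17 : ℕ) ≠ 18),
      State.setA_a_of_ne _ _ _ _ _ (by decide : (19 : ℕ) ≠ 18)]
    refine ⟨by split_ifs <;> omega, by split_ifs <;> omega, by simp, ?_, ?_, ?_⟩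
    · intro v w hvw p hq hq' hnbq
      simp only [State.setA_ra, State.setRA_ra_self]
      by_cases hpq : p = s₁.w 4
      · subst hpq
        obtain rfl := hG.adj.row_unique hp hp' hq hq'
        obtain rfl : x = w := Fin.ext (hnb.symm.trans hnbq)
        simp only [Function.update_self, weight]
        split_ifs <;> simp
      · rw [Function.update_of_ne hpq]
        rw [Finset.mem_insert, Prod.mk.injEq] at hvw
        refine i1 v w (hvw.resolve_left ?_) p hq hq' hnbq
        rintro ⟨rfl, rfl⟩
        exact hpq ((hG.adj.complete v w hux).unique ⟨hq, hq', hnbq⟩ ⟨hp, hp', hnb⟩)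
    · intro v
      rw [hcount (fun e => e ∉ weak) v, ← i2]
      simp only [State.setA_a_of_ne _ _ _ _ _ (by decide : (18 : ℕ) ≠ 19), State.setA_a_self,
        State.setRA_a, Function.update_apply, Fin.val_inj]
      by_cases hvu : v = u
      · subst hvu
        by_cases hw : s(v, x) ∈ weak <;> simp [hw]
      · simp [hvu]
    · intro v
      rw [hcount (fun e => e ∈ weak) v, ← i3]
      simp only [State.setA_a_of_ne _ _ _ _ _ (by decide : (19 : ℕ) ≠ 18), State.setA_a_self,
        State.setRA_a, Function.update_apply, Fin.val_inj]
      by_cases hvu : v = u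
      · subst hvu
        by_cases hw : s(v, x) ∈ weak <;> simp [hw]
      · simp [hvu]
  · rintro t s' ht _ _ ⟨i1, i2, i3⟩
    refine ⟨by simpa using ht, fun u v huv p => i1 u v (by simpa using huv) p, fun u => ?_,
      fun u => ?_⟩
    · rw [i2]
      simp only [mem_arcs]
      rfl
    · rw [i3]
      simp only [mem_arcs]
      rfl

/-- Puts all vertices into the queue. -/
def fillQueue : Cmd := upTo 3 0 (.set 20 (.var 3) ;; enqueue)

theorem wp_fillQueue {off nb : ℕ → ℕ} {W : ℕ} {lam : ℝ} {s : State} (hlam : lam ≤ 1)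
    (hW : (n + 1) * (n + 1) + n < W) (hc : Ctx off nb n lam W s)
    (h18 : ∀ u : Fin n, s.a 18 u = count (StrongAdj G weak) Finset.univ u)
    (h19 : ∀ u : Fin n, s.a 19 u = count (WeakAdj G weak) Finset.univ u)
    (h20 : ∀ i, s.a 20 i = 0) (hra : ∀ i, s.ra 1 i = 0) :
    WP W fillQueue s fun t s' => t ≤ ∑ u, (150 * ((nbrs G u).card + 1) + 60) + 5 ∧
      Queue lam (Finset.univ : Finset (Fin n)) s' := by
  classical
  refine wp_upTo (N := n) (fun i s => Queue lam (Finset.univ.filter fun v : Fin n => (v : ℕ) < i) s)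
    (fun i => 150 * (deg G i + 1) + 53) rfl rfl (by decide) hc.bdd hc.n_eq ?_ ?_ ?_
  -- Zeroed memory is already the empty queue: all cells have size `0` and all tree values are the
  -- sentinel `0`.
  · refine ⟨⟨by simp, by simp, ?_⟩, ?_⟩
    · intro a b _ i hi
      simp [h20] at hi
    · intro a b _
      refine ⟨by simp [hra], ?_, ?_⟩
      · intro a' b' _ _ h
        simp [h20] at h
      · intro h
        simp [hra] at h
  · intro i s₁ hi hf hb hx hI
    have hc₁ := hc.frame hf hb rfl rfl rfl rfl
    obtain ⟨u, rfl⟩ : ∃ u : Fin n, (u : ℕ) = i := ⟨⟨i, hi⟩, rfl⟩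
    have huW : (u : ℕ) < W := by rw [← hx]; exact hb.w 3
    rw [wp_seq, wp_set]
    have hev : (WExp.var 3).eval s₁ = u := hx
    rw [hev]
    refine ⟨huW, ?_⟩
    have hc₂ : Ctx off nb n lam W (s₁.setW 20 u) :=
      ⟨by simp [hc₁.n_eq], hc₁.off_eq, hc₁.nb_eq, hc₁.lam_eq, hb.setW huW⟩
    have hs := count_strong_add_count_weak_le G weak Finset.univ u
    have hlt := card_nbrs_lt G u
    have e18 : (s₁.setW 20 u).a 18 u = count (StrongAdj G weak) Finset.univ u := by
      rw [State.setW_a, hf.a 18 rfl, h18]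
    have e19 : (s₁.setW 20 u).a 19 u = count (WeakAdj G weak) Finset.univ u := by
      rw [State.setW_a, hf.a 19 rfl, h19]
    refine (wp_enqueue hlam hW hc₂ (u := u) (by simp) (by omega) (by omega) (by simp)
      (hI.congr (by simp) (by simp) rfl rfl rfl rfl rfl)).mono ?_
    rintro t s₂ ⟨ht, hQ⟩
    refine ⟨?_, ?_⟩
    · rw [e18, e19] at ht
      simp only [deg_coe, WExp.cost]
      omega
    · have : (Finset.univ.filter fun v : Fin n => (v : ℕ) < u + 1) =
          insert u (Finset.univ.filter fun v : Fin n => (v : ℕ) < u) := by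
        ext v
        simp only [Finset.mem_filter, Finset.mem_univ, true_and, Finset.mem_insert, Fin.ext_iff]
        omega
      rw [this]
      exact hQ.congr (by simp) (by simp) rfl rfl rfl rfl rfl
  · intro t s' ht _ _ hI
    refine ⟨?_, ?_⟩
    · rw [← Fin.sum_univ_eq_sum_range (fun i => 150 * (deg G i + 1) + 53 + 7)] at ht
      simpa using ht
    · simpa using hI

end Degrees

end STCPeel


namespace STCPeel

/-! ## Peeling -/

section Peel

variable {n : ℕ} {G : SimpleGraph (Fin n)} {weak : Set (Sym2 (Fin n))}

/-- Decreases the key of the vertex in variable 6 by the weight of its edge to the vertex in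
variable 3. -/
def decreaseKey : Cmd := .set 20 (.var 6) ;; dequeue ;;
  .store 18 (.var 6) (.sub (.arr 18 (.var 6)) (.sub (.const 1) (.arr 17 (entry 3 6)))) ;;
  .store 19 (.var 6) (.sub (.arr 19 (.var 6)) (.arr 17 (entry 3 6))) ;; enqueue

open Classical in
-- The queue only depends on the keys of its members, so the key of `x` can be changed while `x` is
-- taken out. The new key is not larger, so both queue operations are charged to the old one.
theorem wp_decreaseKey {off nb : ℕ → ℕ} {W : ℕ} {lam : ℝ} {s : State} (hlam : lam ≤ 1)
    (hW : (n + 1) * (n + 1) + n < W) (hc : Ctx off nb n lam W s)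
    (h17 : IsEdgeMatrix weak (s.a 17)) {R : Finset (Fin n)} (hQ : Queue lam R s) {v x : Fin n}
    (h3 : s.w 3 = v) (h6 : s.w 6 = x) (hx : x ∈ R) :
    WP W decreaseKey s fun t s' => t ≤ 300 * (s.a 18 x + s.a 19 x + 1) + 180 ∧ Queue lam R s' ∧
      s'.a 18 = Function.update (s.a 18) x (s.a 18 x - if s(v, x) ∈ weak then 0 else 1) ∧
      s'.a 19 = Function.update (s.a 19) x (s.a 19 x - if s(v, x) ∈ weak then 1 else 0) := by
  obtain ⟨ha, hb⟩ := hQ.members.key_lt x hx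
  have hxW : (x : ℕ) < W := by rw [← h6]; exact hc.bdd.w 6
  rw [decreaseKey, wp_seq, wp_set, show (WExp.var 6).eval s = x from h6]
  refine ⟨hxW, ?_⟩
  have hc₁ : Ctx off nb n lam W (s.setW 20 x) :=
    ⟨by simp [hc.n_eq], hc.off_eq, hc.nb_eq, hc.lam_eq, hc.bdd.setW hxW⟩
  rw [wp_seq]
  refine (wp_dequeue hlam hW hc₁ (u := x) (by simp) hx
    (hQ.congr (by simp) (by simp) rfl rfl rfl rfl rfl)).strengthen hc₁.bdd ?_
  rintro t₂ s₂ ⟨ht₂, hQ₂⟩ hf₂ hb₂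
  have hc₂ := hc₁.frame hf₂ hb₂ rfl rfl rfl rfl
  have e17 : s₂.a 17 (v * n + x) = if s(v, x) ∈ weak then 1 else 0 := by
    rw [hf₂.a 17 rfl, State.setW_a]
    exact h17.eq_ite v x
  have e18 : s₂.a 18 = s.a 18 := hf₂.a 18 rfl
  have e19 : s₂.a 19 = s.a 19 := hf₂.a 19 rfl
  have w3 : s₂.w 3 = v := by rw [hf₂.w 3 rfl]; simp [h3]
  have w6 : s₂.w 6 = x := by rw [hf₂.w 6 rfl]; simp [h6]
  have w20 : s₂.w 20 = x := by rw [hf₂.w 20 rfl]; simp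
  have hsub : 1 - (if s(v, x) ∈ weak then 1 else 0) = if s(v, x) ∈ weak then 0 else 1 := by
    split_ifs <;> rfl
  set α := s.a 18 x - if s(v, x) ∈ weak then 0 else 1 with hα
  set β := s.a 19 x - if s(v, x) ∈ weak then 1 else 0 with hβ
  have hαle : α ≤ s.a 18 x := Nat.sub_le _ _
  have hβle : β ≤ s.a 19 x := Nat.sub_le _ _
  have bα : α < W := lt_of_le_of_lt hαle (hc.bdd.a _ _)
  have bβ : β < W := lt_of_le_of_lt hβle (hc.bdd.a _ _)
  simp only [wp_seq, wp_store, WExp.eval, entry_eval, w3, w6, hc₂.n_eq, State.setA_w, e17, hsub,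
    State.setA_a_of_ne _ _ _ _ _ (by decide : (17 : ℕ) ≠ 18),
    State.setA_a_of_ne _ _ _ _ _ (by decide : (19 : ℕ) ≠ 18), e18, e19, ← hα, ← hβ]
  refine ⟨bα, bβ, ?_⟩
  set s₃ := (s₂.setA 18 x α).setA 19 x β with hs₃
  have hb₃ : s₃.Bdd W := (hb₂.setA bα).setA bβ
  have hc₃ : Ctx off nb n lam W s₃ :=
    ⟨by simp [hs₃, hc₂.n_eq], by simp [hs₃, hc₂.off_eq], by simp [hs₃, hc₂.nb_eq],
      by simp [hs₃, hc₂.lam_eq], hb₃⟩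
  have g18 : s₃.a 18 = Function.update (s.a 18) x α := by simp [hs₃, e18]
  have g19 : s₃.a 19 = Function.update (s.a 19) x β := by simp [hs₃, e19]
  have g18x : s₃.a 18 x = α := by simp [g18]
  have g19x : s₃.a 19 x = β := by simp [g19]
  have hQ₃ : Queue lam (R.erase x) s₃ := by
    refine hQ₂.congr (fun y hy => ?_) (fun y hy => ?_) ?_ ?_ ?_ ?_ ?_
    · have : (y : ℕ) ≠ x := by simpa [Fin.val_inj] using Finset.ne_of_mem_erase hy
      rw [g18, e18, Function.update_of_ne this]
    · have : (y : ℕ) ≠ x := by simpa [Fin.val_inj] using Finset.ne_of_mem_erase hy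
      rw [g19, e19, Function.update_of_ne this]
    all_goals simp [hs₃]
  refine (wp_enqueue hlam hW hc₃ (u := x) (by simp [hs₃, w20]) (by omega) (by omega)
    (by simp) hQ₃).strengthen hb₃ ?_
  rintro t₄ s₄ ⟨ht₄, hQ₄⟩ hf₄ _
  rw [Finset.insert_erase hx] at hQ₄
  refine ⟨?_, hQ₄, by rw [hf₄.a 18 rfl, g18], by rw [hf₄.a 19 rfl, g19]⟩
  rw [g18x, g19x] at ht₄
  simp only [State.setW_a] at ht₂
  simp only [WExp.cost, entry_cost]
  omega

/-- Decreases the keys of the neighbours of the vertex in variable 3 that are not removed. -/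
def decreaseAll : Cmd := eachNb 3 4 5 6
  (.cond (.eq (.arr 24 (.var 6)) (.const 0)) decreaseKey .skip)

open Classical in
-- After `v` has left, the counters of its remaining neighbours are one too high in the class of
-- their edge to `v`. In the loop this excess survives exactly at the neighbours not yet visited.
theorem wp_decreaseAll {off nb : ℕ → ℕ} (hG : IsInput G off nb) {W : ℕ} {lam : ℝ} {s : State}
    (hlam : lam ≤ 1) (hW : (n + 1) * (n + 1) + n < W) (hc : Ctx off nb n lam W s)
    (h17 : IsEdgeMatrix weak (s.a 17)) {R : Finset (Fin n)} (hQ : Queue lam R s) {v : Fin n}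
    (h3 : s.w 3 = v) (h24 : ∀ x : Fin n, s.a 24 x = 0 ↔ x ∈ R)
    (h18 : ∀ x ∈ R, s.a 18 x = count (StrongAdj G weak) R x +
      if StrongAdj G weak v x then 1 else 0)
    (h19 : ∀ x ∈ R, s.a 19 x = count (WeakAdj G weak) R x +
      if WeakAdj G weak v x then 1 else 0) :
    WP W decreaseAll s fun t s' =>
      t ≤ ∑ x ∈ nbrs G v, (300 * ((nbrs G x).card + 3) + 200) + 11 ∧ Queue lam R s' ∧
      (∀ x ∈ R, s'.a 18 x = count (StrongAdj G weak) R x) ∧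
      ∀ x ∈ R, s'.a 19 x = count (WeakAdj G weak) R x := by
  refine wp_eachNb hG v (fun P s => Queue lam R s ∧
      (∀ x ∈ R, s.a 18 x = count (StrongAdj G weak) R x +
        if StrongAdj G weak v x ∧ x ∉ P then 1 else 0) ∧
      (∀ x ∈ R, s.a 19 x = count (WeakAdj G weak) R x +
        if WeakAdj G weak v x ∧ x ∉ P then 1 else 0))
    (fun x => 300 * ((nbrs G x).card + 3) + 190)
    rfl rfl rfl rfl (by decide) (by decide) hc.bdd hc.off_eq hc.nb_eq h3 ?_ ?_ ?_ ?_
  · rintro P s₁ s₂ _ ha _ hra ⟨h, h'⟩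
    refine ⟨h.congr ?_ ?_ ?_ ?_ ?_ ?_ ?_, by simpa only [ha] using h'⟩
    all_goals simp [ha, hra]
  · refine ⟨hQ, ?_, ?_⟩
    · simpa using h18
    · simpa using h19
  · rintro P x s₁ _ hvx hxP hf hb h6 _ _ _ ⟨hQ₁, i18, i19⟩
    have hc₁ := hc.frame hf hb rfl rfl rfl rfl
    rw [wp_cond]
    have htest : Test.holds s₁ (.eq (.arr 24 (.var 6)) (.const 0)) ↔ x ∈ R := by
      simp only [Test.holds, WExp.eval, h6, hf.a 24 rfl, h24]
    rw [htest]
    constructor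
    · intro hxR
      have h17' : IsEdgeMatrix weak (s₁.a 17) := by
        rw [hf.a 17 rfl]
        exact h17
      refine (wp_decreaseKey hlam hW hc₁ h17' hQ₁ (v := v) (by rw [hf.w 3 rfl, h3]) h6 hxR).mono ?_
      rintro t s₂ ⟨ht, hQ₂, e18, e19⟩
      refine ⟨?_, hQ₂, fun y hy => ?_, fun y hy => ?_⟩
      · have h1 := i18 x hxR
        have h2 := i19 x hxR
        have h3 := count_strong_add_count_weak_le G weak R x
        have h4 : (if StrongAdj G weak v x ∧ x ∉ P then 1 else 0) ≤ 1 := by split_ifs <;> simp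
        have h5 : (if WeakAdj G weak v x ∧ x ∉ P then 1 else 0) ≤ 1 := by split_ifs <;> simp
        simp only [Test.cost, WExp.cost]
        omega
      · rw [e18]
        by_cases hyx : y = x
        · subst hyx
          rw [Function.update_self, i18 y hy]
          by_cases hw : s(v, y) ∈ weak <;> simp [StrongAdj, hvx, hxP, hw]
        · rw [Function.update_of_ne (by simpa [Fin.val_inj] using hyx), i18 y hy]
          simp [hyx]
      · rw [e19]
        by_cases hyx : y = x
        · subst hyx
          rw [Function.update_self, i19 y hy]
          by_cases hw : s(v, y) ∈ weak <;> simp [WeakAdj, hvx, hxP, hw]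
        · rw [Function.update_of_ne (by simpa [Fin.val_inj] using hyx), i19 y hy]
          simp [hyx]
    · intro hxR
      rw [wp_skip]
      have hne : ∀ y ∈ R, y ≠ x := fun y hy h => hxR (h ▸ hy)
      refine ⟨by simp only [Test.cost, WExp.cost]; omega, hQ₁, fun y hy => ?_, fun y hy => ?_⟩
      · rw [i18 y hy]
        simp [hne y hy]
      · rw [i19 y hy]
        simp [hne y hy]
  · rintro t s' ht _ _ ⟨hQ', i18, i19⟩
    refine ⟨?_, hQ', fun x hx => ?_, fun x hx => ?_⟩
    · simpa [add_assoc] using ht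
    · rw [i18 x hx, if_neg, add_zero]
      rintro ⟨h, h'⟩
      exact h' (mem_nbrs.2 h.1)
    · rw [i19 x hx, if_neg, add_zero]
      rintro ⟨h, h'⟩
      exact h' (mem_nbrs.2 h.1)

/-- The vertices that are left after the removal of `f 0, …, f (i - 1)`. -/
def left (n : ℕ) (f : ℕ → ℕ) (i : ℕ) : Finset (Fin n) :=
  Finset.univ.filter fun v => ∀ j < i, f j ≠ v

@[simp] theorem mem_left {f : ℕ → ℕ} {i : ℕ} {v : Fin n} :
    v ∈ left n f i ↔ ∀ j < i, f j ≠ v := by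
  simp [left]

theorem left_succ {f : ℕ → ℕ} {i : ℕ} {v : Fin n} (h : f i = v) :
    left n f (i + 1) = (left n f i).erase v := by
  ext x
  simp only [mem_left, Finset.mem_erase, Nat.lt_succ_iff_lt_or_eq]
  constructor
  · intro hx
    refine ⟨?_, fun j hj => hx j (Or.inl hj)⟩
    rintro rfl
    exact hx i (Or.inr rfl) h
  · rintro ⟨hxv, hx⟩ j (hj | rfl)
    · exact hx j hj
    · rw [h, Ne, Fin.val_inj]
      exact hxv.symm

theorem left_congr {f g : ℕ → ℕ} {i : ℕ} (h : ∀ j < i, f j = g j) : left n f i = left n g i := by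
  ext x
  simp only [mem_left]
  exact forall₂_congr fun j hj => by rw [h j hj]

/-- In the first `i` rounds, a vertex of minimum weighted degree is removed; `f` holds these vertices
and `ky` their weighted degrees. -/
def Removes (G : SimpleGraph (Fin n)) (w : Sym2 (Fin n) → ℝ) (f : ℕ → ℕ) (ky : ℕ → ℝ) (i : ℕ) :
    Prop :=
  ∀ j < i, ∃ v ∈ left n f j, f j = v ∧ ky j = wdeg G w (left n f j) v ∧
    ∀ x ∈ left n f j, wdeg G w (left n f j) v ≤ wdeg G w (left n f j) x

theorem Removes.card_left {w : Sym2 (Fin n) → ℝ} {f : ℕ → ℕ} {ky : ℕ → ℝ} {i : ℕ}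
    (h : Removes G w f ky i) : ∀ j ≤ i, (left n f j).card = n - j := by
  intro j hj
  induction j with
  | zero => simp [left]
  | succ j ih =>
    obtain ⟨v, hv, hfv, _⟩ := h j hj
    rw [left_succ hfv, Finset.card_erase_of_mem hv, ih (by omega)]
    omega

/-- One round of peeling; the number of the round stands in variable 18. -/
def peelRound : Cmd :=
  .set 20 (.arr 21 (.mul (.arr 23 (.const 0)) (.add (.var 0) (.const 1)))) ;;
  .set 3 (.var 20) ;; .store 7 (.var 18) (.var 20) ;;
  .rstore 2 (.var 18) (.add (.ofWord (.arr 18 (.var 20)))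
    (.mul (.var 0) (.ofWord (.arr 19 (.var 20))))) ;;
  .store 24 (.var 20) (.const 1) ;; dequeue ;; decreaseAll

/-- The state of the peeling when the vertices of `R` are left. -/
structure PeelState (G : SimpleGraph (Fin n)) (weak : Set (Sym2 (Fin n))) (lam : ℝ)
    (R : Finset (Fin n)) (s : State) : Prop where
  queue : Queue lam R s
  strong : ∀ x ∈ R, s.a 18 x = count (StrongAdj G weak) R x
  weak : ∀ x ∈ R, s.a 19 x = count (WeakAdj G weak) R x
  removed : ∀ x : Fin n, s.a 24 x = 0 ↔ x ∈ R

/-- The time for the removal of a vertex. -/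
noncomputable def removalTime (G : SimpleGraph (Fin n)) (v : Fin n) : ℕ :=
  ∑ x ∈ nbrs G v, (300 * ((nbrs G x).card + 3) + 200) + (150 * ((nbrs G v).card + 1) + 150)

open Classical in
-- By `wdeg_eq` the queue keys are the weighted degrees within `R`, so the minimum of the queue is
-- an admissible choice. Its weighted degree is recorded for the later density computation; the `7`
-- makes room for the overhead of the outer loop.
theorem wp_peelRound {off nb : ℕ → ℕ} (hG : IsInput G off nb) {W : ℕ} {lam : ℝ} {s : State}
    (hlam : lam ≤ 1) (hW : (n + 1) * (n + 1) + n < W) (hc : Ctx off nb n lam W s)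
    (h17 : IsEdgeMatrix weak (s.a 17)) {R : Finset (Fin n)} (hR : R.Nonempty)
    (h : PeelState G weak lam R s) {i : ℕ} (h18 : s.w 18 = i) :
    WP W peelRound s fun t s' => ∃ v ∈ R, t + 7 ≤ removalTime G v ∧
      PeelState G weak lam (R.erase v) s' ∧ s'.a 7 = Function.update (s.a 7) i v ∧
      s'.ra 2 = Function.update (s.ra 2) i (wdeg G (weight weak lam) R v) ∧
      ∀ x ∈ R, wdeg G (weight weak lam) R v ≤ wdeg G (weight weak lam) R x := by
  obtain ⟨v, hv, hval, hmin⟩ := h.queue.min hlam hR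
  have hkey : ∀ x ∈ R, (s.a 18 x + lam * s.a 19 x : ℝ) = wdeg G (weight weak lam) R x := by
    intro x hx
    rw [wdeg_eq, h.strong x hx, h.weak x hx]
  have hvW : (v : ℕ) < W := by rw [← hval]; exact hc.bdd.a _ _
  have hiW : i < W := by rw [← h18]; exact hc.bdd.w 18
  have h1W : 1 < W := by nlinarith
  obtain ⟨K, hK⟩ : ∃ K : ℝ, K = s.a 18 v + lam * s.a 19 v := ⟨_, rfl⟩
  rw [peelRound]
  simp only [wp_seq, wp_set, wp_store, wp_rstore, WExp.eval, RExp.eval, hc.n_eq, hval, hvW,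
    State.setW_w, State.setW_a, State.setW_r, State.setA_w, State.setA_r, hc.lam_eq,
    State.setRA_w, if_true, true_and, h18,
    State.setA_a_of_ne _ _ _ _ _ (by decide : (18 : ℕ) ≠ 7),
    State.setA_a_of_ne _ _ _ _ _ (by decide : (19 : ℕ) ≠ 7),
    (by decide : ¬ (20 : ℕ) = 3), (by decide : ¬ (18 : ℕ) = 20), (by decide : ¬ (18 : ℕ) = 3),
    if_false, h1W, ← hK]
  set s₁ := (((s.setW 20 v).setW 3 v).setA 7 i v).setRA 2 i K |>.setA 24 v 1 with hs₁
  have hb₁ : s₁.Bdd W := by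
    have := (((hc.bdd.setW (x := 20) hvW).setW (x := 3) hvW).setA (A := 7) (i := i) hvW)
    have h2 : ((((s.setW 20 v).setW 3 v).setA 7 i v).setRA 2 i K).Bdd W := ⟨this.w, this.a⟩
    exact h2.setA h1W
  have hc₁ : Ctx off nb n lam W s₁ :=
    ⟨by simp [hs₁, hc.n_eq], by simp [hs₁, hc.off_eq], by simp [hs₁, hc.nb_eq],
      by simp [hs₁, hc.lam_eq], hb₁⟩
  have hQ₁ : Queue lam R s₁ := by
    refine h.queue.congr ?_ ?_ ?_ ?_ ?_ ?_ ?_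
    all_goals simp [hs₁]
  refine (wp_dequeue hlam hW hc₁ (u := v) (by simp [hs₁]) hv hQ₁).strengthen hb₁ ?_
  rintro t₂ s₂ ⟨ht₂, hQ₂⟩ hf₂ hb₂
  have hc₂ := hc₁.frame hf₂ hb₂ rfl rfl rfl rfl
  have e18 : s₂.a 18 = s.a 18 := by rw [hf₂.a 18 rfl]; simp [hs₁]
  have e19 : s₂.a 19 = s.a 19 := by rw [hf₂.a 19 rfl]; simp [hs₁]
  have e24 : s₂.a 24 = Function.update (s.a 24) v 1 := by rw [hf₂.a 24 rfl]; simp [hs₁]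
  have e7 : s₂.a 7 = Function.update (s.a 7) i v := by rw [hf₂.a 7 rfl]; simp [hs₁]
  have era : s₂.ra 2 = Function.update (s.ra 2) i K := by rw [hf₂.ra 2 rfl]; simp [hs₁]
  have e17 : s₂.a 17 = s.a 17 := by rw [hf₂.a 17 rfl]; simp [hs₁]
  have r24 : ∀ x : Fin n, s₂.a 24 x = 0 ↔ x ∈ R.erase v := by
    intro x
    rw [e24, Function.update_apply, Finset.mem_erase, ← h.removed x]
    by_cases hxv : x = v <;> simp [hxv, Fin.val_inj]
  refine (wp_decreaseAll hG hlam hW hc₂ (by rw [e17]; exact h17) hQ₂ (v := v)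
    (by rw [hf₂.w 3 rfl]; simp [hs₁]) r24 ?_ ?_).strengthen hb₂ ?_
  · intro x hx
    rw [e18, h.strong x (Finset.mem_of_mem_erase hx), count_eq_erase hv x]
    simp only [strongAdj_comm (u := x)]
  · intro x hx
    rw [e19, h.weak x (Finset.mem_of_mem_erase hx), count_eq_erase hv x]
    simp only [weakAdj_comm (u := x)]
  · rintro t₃ s₃ ⟨ht₃, hQ₃, g18, g19⟩ hf₃ _
    refine ⟨v, hv, ?_, ⟨hQ₃, g18, g19, ?_⟩, ?_, ?_, ?_⟩
    · have h1 := count_strong_add_count_weak_le G weak R v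
      rw [← h.strong v hv, ← h.weak v hv] at h1
      have h2 : s₁.a 18 v = s.a 18 v := by simp [hs₁]
      have h3 : s₁.a 19 v = s.a 19 v := by simp [hs₁]
      rw [h2, h3] at ht₂
      simp only [removalTime, WExp.cost, RExp.cost]
      omega
    · rw [hf₃.a 24 rfl]
      exact r24
    · rw [hf₃.a 7 rfl, e7]
    · rw [hf₃.ra 2 rfl, era, hK, hkey v hv]
    · intro x hx
      rw [← hkey v hv, ← hkey x hx]
      exact hmin x hx

/-- Peeling. -/
def peel : Cmd := upTo 18 0 peelRound

/-- The order of removal is not known beforehand, so the invariant is amortised: the time used plus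
the cost of removing all vertices still left stays below the cost of removing all vertices. -/
theorem wp_peel {off nb : ℕ → ℕ} (hG : IsInput G off nb) {W : ℕ} {lam : ℝ} {s : State}
    (hlam : lam ≤ 1) (hW : (n + 1) * (n + 1) + n < W) (hc : Ctx off nb n lam W s)
    (h17 : IsEdgeMatrix weak (s.a 17)) (h : PeelState G weak lam Finset.univ s) :
    WP W peel s fun t s' => t ≤ ∑ v, removalTime G v + 5 ∧
      Removes G (weight weak lam) (s'.a 7) (s'.ra 2) n := by
  classical
  refine wp_upTo_time (N := n) (fun i t s =>
      t + ∑ v ∈ left n (s.a 7) i, removalTime G v ≤ ∑ v, removalTime G v ∧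
      PeelState G weak lam (left n (s.a 7) i) s ∧
      Removes G (weight weak lam) (s.a 7) (s.ra 2) i)
    rfl rfl (by decide) hc.bdd hc.n_eq ?_ ?_ ?_
  · have : ∀ f, left n f 0 = Finset.univ := by simp [left]
    refine ⟨by simp [this], ?_, by simp [Removes]⟩
    rw [this]
    exact ⟨h.queue.congr (by simp) (by simp) rfl rfl rfl rfl rfl, h.strong, h.weak, h.removed⟩
  · rintro i t s₁ hi hf hb hx ⟨ht, hP, hrem⟩
    have hc₁ := hc.frame hf hb rfl rfl rfl rfl
    have hne : (left n (s₁.a 7) i).Nonempty := by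
      rw [← Finset.card_pos, hrem.card_left i le_rfl]
      omega
    refine (wp_peelRound hG hlam hW hc₁ (by rw [hf.a 17 rfl]; exact h17) hne hP hx).mono ?_
    rintro t' s₂ ⟨v, hv, ht', hP₂, e7, era, hmin⟩
    have hl : ∀ j ≤ i, left n (s₂.a 7) j = left n (s₁.a 7) j := by
      intro j hj
      refine left_congr fun k hk => ?_
      rw [e7, Function.update_of_ne (by omega)]
    have hi7 : s₂.a 7 i = v := by simp [e7]
    have hsucc : left n (s₂.a 7) (i + 1) = (left n (s₁.a 7) i).erase v := by
      rw [left_succ hi7, hl i le_rfl]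
    simp only [State.setW_a, State.setW_ra, hsucc]
    refine ⟨?_, ?_, ?_⟩
    · have := Finset.add_sum_erase _ (removalTime G) hv
      omega
    · exact ⟨hP₂.queue.congr (by simp) (by simp) rfl rfl rfl rfl rfl, hP₂.strong, hP₂.weak,
        hP₂.removed⟩
    · intro j hj
      rcases Nat.lt_succ_iff_lt_or_eq.1 hj with hj | rfl
      · obtain ⟨x, h1, h2, h3, h4⟩ := hrem j hj
        rw [hl j hj.le]
        exact ⟨x, h1, by rw [e7, Function.update_of_ne hj.ne, h2],
          by rw [era, Function.update_of_ne hj.ne, h3], h4⟩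
      · rw [hl j le_rfl]
        exact ⟨v, hv, hi7, by simp [era], hmin⟩
  · rintro t s' _ _ ⟨ht, _, hrem⟩
    exact ⟨by omega, hrem⟩

theorem sum_removalTime_le (G : SimpleGraph (Fin n)) :
    ∑ v, removalTime G v ≤ 2000 * size G := by
  have h1 : ∑ v, removalTime G v ≤
      ∑ v, ∑ x ∈ nbrs G v, 300 * ((nbrs G v).card + (nbrs G x).card) +
        ∑ v, (1100 * (nbrs G v).card + (150 * ((nbrs G v).card + 1) + 150)) := by
    rw [← Finset.sum_add_distrib]
    refine Finset.sum_le_sum fun v _ => ?_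
    -- Adding the superfluous `deg v` makes the summand symmetric, so that `sum_nbrs_degree_add`
    -- applies.
    have h2 : ∑ x ∈ nbrs G v, (300 * ((nbrs G x).card + 3) + 200) ≤
        ∑ x ∈ nbrs G v, (300 * ((nbrs G v).card + (nbrs G x).card) + 1100) :=
      Finset.sum_le_sum fun x _ => by omega
    rw [Finset.sum_add_distrib (g := fun _ => 1100), Finset.sum_const, smul_eq_mul] at h2
    rw [removalTime]
    omega
  simp only [← Finset.mul_sum] at h1
  rw [sum_nbrs_degree_add] at h1
  have h2 : ∑ u, (nbrs G u).card ^ 2 ≤ 1 * size G := sum_le_size G fun u => by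
    rw [one_mul]
    exact Nat.pow_le_pow_left (by omega) 2
  have h3 : ∑ v, (1100 * (nbrs G v).card + (150 * ((nbrs G v).card + 1) + 150)) ≤
      1400 * size G := sum_le_size G fun u => by nlinarith
  omega

end Peel

end STCPeel


namespace STCPeel

/-! ## The densest remaining set -/

section Density

variable {n : ℕ} {G : SimpleGraph (Fin n)}

open Classical in
/-- Total weight of the edges inside `R`. -/
noncomputable def inside (G : SimpleGraph (Fin n)) (w : Sym2 (Fin n) → ℝ) (R : Finset (Fin n)) : ℝ :=
  ∑ e ∈ (sub G R).edgeFinset, w e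

theorem density_eq (G : SimpleGraph (Fin n)) (w : Sym2 (Fin n) → ℝ) (R : Finset (Fin n)) :
    density G w R = inside G w R / R.card := rfl

theorem inside_empty (w : Sym2 (Fin n) → ℝ) : inside G w ∅ = 0 := by
  classical
  refine Finset.sum_eq_zero fun e he => ?_
  induction e with
  | _ x y => simp at he

theorem inside_nonneg {w : Sym2 (Fin n) → ℝ} (hw : ∀ e, 0 ≤ w e) (R : Finset (Fin n)) :
    0 ≤ inside G w R :=
  Finset.sum_nonneg fun e _ => hw e

/-- The edges inside `R` split into those avoiding `v` and the star of `v` in `R`. Adding up the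
recorded degrees backwards thus yields the total weight of every remaining set. -/
theorem inside_erase (w : Sym2 (Fin n) → ℝ) {R : Finset (Fin n)} {v : Fin n} (hv : v ∈ R) :
    inside G w R = inside G w (R.erase v) + wdeg G w R v := by
  classical
  rw [inside, inside, wdeg]
  have hinj : Set.InjOn (fun u => s(v, u)) (R.filter fun u => G.Adj v u : Finset (Fin n)) :=
    fun x _ y _ h => Sym2.congr_right.1 h
  rw [← Finset.sum_image hinj, ← Finset.sum_union]
  · refine Finset.sum_congr ?_ fun _ _ => rfl
    ext e
    induction e with
    | _ x y =>
      simp only [SimpleGraph.mem_edgeFinset, SimpleGraph.mem_edgeSet, sub_adj, Finset.mem_union,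
        Finset.mem_erase, Finset.mem_image, Finset.mem_filter]
      constructor
      · rintro ⟨ha, hx, hy⟩
        by_cases hxv : x = v
        · subst hxv
          exact Or.inr ⟨y, ⟨hy, ha⟩, rfl⟩
        by_cases hyv : y = v
        · subst hyv
          exact Or.inr ⟨x, ⟨hx, ha.symm⟩, Sym2.eq_swap⟩
        exact Or.inl ⟨ha, ⟨hxv, hx⟩, hyv, hy⟩
      · rintro (⟨ha, ⟨_, hx⟩, _, hy⟩ | ⟨u, ⟨hu, ha⟩, h⟩)
        · exact ⟨ha, hx, hy⟩
        · rcases Sym2.eq_iff.1 h with ⟨rfl, rfl⟩ | ⟨rfl, rfl⟩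
          · exact ⟨ha, hv, hu⟩
          · exact ⟨ha.symm, hu, hv⟩
  · rw [Finset.disjoint_left]
    intro e he he'
    obtain ⟨u, _, rfl⟩ := Finset.mem_image.1 he'
    simp at he

/-- Finds the number of the round before which the remaining set is a densest one. -/
def findBest : Cmd :=
  .rset 1 (.ofWord (.const 0)) ;;
  .rset 2 (.sub (.ofWord (.const 0)) (.ofWord (.const 1))) ;;
  upTo 18 0
    (.set 31 (.sub (.sub (.var 0) (.const 1)) (.var 18)) ;;
     .rset 1 (.add (.var 1) (.arr 2 (.var 31))) ;;
     .cond (.rlt (.var 2) (.div (.var 1) (.ofWord (.add (.var 18) (.const 1)))))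
       (.rset 2 (.div (.var 1) (.ofWord (.add (.var 18) (.const 1)))) ;; .set 30 (.var 31))
       .skip)

/-- Starting from the empty set, the removed vertices are put back in reverse order. One addition of
a recorded degree and one division give each density, so constant time per set suffices. -/
theorem wp_findBest {off nb : ℕ → ℕ} {W : ℕ} {lam : ℝ} {s : State} (hn : 1 ≤ n)
    (hc : Ctx off nb n lam W s) {w : Sym2 (Fin n) → ℝ} (hw : ∀ e, 0 ≤ w e)
    (h : Removes G w (s.a 7) (s.ra 2) n) :
    WP W findBest s fun t s' => t ≤ ∑ _u : Fin n, 60 + 20 ∧ s'.w 30 < n ∧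
      ∀ j < n, density G w (left n (s.a 7) j) ≤ density G w (left n (s.a 7) (s'.w 30)) := by
  set L := left n (s.a 7) with hL
  rw [findBest]
  simp only [wp_seq, wp_rset, RExp.eval, WExp.eval, RExp.cost, WExp.cost]
  set s₀ := (s.setR 1 _).setR 2 _ with hs₀
  have hb₀ : s₀.Bdd W := ⟨hc.bdd.w, hc.bdd.a⟩
  refine wp_upTo (N := n) (fun i s₁ => s₁.r 1 = inside G w (L (n - i)) ∧
      (i = 0 → s₁.r 2 = -1) ∧ (∀ j, n - i ≤ j → j < n → density G w (L j) ≤ s₁.r 2) ∧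
      (0 < i → n - i ≤ s₁.w 30 ∧ s₁.w 30 < n ∧ s₁.r 2 = density G w (L (s₁.w 30))))
    (fun _ => 40) rfl rfl (by decide) hb₀ hc.n_eq ?_ ?_ ?_
  · have : L n = ∅ := by
      rw [← Finset.card_eq_zero, hL, h.card_left n le_rfl, Nat.sub_self]
    refine ⟨?_, ?_, ?_, ?_⟩
    · simp [hs₀, this, inside_empty]
    · simp [hs₀]
    · intro j h1 h2
      omega
    · simp
  · rintro i s₁ hi hf hb hx ⟨h1, h2, h3, h4⟩
    have hn₁ : s₁.w 0 = n := (hf.w 0 rfl).trans hc.n_eq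
    have hra : s₁.ra 2 = s.ra 2 := hf.ra 2 rfl
    have hnW : n < W := hc.n_eq ▸ hc.bdd.w 0
    obtain ⟨v, hv, hfv, hky, _⟩ := h (n - 1 - i) (by omega)
    have hsucc := left_succ hfv
    rw [show n - 1 - i + 1 = n - i by omega] at hsucc
    have hsum : s₁.r 1 + s.ra 2 (n - 1 - i) = inside G w (L (n - 1 - i)) := by
      rw [h1, hky, inside_erase w hv, hL, hsucc]
    have hden : inside G w (L (n - 1 - i)) / ((i + 1 : ℕ) : ℝ) = density G w (L (n - 1 - i)) := by
      rw [density_eq, hL, h.card_left _ (by omega), show n - (n - 1 - i) = i + 1 by omega]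
    have hpos : 0 ≤ density G w (L (n - 1 - i)) := by
      rw [← hden]
      exact div_nonneg (inside_nonneg hw _) (Nat.cast_nonneg _)
    simp only [wp_seq, wp_set, wp_rset, wp_cond, wp_skip, Test.holds, RExp.eval, WExp.eval,
      State.setW_w, State.setW_r, State.setW_ra, State.setR_w, State.setR_r, hn₁, hx,
      hra, hsum, hden, if_true, RExp.cost, WExp.cost, Test.cost,
      (by decide : ¬ (18 : ℕ) = 31), (by decide : ¬ (2 : ℕ) = 1), (by decide : ¬ (1 : ℕ) = 2),
      (by decide : ¬ (30 : ℕ) = 18), (by decide : ¬ (30 : ℕ) = 31),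
      if_false, (by omega : n - 1 - i < W), true_and,
      show n - (i + 1) = n - 1 - i by omega]
    refine ⟨fun hlt => ⟨by omega, by omega, ?_, fun _ => ⟨le_rfl, by omega, trivial⟩⟩,
      fun hlt => ⟨by omega, by omega, ?_, fun _ => ?_⟩⟩
    · intro j hj hjn
      rcases hj.eq_or_lt with rfl | hj
      · exact le_rfl
      · exact (h3 j (by omega) hjn).trans hlt.le
    · intro j hj hjn
      rcases hj.eq_or_lt with rfl | hj
      · exact not_lt.1 hlt
      · exact h3 j (by omega) hjn
    -- The initial value `-1` lies below every density, as weights are nonnegative. Hence the first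
    -- candidate is always taken and variable 30 holds a valid round.
    · have hi0 : 0 < i := by
        by_contra h0
        rw [h2 (by omega)] at hlt
        linarith
      have := h4 hi0
      exact ⟨by omega, this.2.1, this.2.2⟩
  · rintro t s' ht hf _ ⟨_, _, h3, h4⟩
    obtain ⟨_, hk, hr⟩ := h4 (by omega)
    refine ⟨?_, hk, fun j hj => ?_⟩
    · simp only [Finset.sum_const, Finset.card_range, Finset.card_univ, Fintype.card_fin,
        smul_eq_mul] at ht ⊢
      omega
    · rw [← hr]
      exact h3 j (by omega) hj

/-- Writes the flags of the vertices that are not removed before the round in variable 30. -/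
def writeFlags : Cmd := upTo 18 0
  (.cond (.lt (.var 18) (.var 30)) (.store 8 (.arr 7 (.var 18)) (.const 0))
    (.store 8 (.arr 7 (.var 18)) (.const 1)))

/-- A vertex is still left when it is removed, so no vertex is removed twice; an injection of `Fin
n` into itself is a permutation. -/
theorem Removes.exists_perm {w : Sym2 (Fin n) → ℝ} {f : ℕ → ℕ} {ky : ℕ → ℝ}
    (h : Removes G w f ky n) : ∃ order : Equiv.Perm (Fin n), ∀ i : Fin n, f i = order i := by
  choose g hg hfg _ using fun i : Fin n => h i i.2
  have hinj : Function.Injective g := by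
    have : ∀ i j : Fin n, i < j → g i ≠ g j := fun i j hij he =>
      mem_left.1 (hg j) i hij (by rw [hfg i, he])
    intro i j he
    by_contra hne
    rcases lt_or_gt_of_ne hne with hlt | hlt
    · exact this i j hlt he
    · exact this j i hlt he.symm
  exact ⟨Equiv.ofBijective g (Finite.injective_iff_bijective.1 hinj), hfg⟩

theorem left_eq_remaining {f : ℕ → ℕ} {order : Equiv.Perm (Fin n)}
    (h : ∀ i : Fin n, f i = order i) {i : ℕ} (hi : i ≤ n) : left n f i = remaining order i := by
  ext v
  simp only [mem_left, remaining, Finset.mem_filter, Finset.mem_univ, true_and]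
  constructor
  · intro hv
    by_contra hlt
    exact hv _ (not_le.1 hlt) (by rw [h]; simp)
  · intro hv j hj he
    rw [h ⟨j, hj.trans_le hi⟩, Fin.val_inj] at he
    rw [← he, Equiv.symm_apply_apply] at hv
    simp only at hv
    omega

theorem Removes.isPeelOrder {w : Sym2 (Fin n) → ℝ} {f : ℕ → ℕ} {ky : ℕ → ℝ}
    (h : Removes G w f ky n) {order : Equiv.Perm (Fin n)} (ho : ∀ i : Fin n, f i = order i) :
    IsPeelOrder G w order := by
  intro i v hv
  obtain ⟨x, _, hfx, _, hmin⟩ := h i i.2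
  rw [← left_eq_remaining ho i.2.le] at hv ⊢
  rw [ho i, Fin.val_inj] at hfx
  rw [hfx]
  exact hmin v hv

theorem wp_writeFlags {off nb : ℕ → ℕ} {W : ℕ} {lam : ℝ} {s : State} (hW : 1 < W)
    (hc : Ctx off nb n lam W s) {order : Equiv.Perm (Fin n)}
    (ho : ∀ i : Fin n, s.a 7 i = order i) :
    WP W writeFlags s fun t s' => t ≤ ∑ _u : Fin n, 20 + 5 ∧
      IsFlags (remaining order (s.w 30)) (s'.a 8) := by
  refine wp_upTo (N := n) (fun i s₁ => ∀ v : Fin n, (order.symm v : ℕ) < i →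
      s₁.a 8 v = if s.w 30 ≤ (order.symm v : ℕ) then 1 else 0)
    (fun _ => 13) rfl rfl (by decide) hc.bdd hc.n_eq (by simp) ?_ ?_
  · intro i s₁ hi hf hb hx hI
    have h7 : s₁.a 7 i = order ⟨i, hi⟩ := by rw [hf.a 7 rfl]; exact ho ⟨i, hi⟩
    have key : ∀ (c : ℕ), (c = if s.w 30 ≤ i then 1 else 0) → ∀ v : Fin n,
        (order.symm v : ℕ) < i + 1 → Function.update (s₁.a 8) (order ⟨i, hi⟩ : ℕ) c v =
          if s.w 30 ≤ (order.symm v : ℕ) then 1 else 0 := by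
      intro c hcc v hv
      by_cases hvi : v = order ⟨i, hi⟩
      · subst hvi
        simp [hcc]
      · rw [Function.update_of_ne (by simpa [Fin.val_inj] using hvi)]
        refine hI v (lt_of_le_of_ne (by omega) fun he => hvi ?_)
        rw [← Equiv.symm_apply_eq]
        exact Fin.ext he
    simp only [wp_cond, wp_store, Test.holds, WExp.eval, hx, h7, WExp.cost, Test.cost, hf.w 30 rfl,
      State.setW_a, State.setA_a_self, hW, (by omega : 0 < W), true_and]
    refine ⟨fun h => ⟨by omega, key 0 (by simp [h])⟩, fun h => ⟨by omega, key 1 ?_⟩⟩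
    rw [if_pos (not_lt.1 h)]
  · intro t s' ht _ _ hI
    refine ⟨by simpa using ht, fun v => ?_⟩
    rw [hI v (order.symm v).2]
    simp [remaining]

/-- Writes the flags of all vertices. -/
def initFlags : Cmd := upTo 18 0 (.store 8 (.var 18) (.const 1))

theorem wp_initFlags {off nb : ℕ → ℕ} {W : ℕ} {lam : ℝ} {s : State} (hW : 1 < W)
    (hc : Ctx off nb n lam W s) :
    WP W initFlags s fun t s' => t ≤ ∑ _u : Fin n, 10 + 5 ∧
      IsFlags (Finset.univ : Finset (Fin n)) (s'.a 8) := by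
  refine wp_upTo (N := n) (fun i s₁ => ∀ j < i, s₁.a 8 j = 1)
    (fun _ => 3) rfl rfl (by decide) hc.bdd hc.n_eq (by simp) ?_ ?_
  · intro i s₁ hi hf hb hx hI
    simp only [wp_store, WExp.eval, hx, WExp.cost, State.setW_a, State.setA_a_self, hW, true_and]
    refine ⟨by omega, fun j hj => ?_⟩
    by_cases hji : j = i
    · simp [hji]
    · rw [Function.update_of_ne hji]
      exact hI j (by omega)
  · intro t s' ht _ _ hI
    exact ⟨by simpa using ht, fun v => by simp [hI v v.2]⟩

end Density

end STCPeel


namespace STCPeel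

/-! ## The whole program -/

section Program

variable {n : ℕ} {G : SimpleGraph (Fin n)}

/-- STC-Peel. -/
def stcPeel : Cmd :=
  initFlags ;; apr ;; copyOut ;; initDegrees ;; fillQueue ;; peel ;; findBest ;; writeFlags ;; apr

theorem weight_nonneg (weak : Set (Sym2 (Fin n))) {lam : ℝ} (h : 0 ≤ lam) (e : Sym2 (Fin n)) :
    0 ≤ weight weak lam e := by
  rw [weight]
  split_ifs
  exacts [h, zero_le_one]

theorem exists_row {off nb : ℕ → ℕ} (hG : IsInput G off nb) {p : ℕ} (hp : p < off n) :
    ∃ u : Fin n, off u ≤ p ∧ p < off (u + 1) := by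
  classical
  have hex : ∃ i, p < off i := ⟨n, hp⟩
  obtain ⟨i, hi⟩ : ∃ i, Nat.find hex = i + 1 := by
    refine Nat.exists_eq_succ_of_ne_zero fun h0 => ?_
    have := Nat.find_spec hex
    rw [h0, hG.adj.zero] at this
    omega
  have hle : Nat.find hex ≤ n := Nat.find_min' hex hp
  refine ⟨⟨i, by omega⟩, not_lt.1 (Nat.find_min hex (by rw [hi]; exact i.lt_succ_self)), ?_⟩
  have := Nat.find_spec hex
  rwa [hi] at this

/-- Boundedness is demanded of every memory cell, so the convention that unused input cells hold `0`
is needed here. Used offsets are at most the total degree and used entries are vertices. -/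
theorem ctx_initState {off nb : ℕ → ℕ} (hG : IsInput G off nb) (lam : ℝ) {W : ℕ}
    (hW : n ^ 3 + n < W) : Ctx off nb n lam W (initState n lam off nb) := by
  refine ⟨rfl, rfl, rfl, rfl, fun x => ?_, fun A i => ?_⟩
  · simp only [initState]
    split_ifs <;> omega
  · have hoff : off n ≤ n ^ 3 := (off_le_size hG).trans (size_le G)
    simp only [initState]
    split_ifs
    · rcases le_or_gt i n with hi | hi
      · have := hG.adj.off_le hi le_rfl
        omega
      · rw [hG.off_unused i hi]
        omega
    · rcases le_or_gt (off n) i with hi | hi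
      · rw [hG.nb_unused i hi]
        omega
      · obtain ⟨u, hu, hu'⟩ := exists_row hG hi
        obtain ⟨j, hj, _⟩ := hG.adj.sound u i hu hu'
        omega
    · exact hW.trans_le' (Nat.zero_le _)

/-- Each phase costs a constant multiple of `size G` plus a constant. In the word bound, `4 * n ^ 3`
leaves room for the copy loop and the quadratic and linear terms for the grid of cells. -/
theorem wp_stcPeel {off nb : ℕ → ℕ} (hG : IsInput G off nb) {W : ℕ} {lam : ℝ} (hn : 1 ≤ n)
    (h0 : 0 ≤ lam) (h1 : lam ≤ 1) (hW : 4 * n ^ 3 + n * n + 3 * n + 3 ≤ W) :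
    WP W stcPeel (initState n lam off nb) fun t s' =>
      t ≤ 5000 * size G + 500 ∧ IsOutput G lam off nb s' := by
  have hc := ctx_initState hG lam (W := W) (by omega)
  set s := initState n lam off nb with hs
  have hsz := le_size G
  have hW' : (n + 1) * (n + 1) + n < W := by
    have : (n + 1) * (n + 1) = n * n + 2 * n + 1 := by ring
    omega
  rw [stcPeel, wp_seq]
  refine (wp_initFlags (by omega) hc).strengthen hc.bdd ?_
  rintro t₁ s₁ ⟨ht₁, hU₁⟩ hf₁ hb₁
  have hc₁ := hc.frame hf₁ hb₁ rfl rfl rfl rfl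
  have hclean : CleanOutside G s₁ := by
    intro u v _
    rw [hf₁.a 14 rfl, hf₁.a 16 rfl, hf₁.a 17 rfl]
    exact ⟨rfl, rfl, rfl⟩
  rw [wp_seq]
  refine (wp_apr hG (by omega) hc₁ hU₁ hclean).strengthen hb₁ ?_
  rintro t₂ s₂ ⟨ht₂, weak, hpost⟩ hf₂ hb₂
  rw [sub_univ] at hpost
  have hc₂ := hc₁.frame hf₂ hb₂ rfl rfl rfl rfl
  rw [wp_seq]
  refine (wp_copyOut hG (by omega) hc₂ hpost).strengthen hb₂ ?_
  rintro t₃ s₃ ⟨ht₃, hZ, hlab⟩ hf₃ hb₃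
  have hc₃ := hc₂.frame hf₃ hb₃ rfl rfl rfl rfl
  have h17 : IsEdgeMatrix weak (s₃.a 17) := by rw [hf₃.a 17 rfl]; exact hpost.matrix
  rw [wp_seq]
  refine (wp_initDegrees hG (by omega) hc₃ h17
    (fun u => by rw [hf₃.a 18 rfl, hf₂.a 18 rfl, hf₁.a 18 rfl]; rfl)
    (fun u => by rw [hf₃.a 19 rfl, hf₂.a 19 rfl, hf₁.a 19 rfl]; rfl)).strengthen hb₃ ?_
  rintro t₄ s₄ ⟨ht₄, hH, h18, h19⟩ hf₄ hb₄
  have hc₄ := hc₃.frame hf₄ hb₄ rfl rfl rfl rfl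
  rw [wp_seq]
  refine (wp_fillQueue h1 hW' hc₄ h18 h19
    (fun i => by rw [hf₄.a 20 rfl, hf₃.a 20 rfl, hf₂.a 20 rfl, hf₁.a 20 rfl]; rfl)
    (fun i => by rw [hf₄.ra 1 rfl, hf₃.ra 1 rfl, hf₂.ra 1 rfl, hf₁.ra 1 rfl]; rfl)).strengthen
    hb₄ ?_
  rintro t₅ s₅ ⟨ht₅, hQ⟩ hf₅ hb₅
  have hc₅ := hc₄.frame hf₅ hb₅ rfl rfl rfl rfl
  have hpeel : PeelState G weak lam Finset.univ s₅ := by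
    refine ⟨hQ, fun x _ => ?_, fun x _ => ?_, fun x => ?_⟩
    · rw [hf₅.a 18 rfl, h18]
    · rw [hf₅.a 19 rfl, h19]
    · rw [hf₅.a 24 rfl, hf₄.a 24 rfl, hf₃.a 24 rfl, hf₂.a 24 rfl, hf₁.a 24 rfl]
      simp [hs, initState]
  rw [wp_seq]
  refine (wp_peel hG h1 hW' hc₅ (by rw [hf₅.a 17 rfl, hf₄.a 17 rfl]; exact h17) hpeel).strengthen
    hb₅ ?_
  rintro t₆ s₆ ⟨ht₆, hrem⟩ hf₆ hb₆
  have hc₆ := hc₅.frame hf₆ hb₆ rfl rfl rfl rfl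
  obtain ⟨order, ho⟩ := hrem.exists_perm
  rw [wp_seq]
  refine (wp_findBest hn hc₆ (weight_nonneg weak h0) hrem).strengthen hb₆ ?_
  rintro t₇ s₇ ⟨ht₇, hk, hbest⟩ hf₇ hb₇
  have hc₇ := hc₆.frame hf₇ hb₇ rfl rfl rfl rfl
  rw [wp_seq]
  refine (wp_writeFlags (by omega) hc₇ (order := order)
    (by rw [hf₇.a 7 rfl]; exact ho)).strengthen hb₇ ?_
  rintro t₈ s₈ ⟨ht₈, hU⟩ hf₈ hb₈
  have hc₈ := hc₇.frame hf₈ hb₈ rfl rfl rfl rfl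
  set U := remaining order (s₇.w 30) with hUdef
  -- The matrices have not been written since the first labeling, which left them clean, so the
  -- second labeling can start without resetting them.
  have hclean₈ : CleanOutside G s₈ := by
    have h14 : s₈.a 14 = s₂.a 14 := by
      rw [hf₈.a 14 rfl, hf₇.a 14 rfl, hf₆.a 14 rfl, hf₅.a 14 rfl, hf₄.a 14 rfl, hf₃.a 14 rfl]
    have h16 : s₈.a 16 = s₂.a 16 := by
      rw [hf₈.a 16 rfl, hf₇.a 16 rfl, hf₆.a 16 rfl, hf₅.a 16 rfl, hf₄.a 16 rfl, hf₃.a 16 rfl]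
    have h17 : s₈.a 17 = s₂.a 17 := by
      rw [hf₈.a 17 rfl, hf₇.a 17 rfl, hf₆.a 17 rfl, hf₅.a 17 rfl, hf₄.a 17 rfl, hf₃.a 17 rfl]
    rw [CleanOutside, h14, h16, h17]
    exact hpost.clean
  refine (wp_apr hG (by omega) hc₈ hU hclean₈).strengthen hb₈ ?_
  rintro t₉ s₉ ⟨ht₉, weak', hpost'⟩ hf₉ hb₉
  have g2 : s₉.a 2 = s₃.a 2 := by
    rw [hf₉.a 2 rfl, hf₈.a 2 rfl, hf₇.a 2 rfl, hf₆.a 2 rfl, hf₅.a 2 rfl, hf₄.a 2 rfl]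
  have g3 : s₉.a 3 = s₃.a 3 := by
    rw [hf₉.a 3 rfl, hf₈.a 3 rfl, hf₇.a 3 rfl, hf₆.a 3 rfl, hf₅.a 3 rfl, hf₄.a 3 rfl]
  have g4 : s₉.a 4 = s₃.a 4 := by
    rw [hf₉.a 4 rfl, hf₈.a 4 rfl, hf₇.a 4 rfl, hf₆.a 4 rfl, hf₅.a 4 rfl, hf₄.a 4 rfl]
  have g5 : s₉.a 5 = s₃.a 5 := by
    rw [hf₉.a 5 rfl, hf₈.a 5 rfl, hf₇.a 5 rfl, hf₆.a 5 rfl, hf₅.a 5 rfl, hf₄.a 5 rfl]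
  have g6 : s₉.a 6 = s₃.a 6 := by
    rw [hf₉.a 6 rfl, hf₈.a 6 rfl, hf₇.a 6 rfl, hf₆.a 6 rfl, hf₅.a 6 rfl, hf₄.a 6 rfl]
  have hw1 : s₉.w 1 = s₃.w 1 := by
    rw [hf₉.w 1 rfl, hf₈.w 1 rfl, hf₇.w 1 rfl, hf₆.w 1 rfl, hf₅.w 1 rfl, hf₄.w 1 rfl]
  refine ⟨?_, weak, order, U, weak', ⟨hpost.label, hrem.isPeelOrder ho, ?_, hpost'.label⟩,
    ?_, ?_, ?_, ?_, ?_, hpost'.graph, ?_⟩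
  · have e₁ : ∑ u, (∑ _x ∈ nbrs G u, 60 + 18) ≤ 78 * size G :=
      sum_le_size G fun u => by simp only [Finset.sum_const, smul_eq_mul]; nlinarith
    have e₂ : ∑ u, (150 * ((nbrs G u).card + 1) + 60) ≤ 210 * size G :=
      sum_le_size G fun u => by
        have := Nat.le_self_pow (two_ne_zero) ((nbrs G u).card + 1)
        omega
    have e₃ := sum_removalTime_le G
    simp only [Finset.sum_const, Finset.card_univ, Fintype.card_fin, smul_eq_mul] at ht₁ ht₇ ht₈
    omega
  · refine ⟨⟨s₇.w 30, hk⟩, rfl, fun j => ?_⟩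
    have := hbest j j.2
    rwa [left_eq_remaining ho j.2.le, left_eq_remaining ho hk.le] at this
  · rw [hw1, g2, g3, g4, g5]
    exact hZ
  · rw [g6]
    exact hlab
  · rw [hf₉.ra 0 rfl, hf₈.ra 0 rfl, hf₇.ra 0 rfl, hf₆.ra 0 rfl, hf₅.ra 0 rfl]
    exact hH
  · rw [hf₉.a 7 rfl, hf₈.a 7 rfl, hf₇.a 7 rfl]
    exact ho
  · rw [hf₉.a 8 rfl]
    exact hU
  · exact fun u v huv => hpost'.edges u v (sub_le G U huv)

end Program

/-! ## The time bound -/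

section Bound

variable {n : ℕ}

theorem card_nbrs (G : SimpleGraph (Fin n)) (v : Fin n)
    [Fintype (G.neighborSet v)] : (nbrs G v).card = G.degree v := by
  rw [← SimpleGraph.card_neighborFinset_eq_degree]
  congr 1
  ext
  simp

/-- For `n ≥ 2` it suffices that `2 * log 2 > 1`; the summand `1` is for `n = 1`, where the
logarithm vanishes. -/
theorem le_mul_log_add_one (n : ℕ) : (n : ℝ) ≤ 2 * (n * Real.log n) + 1 := by
  rcases Nat.lt_or_ge n 2 with h | h
  · interval_cases n <;> simp
  · have h2 : Real.log 2 ≤ Real.log n := Real.log_le_log (by norm_num) (by exact_mod_cast h)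
    have := Real.log_two_gt_d9
    nlinarith [(Nat.cast_nonneg n : (0 : ℝ) ≤ n)]

/-- From `(d + 1)² ≤ 2d² + 2` the size is at most `2 Σ deg² + 2n`, and `2n ≤ 4 n log n + 2`. The
edge and wedge-graph terms are merely nonnegative. -/
theorem size_le_timeBound (G : SimpleGraph (Fin n)) : (size G : ℝ) ≤ 4 * (timeBound G + 1) := by
  classical
  have h1 : (size G : ℝ) ≤ ∑ v, (2 * (G.degree v : ℝ) ^ 2 + 2) := by
    rw [size]
    push_cast
    refine Finset.sum_le_sum fun v _ => ?_
    rw [card_nbrs]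
    nlinarith [sq_nonneg ((G.degree v : ℝ) - 1)]
  rw [Finset.sum_add_distrib, ← Finset.mul_sum] at h1
  simp only [Finset.sum_const, Finset.card_univ, Fintype.card_fin, nsmul_eq_mul] at h1
  have h2 := le_mul_log_add_one n
  have h3 : ∑ v, (G.degree v : ℝ) ^ 2 + n * Real.log n ≤ timeBound G := by
    simp only [timeBound, ← card_nbrs]
    have : (0 : ℝ) ≤ G.edgeSet.ncard := Nat.cast_nonneg _
    have : (0 : ℝ) ≤ (wedgeGraph G).edgeSet.ncard := Nat.cast_nonneg _
    have : (0 : ℝ) ≤ (wedgeVerts G).ncard := Nat.cast_nonneg _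
    linarith
  have h4 : 0 ≤ ∑ v, (G.degree v : ℝ) ^ 2 := Finset.sum_nonneg fun v _ => sq_nonneg _
  linarith

theorem ncard_wedgeVerts_le (G : SimpleGraph (Fin n)) :
    (wedgeVerts G).ncard ≤ G.edgeSet.ncard := by
  refine Set.ncard_le_ncard ?_ (Set.toFinite _)
  rintro e ⟨x, y, z, h, rfl | rfl⟩
  exacts [h.1, h.2.1]

/-- Each edge of the wedge graph comes from a centre and an ordered pair of its neighbours, so the
set of such triples maps onto a set containing all these edges. -/
theorem ncard_edgeSet_wedgeGraph_le (G : SimpleGraph (Fin n)) :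
    (wedgeGraph G).edgeSet.ncard ≤ ∑ v, (nbrs G v).card ^ 2 := by
  classical
  let T : Finset (Σ _ : Fin n, Fin n × Fin n) :=
    Finset.univ.sigma fun y => nbrs G y ×ˢ nbrs G y
  have hT : T.card = ∑ v, (nbrs G v).card ^ 2 := by
    simp [T, Finset.card_sigma, sq]
  let φ : (Σ _ : Fin n, Fin n × Fin n) → Sym2 (Sym2 (Fin n)) :=
    fun t => s(s(t.2.1, t.1), s(t.1, t.2.2))
  have hinj : Function.Injective (Sym2.map (Subtype.val : wedgeVerts G → Sym2 (Fin n))) :=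
    Sym2.map.injective Subtype.val_injective
  rw [← Set.ncard_image_of_injective _ hinj, ← hT]
  refine (Set.ncard_le_ncard (t := (T.image φ : Finset _)) ?_ (Set.toFinite _)).trans ?_
  · rintro _ ⟨e, he, rfl⟩
    induction e with
    | _ e f =>
      obtain ⟨x, y, z, h, h1, h2⟩ := he
      rw [Finset.mem_coe, Finset.mem_image]
      refine ⟨⟨y, x, z⟩, ?_, ?_⟩
      · simp [T, h.1.symm, h.2.1]
      · simp only at h1 h2
        simp [φ, h1, h2]
  · rw [Set.ncard_coe_finset]
    exact Finset.card_image_le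

theorem sum_card_nbrs_sq_le (G : SimpleGraph (Fin n)) :
    ∑ v, (nbrs G v).card ^ 2 ≤ 2 * (n * G.edgeSet.ncard) := by
  classical
  have h1 : ∑ v, (nbrs G v).card ^ 2 ≤ ∑ v, n * G.degree v := by
    refine Finset.sum_le_sum fun v _ => ?_
    rw [sq]
    refine Nat.mul_le_mul ((Finset.card_le_univ _).trans (by simp)) (card_nbrs G v).le
  rw [← Finset.mul_sum, G.sum_degrees_eq_twice_card_edges, ← Set.ncard_coe_finset,
    SimpleGraph.coe_edgeFinset] at h1
  linarith

/-- The constant collects `2` from `Σ deg²`, `1` from `m`, `K` from `n log n`, `2` from `m'` and `1`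
from `n'`, each multiplied by `nm`. -/
theorem timeBound_le {K : ℝ} (G : SimpleGraph (Fin n))
    (h : Real.log n ≤ K * (G.edgeSet.ncard : ℝ)) :
    timeBound G ≤ (K + 6) * ((n : ℝ) * (G.edgeSet.ncard : ℝ)) := by
  classical
  have h1 : (∑ v, ((nbrs G v).card : ℝ) ^ 2) ≤ 2 * (n * G.edgeSet.ncard) := by
    exact_mod_cast sum_card_nbrs_sq_le G
  have h2 : ((wedgeGraph G).edgeSet.ncard : ℝ) ≤ ∑ v, ((nbrs G v).card : ℝ) ^ 2 := by
    exact_mod_cast ncard_edgeSet_wedgeGraph_le G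
  have h3 : ((wedgeVerts G).ncard : ℝ) ≤ G.edgeSet.ncard := by
    exact_mod_cast ncard_wedgeVerts_le G
  have h4 : (G.edgeSet.ncard : ℝ) ≤ n * G.edgeSet.ncard := by
    rcases Nat.eq_zero_or_pos n with rfl | hn
    · have : G.edgeSet = ∅ := Set.eq_empty_of_isEmpty _
      simp [this]
    · exact le_mul_of_one_le_left (Nat.cast_nonneg _) (by exact_mod_cast hn)
  have h5 : n * Real.log n ≤ K * ((n : ℝ) * G.edgeSet.ncard) := by
    have := mul_le_mul_of_nonneg_left h (Nat.cast_nonneg n : (0 : ℝ) ≤ n)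
    linarith
  simp only [timeBound, ← card_nbrs]
  linarith

end Bound

end STCPeel

theorem mainTheorem10 :
    (∃ (P : STCPeel.Cmd) (k : ℕ) (C : ℝ), ∀ (n : ℕ), 1 ≤ n → ∀ (G : SimpleGraph (Fin n)) (lam : ℝ),
      0 ≤ lam → lam ≤ 1 → ∀ off nb : ℕ → ℕ, STCPeel.IsInput G off nb →
        ∃ (t : ℕ) (s : STCPeel.State),
          STCPeel.Exec ((n + 2) ^ k) P (STCPeel.initState n lam off nb) t s ∧
          STCPeel.IsOutput G lam off nb s ∧
          (t : ℝ) ≤ C * (STCPeel.timeBound G + 1)) ∧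
    (∀ K : ℝ, ∃ C : ℝ, ∀ (n : ℕ) (G : SimpleGraph (Fin n)),
      Real.log n ≤ K * (G.edgeSet.ncard : ℝ) →
        STCPeel.timeBound G ≤ C * ((n : ℝ) * (G.edgeSet.ncard : ℝ))) := by
  -- As `size G ≥ 1`, the step count is at most `5500 * size G`, and `5500 * 4 = 22000`. The
  -- exponent `5` suffices, since the coefficients of `(n + 2) ^ 5` dominate those of the required
  -- word bound.
  refine ⟨⟨STCPeel.stcPeel, 5, 22000, fun n hn G lam h0 h1 off nb hG => ?_⟩,
    fun K => ⟨K + 6, fun n G h => STCPeel.timeBound_le G h⟩⟩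
  have hW : 4 * n ^ 3 + n * n + 3 * n + 3 ≤ (n + 2) ^ 5 := by
    ring_nf
    have : n ≤ n ^ 2 := Nat.le_self_pow (by norm_num) n
    omega
  obtain ⟨t, s, he, ht, ho⟩ := STCPeel.wp_stcPeel hG hn h0 h1 hW
  refine ⟨t, s, he, ho, ?_⟩
  have h2 := STCPeel.size_le_timeBound G
  have h3 : (t : ℝ) ≤ 5000 * STCPeel.size G + 500 := by exact_mod_cast ht
  have h4 : (1 : ℝ) ≤ STCPeel.size G := by exact_mod_cast hn.trans (STCPeel.le_size G)
  linarith
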